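/- Notation. Maps act from the right, so $\sigma\tau$ means first $\sigma$, then $\tau$. A labeling of a finite set $V$ with $n$ elements is a bijection $V\to\{1,\dots,n\}$; a labeling coset of $V$ is a set of labelings of the form $\tau\Theta=\{\tau\theta\mid\theta\in\Theta\}$ with a labeling $\tau$ of $V$ and a subgroup $\Theta\le\operatorname{Sym}(\{1,\dots,n\})$. A colored family of labeling cosets is $X=(V,\mathcal F,\chi)$ with a set $\mathcal F=\{\tau_1\Theta_1,\dots,\tau_t\Theta_t\}$ of $t=|\mathcal F|$ labeling cosets of $V$ and a coloring $\chi:\mathcal F\to\mathbb N$. For a bijection $\sigma:V\to W$ and a labeling coset $\Lambda$ of $V$ put $\Lambda^\sigma=\sigma^{-1}\Lambda$, and let $X^\sigma$ be the family on $W$ that consists of the cosets $(\tau_i\Theta_i)^\sigma$, each with the color $\chi(\tau_i\Theta_i)$. For a labeling coset $\Lambda=\tau\Delta$ of $V$ let $\operatorname{Aut}(X;\Lambda)=\{\sigma\in\Lambda\Lambda^{-1}=\tau\Delta\tau^{-1}\mid X^\sigma=X\}$. (The case $V=\{1,\dots,n\}$, $\tau=\mathrm{id}$, $\Lambda=\Delta\le\operatorname{Sym}(V)$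 is included.) Theorem. There is a map $\operatorname{CL}$ that assigns to every finite set $V$, every colored family of labeling cosets $X=(V,\mathcal F,\chi)$ and every labeling coset $\Lambda=\tau\Delta$ of $V$ a labeling coset $\operatorname{CL}(X;\Lambda)$ of $V$ such that 1. $\operatorname{CL}(X;\Lambda)\subseteq\Lambda$; 2. $\operatorname{CL}(X;\Lambda)=\sigma\operatorname{CL}(X^\sigma;\Lambda^\sigma)$ for every bijection $\sigma:V\to W$; 3. $\operatorname{CL}(X;\Lambda)=\operatorname{Aut}(X;\Lambda)\,\pi$ for every $\pi\in\operatorname{CL}(X;\Lambda)$; and there is an algorithm that computes $\operatorname{CL}$ in the following sense. Labeling cosets $\tau\Theta$ are given by $\tau$ and a list of generators of $\Theta$, permutations being given by their tables with respect to a numbering of $V$. Given $\Lambda$, the list of the (pairwise distinct) members of $\mathcal F$, and their colors, the algorithm outputs a labeling and a list of generators that represent $\operatorname{CL}(X;\Lambda)$. For some constant $d$ the output has at most $(|V|+2)^d$ generators, and the number of steps is at most $$|V|!\cdot(|V|+|\mathcal F|+2)^d+(L+2)^d ,$$ where $L$ is the length of the input, i.e. the number of natural numbers of which it consists. (Hence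 the running time is $|V|!\cdot(|V|+|\mathcal F|+2)^{O(1)}$ whenever the given lists of generators have length polynomial in $|V|+|\mathcal F|$.) Here an algorithm is a program for a random access machine over the natural numbers with unit-cost instructions: set to zero, copy, successor, predecessor, indirect load and store, and comparison of two registers. -/

import Mathlib

universe u v

/-! ### Labelings and labeling cosets

Maps are composed from left to right: the product `στ` (first `σ`, then `τ`) is `σ.trans τ`.
The label set `{1, …, n}` is `Fin n`. -/

/-- A labeling of the `n`-element set `V`: a bijection from `V` to the label set. -/
abbrev Labeling (V : Type u) (n : ℕ) : Type u := V ≃ Fin n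

/-- The set `τΘ = {τθ | θ ∈ Θ}`. -/
def cosetSet {V : Type u} {n : ℕ} (τ : Labeling V n) (Θ : Subgroup (Equiv.Perm (Fin n))) :
    Set (Labeling V n) :=
  {ρ | ∃ θ ∈ Θ, ρ = τ.trans θ}

/-- A labeling coset of `V`: a set of labelings of the form `τΘ`. -/
@[ext]
structure LabelingCoset (V : Type u) (n : ℕ) where
  carrier : Set (Labeling V n)
  isCoset : ∃ (τ : Labeling V n) (Θ : Subgroup (Equiv.Perm (Fin n))), carrier = cosetSet τ Θ

/-- The image `Λ^σ = σ⁻¹Λ` of a labeling coset under a bijection `σ : V → W`. -/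
def LabelingCoset.map {V : Type u} {W : Type v} {n : ℕ} (σ : V ≃ W) (Λ : LabelingCoset V n) :
    LabelingCoset W n where
  carrier := {ρ | ∃ lam ∈ Λ.carrier, ρ = σ.symm.trans lam}
  isCoset := by
    obtain ⟨τ, Θ, h⟩ := Λ.isCoset
    refine ⟨σ.symm.trans τ, Θ, ?_⟩
    ext ρ
    simp only [h, cosetSet, Set.mem_ofPred_eq]
    constructor
    · rintro ⟨lam, ⟨θ, hθ, rfl⟩, rfl⟩
      exact ⟨θ, hθ, rfl⟩
    · rintro ⟨θ, hθ, rfl⟩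
      exact ⟨τ.trans θ, ⟨θ, hθ, rfl⟩, rfl⟩

/-- A colored family of labeling cosets of `V`, that is, a set `F` of labeling cosets with a
coloring `χ : F → ℕ`, given as the partial function `χ`: `X A = some k` says that `A ∈ F` and
`χ(A) = k`, and `X A = none` says that `A ∉ F`. -/
def ColoredFamily (V : Type u) (n : ℕ) : Type u := LabelingCoset V n → Option ℕ

/-- The number `|F|` of cosets in the family. -/
noncomputable def ColoredFamily.card {V : Type u} {n : ℕ} (X : ColoredFamily V n) : ℕ :=
  Set.ncard {A : LabelingCoset V n | X A ≠ none}

/-- The image `X^σ` under a bijection `σ : V → W`: the family of all `A^σ`, `A ∈ F`, where `A^σ`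
has the color of `A`. -/
def ColoredFamily.map {V : Type u} {W : Type v} {n : ℕ} (σ : V ≃ W) (X : ColoredFamily V n) :
    ColoredFamily W n :=
  fun B => X (B.map σ.symm)

/-- The automorphisms of `X` relative to `Λ = τΔ`: the permutations `σ` of `V` with `X^σ = X`
that lie in the group `ΛΛ⁻¹ = τΔτ⁻¹`. -/
def relAut {V : Type u} {n : ℕ} (X : ColoredFamily V n) (Λ : LabelingCoset V n) :
    Set (Equiv.Perm V) :=
  {σ | X.map σ = X ∧ ∃ lam ∈ Λ.carrier, ∃ mu ∈ Λ.carrier, σ = lam.trans mu.symm}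

/-- `CL` assigns to every colored family of labeling cosets `X` and every labeling coset `Λ` of
the same set `V` a canonical labeling coset of `(X; Λ)`. -/
structure IsCanonicalLabeling
    (CL : ∀ (V : Type u) (n : ℕ), ColoredFamily V n → LabelingCoset V n → LabelingCoset V n) :
    Prop where
  /-- `CL(X; Λ) ⊆ Λ`. -/
  subset : ∀ (V : Type u) (n : ℕ) (X : ColoredFamily V n) (Λ : LabelingCoset V n),
    (CL V n X Λ).carrier ⊆ Λ.carrier
  /-- `CL(X^σ; Λ^σ) = σ⁻¹ CL(X; Λ)` for every bijection `σ : V → W`. -/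
  canonical : ∀ (V W : Type u) (n : ℕ) (σ : V ≃ W) (X : ColoredFamily V n)
    (Λ : LabelingCoset V n), CL W n (X.map σ) (Λ.map σ) = (CL V n X Λ).map σ
  /-- `CL(X; Λ) = Aut(X; Λ)π` for every `π ∈ CL(X; Λ)`. -/
  eq_aut : ∀ (V : Type u) (n : ℕ) (X : ColoredFamily V n) (Λ : LabelingCoset V n),
    ∀ π ∈ (CL V n X Λ).carrier,
      (CL V n X Λ).carrier = {ρ | ∃ σ ∈ relAut X Λ, ρ = σ.trans π}

/-! ### Random access machines

The machine has registers and a memory, both holding natural numbers. Its only arithmetic is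
successor and predecessor, so at unit cost a number grows by at most one per step. -/

/-- Programs of the machine. -/
inductive Prog : Type
  | zero (x : ℕ) : Prog
  | copy (x y : ℕ) : Prog
  | succ (x : ℕ) : Prog
  | pred (x : ℕ) : Prog
  | load (x y : ℕ) : Prog
  | store (x y : ℕ) : Prog
  | seq (p q : Prog) : Prog
  | ifLt (x y : ℕ) (p q : Prog) : Prog
  | whileLt (x y : ℕ) (p : Prog) : Prog

/-- Configurations: contents of the registers and of the memory cells. -/
structure RamState : Type where
  reg : ℕ → ℕ
  mem : ℕ → ℕ

/-- Write a register. -/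
def RamState.setReg (s : RamState) (x a : ℕ) : RamState :=
  ⟨Function.update s.reg x a, s.mem⟩

/-- Write a memory cell. -/
def RamState.setMem (s : RamState) (i a : ℕ) : RamState :=
  ⟨s.reg, Function.update s.mem i a⟩

/-- `Exec p s k s'`: the program `p`, started in `s`, halts in `s'` after exactly `k` steps.
Every elementary instruction and every comparison is one step. -/
inductive Exec : Prog → RamState → ℕ → RamState → Prop
  | zero (s : RamState) (x : ℕ) : Exec (.zero x) s 1 (s.setReg x 0)
  | copy (s : RamState) (x y : ℕ) : Exec (.copy x y) s 1 (s.setReg x (s.reg y))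
  | succ (s : RamState) (x : ℕ) : Exec (.succ x) s 1 (s.setReg x (s.reg x + 1))
  | pred (s : RamState) (x : ℕ) : Exec (.pred x) s 1 (s.setReg x (s.reg x - 1))
  | load (s : RamState) (x y : ℕ) : Exec (.load x y) s 1 (s.setReg x (s.mem (s.reg y)))
  | store (s : RamState) (x y : ℕ) : Exec (.store x y) s 1 (s.setMem (s.reg x) (s.reg y))
  | seq {p q : Prog} {s s' s'' : RamState} {k l : ℕ} (hp : Exec p s k s')
      (hq : Exec q s' l s'') : Exec (.seq p q) s (k + l) s''
  | ifTrue {x y : ℕ} {p q : Prog} {s s' : RamState} {k : ℕ} (h : s.reg x < s.reg y)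
      (hp : Exec p s k s') : Exec (.ifLt x y p q) s (k + 1) s'
  | ifFalse {x y : ℕ} {p q : Prog} {s s' : RamState} {k : ℕ} (h : ¬ s.reg x < s.reg y)
      (hq : Exec q s k s') : Exec (.ifLt x y p q) s (k + 1) s'
  | whileDone {x y : ℕ} {p : Prog} {s : RamState} (h : ¬ s.reg x < s.reg y) :
      Exec (.whileLt x y p) s 1 s
  | whileStep {x y : ℕ} {p : Prog} {s s' s'' : RamState} {k l : ℕ} (h : s.reg x < s.reg y)
      (hp : Exec p s k s') (hw : Exec (.whileLt x y p) s' l s'') :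
      Exec (.whileLt x y p) s (k + l + 1) s''

/-- The initial configuration on an input word: the input stands at the beginning of the memory,
everything else is zero. -/
def initialState (w : List ℕ) : RamState :=
  ⟨fun _ => 0, fun i => w.getD i 0⟩

/-- The word `w` stands in the memory from the address in register `0` on. -/
def HoldsOutput (s : RamState) (w : List ℕ) : Prop :=
  ∀ i : Fin w.length, s.mem (s.reg 0 + i) = w.get i

/-! ### Encodings -/

/-- The table `π(0), …, π(n-1)` of a permutation. -/
def permWord {n : ℕ} (π : Equiv.Perm (Fin n)) : List ℕ :=
  List.ofFn fun i => (π i : ℕ)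

/-- A labeling coset `τΘ` given by `τ` and a list of generators of `Θ`. -/
structure CosetCode (n : ℕ) : Type where
  rep : Equiv.Perm (Fin n)
  gens : List (Equiv.Perm (Fin n))

/-- The labeling coset of `V` denoted by a code, where `ν` numbers the elements of `V`. -/
def CosetCode.toCoset {V : Type u} {n : ℕ} (ν : V ≃ Fin n) (c : CosetCode n) :
    LabelingCoset V n where
  carrier := cosetSet (ν.trans c.rep) (Subgroup.closure {g | g ∈ c.gens})
  isCoset := ⟨_, _, rfl⟩

/-- The word of a coset code: `τ`, the number of generators, the generators. -/
def CosetCode.word {n : ℕ} (c : CosetCode n) : List ℕ :=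
  permWord c.rep ++ c.gens.length :: c.gens.flatMap permWord

/-- The input: the labeling coset `Λ`, and a list of the cosets of the family with their
colors. -/
structure InputCode (n : ℕ) : Type where
  bound : CosetCode n
  members : List (CosetCode n × ℕ)

/-- The word of an input: `n`, the coset `Λ`, the number of cosets of the family, and for each of
them the coset and its color. -/
def InputCode.word {n : ℕ} (c : InputCode n) : List ℕ :=
  n :: (c.bound.word ++ c.members.length :: c.members.flatMap fun m => m.1.word ++ [m.2])

/-- `c` encodes the pair `(X; Λ)`, where `ν` numbers the elements of `V`. Each coset of the family
is listed exactly once. -/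
structure InputCode.Encodes {V : Type u} {n : ℕ} (c : InputCode n) (ν : V ≃ Fin n)
    (X : ColoredFamily V n) (Λ : LabelingCoset V n) : Prop where
  bound_eq : c.bound.toCoset ν = Λ
  nodup : (c.members.map fun m => m.1.toCoset ν).Nodup
  family_iff : ∀ (A : LabelingCoset V n) (k : ℕ),
    X A = some k ↔ ∃ m ∈ c.members, m.1.toCoset ν = A ∧ m.2 = k

/-! A labeling `ρ` carries `X` to a family `X^ρ` on the label set. Suppose that every family on the
label set has a word that determines it. Let `CL(X; Λ)` consist of the `ρ ∈ Λ` for which the word of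
`X^ρ` is smallest (`minimalLabelings`). All of them yield the same family, so any two differ by an
element of `Aut(X; Λ)`, and conversely; hence the set is a labeling coset and satisfies condition 3.
No numbering of `V` enters, hence condition 2.

The word of a family is the sorted list of the words of its colored members, so a canonical word for
a coset of a permutation group given by generators is needed. In the manner of Schreier and Sims,
`build` makes a table that provides, for every level `j` and every `x` in the orbit of `j` under the
stabilizer of the points below `j`, an element of that stabilizer that takes `j` to `x`. It suffices
that all products of two entries sift to the identity (`IsClosedTable.isTable`), and the table never
has more than `n * n` entries (`Slotted.length_le`). A greedy choice, level by level, gives a coset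
representative that depends on the coset alone (`IsTable.canon_eq`). Applied to the cosets of the
successive stabilizers it gives a normal form of the group (`IsTable.normalForm_eq`,
`IsTable.normalForm_isTable`). So the word determines the family (`ColoredFamily.word_injective`).

The algorithm tries all `n!` labelings. It keeps the smallest word found in `Λ`, a labeling with
this word, and a table of the group generated by the automorphisms found (`SearchInv.step`).
Relabeling changes only the representative of a coset and not its group (`toCoset_map`), so the
tables are made once, in time polynomial in the input length; afterwards each labeling costs time
polynomial in `n + |F|`. This explains the two summands of the bound.

The machine programs come from a calculus of functions on trees in memory: `RT` counts steps, `T`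
asks for polynomial time in a parameter, and `TF` allows an additional factor such as `n!`. All
loops of the calculus run over lists. -/

/-! ### Total correctness with a bound on the number of steps -/

/-- `p`, started in `s`, halts after at most `K` steps in a state that satisfies `Q`. -/
def Steps (p : Prog) (s : RamState) (K : ℕ) (Q : RamState → Prop) : Prop :=
  ∃ k s', Exec p s k s' ∧ k ≤ K ∧ Q s'

namespace Steps

variable {p q : Prog} {s : RamState} {K L : ℕ} {Q R : RamState → Prop}

theorem mono (h : Steps p s K Q) (hK : K ≤ L) (hQ : ∀ s', Q s' → R s') : Steps p s L R := by
  obtain ⟨k, s', he, hk, hq⟩ := h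
  exact ⟨k, s', he, hk.trans hK, hQ _ hq⟩

theorem zero {x : ℕ} (h : Q (s.setReg x 0)) : Steps (.zero x) s 1 Q :=
  ⟨_, _, .zero _ _, le_rfl, h⟩

theorem copy {x y : ℕ} (h : Q (s.setReg x (s.reg y))) : Steps (.copy x y) s 1 Q :=
  ⟨_, _, .copy _ _ _, le_rfl, h⟩

theorem succ {x : ℕ} (h : Q (s.setReg x (s.reg x + 1))) : Steps (.succ x) s 1 Q :=
  ⟨_, _, .succ _ _, le_rfl, h⟩

theorem pred {x : ℕ} (h : Q (s.setReg x (s.reg x - 1))) : Steps (.pred x) s 1 Q :=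
  ⟨_, _, .pred _ _, le_rfl, h⟩

theorem load {x y : ℕ} (h : Q (s.setReg x (s.mem (s.reg y)))) : Steps (.load x y) s 1 Q :=
  ⟨_, _, .load _ _ _, le_rfl, h⟩

theorem store {x y : ℕ} (h : Q (s.setMem (s.reg x) (s.reg y))) : Steps (.store x y) s 1 Q :=
  ⟨_, _, .store _ _ _, le_rfl, h⟩

theorem seq (hp : Steps p s K R) (hq : ∀ s', R s' → Steps q s' L Q) :
    Steps (.seq p q) s (K + L) Q := by
  obtain ⟨k, s', he, hk, hr⟩ := hp
  obtain ⟨l, s'', he', hl, hQ⟩ := hq s' hr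
  exact ⟨_, _, .seq he he', Nat.add_le_add hk hl, hQ⟩

theorem ifLt {x y : ℕ} (h₁ : s.reg x < s.reg y → Steps p s K Q)
    (h₂ : ¬ s.reg x < s.reg y → Steps q s K Q) : Steps (.ifLt x y p q) s (K + 1) Q := by
  by_cases h : s.reg x < s.reg y
  · obtain ⟨k, s', he, hk, hQ⟩ := h₁ h
    exact ⟨_, _, .ifTrue h he, Nat.add_le_add_right hk 1, hQ⟩
  · obtain ⟨k, s', he, hk, hQ⟩ := h₂ h
    exact ⟨_, _, .ifFalse h he, Nat.add_le_add_right hk 1, hQ⟩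

/-- The invariant of a loop is indexed by the number of iterations still to come. -/
theorem whileLt {x y : ℕ} {Inv : ℕ → RamState → Prop}
    (hstep : ∀ k s, Inv (k + 1) s → s.reg x < s.reg y ∧ Steps p s K (Inv k))
    (hdone : ∀ s, Inv 0 s → ¬ s.reg x < s.reg y) (N : ℕ) :
    ∀ s, Inv N s → Steps (.whileLt x y p) s (N * (K + 1) + 1) (Inv 0) := by
  induction N with
  | zero => exact fun s h => ⟨_, _, .whileDone (hdone s h), by omega, h⟩
  | succ N ih =>
    intro s h
    obtain ⟨hlt, k, s', he, hk, h'⟩ := hstep N s h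
    obtain ⟨l, s'', he', hl, h''⟩ := ih s' h'
    refine ⟨_, _, .whileStep hlt he he', ?_, h''⟩
    rw [Nat.add_mul]
    omega

end Steps

@[simp] theorem RamState.setReg_mem (s : RamState) (x a : ℕ) : (s.setReg x a).mem = s.mem := rfl

@[simp] theorem RamState.setMem_reg (s : RamState) (x a : ℕ) : (s.setMem x a).reg = s.reg := rfl

@[simp] theorem RamState.setReg_reg_self (s : RamState) (x a : ℕ) :
    (s.setReg x a).reg x = a := by
  simp [RamState.setReg]

theorem RamState.setReg_reg_ne (s : RamState) {x y : ℕ} (a : ℕ) (h : y ≠ x) :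
    (s.setReg x a).reg y = s.reg y := by
  simp [RamState.setReg, h]

@[simp] theorem RamState.setMem_mem_self (s : RamState) (x a : ℕ) :
    (s.setMem x a).mem x = a := by
  simp [RamState.setMem]

theorem RamState.setMem_mem_ne (s : RamState) {x y : ℕ} (a : ℕ) (h : y ≠ x) :
    (s.setMem x a).mem y = s.mem y := by
  simp [RamState.setMem, h]

/-! ### Trees in the memory of the machine -/

/-- Binary trees with natural numbers at the leaves. -/
inductive Data : Type
  | atom (a : ℕ) : Data
  | cons (a b : Data) : Data

/-- The number `v` represents the tree in the memory `mem` below the address `hp`. -/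
def TreeAt (mem : ℕ → ℕ) (hp : ℕ) : ℕ → Data → Prop
  | v, .atom a => v = a
  | v, .cons a b => 0 < v ∧ v + 1 < hp ∧ TreeAt mem hp (mem v) a ∧ TreeAt mem hp (mem (v + 1)) b

/-- Cells are allocated at the heap pointer and never overwritten or freed. A tree therefore
survives every later computation, and subtrees may be shared. -/
theorem TreeAt.mono {mem mem' : ℕ → ℕ} {hp hp' : ℕ} (hle : hp ≤ hp')
    (hmem : ∀ a < hp, mem' a = mem a) {v : ℕ} {d : Data} (h : TreeAt mem hp v d) :
    TreeAt mem' hp' v d := by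
  induction d generalizing v with
  | atom a => exact h
  | cons a b iha ihb =>
    obtain ⟨h0, h1, ha, hb⟩ := h
    refine ⟨h0, h1.trans_le hle, ?_, ?_⟩
    · rw [hmem v (by omega)]; exact iha ha
    · rw [hmem (v + 1) h1]; exact ihb hb

/-- Register `r` holds the tree `d`. Register `0` is the heap pointer. -/
def Holds (s : RamState) (r : ℕ) (d : Data) : Prop :=
  TreeAt s.mem (s.reg 0) (s.reg r) d

/-- What a program that works in the registers from `m` on leaves unchanged. -/
structure Frame (m : ℕ) (s s' : RamState) : Prop where
  pos : 0 < s.reg 0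
  hp : s.reg 0 ≤ s'.reg 0
  mem : ∀ a < s.reg 0, s'.mem a = s.mem a
  reg : ∀ r, 0 < r → r < m → s'.reg r = s.reg r

theorem Frame.pos' {m : ℕ} {s s' : RamState} (h : Frame m s s') : 0 < s'.reg 0 :=
  h.pos.trans_le h.hp

theorem Frame.trans {m m' k : ℕ} {s s' s'' : RamState} (h : Frame m s s') (h' : Frame m' s' s'')
    (hk : k ≤ m := by omega) (hk' : k ≤ m' := by omega) : Frame k s s'' :=
  ⟨h.pos, h.hp.trans h'.hp,
    fun a ha => (h'.mem a (ha.trans_le h.hp)).trans (h.mem a ha),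
    fun r h0 hr => (h'.reg r h0 (hr.trans_le hk')).trans (h.reg r h0 (hr.trans_le hk))⟩

theorem Holds.frame {m r : ℕ} {s s' : RamState} {d : Data} (h : Holds s r d) (hf : Frame m s s')
    (hr : 0 < r := by omega) (hm : r < m := by omega) : Holds s' r d := by
  unfold Holds
  rw [hf.reg r hr hm]
  exact TreeAt.mono hf.hp hf.mem h

theorem Frame.setReg {m x a : ℕ} {s : RamState} (h : 0 < s.reg 0) (hx : 0 < x := by omega)
    (hm : m ≤ x := by omega) : Frame m s (s.setReg x a) := by
  refine ⟨h, ?_, fun _ _ => rfl, fun r _ hr => RamState.setReg_reg_ne _ _ (by omega)⟩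
  rw [RamState.setReg_reg_ne _ _ (by omega)]

theorem Holds.setReg_self {x : ℕ} {v : ℕ} {s : RamState} {d : Data}
    (h : TreeAt s.mem (s.reg 0) v d) (hx : 0 < x := by omega) : Holds (s.setReg x v) x d := by
  unfold Holds
  rw [RamState.setReg_reg_self, RamState.setReg_reg_ne _ _ (by omega)]
  exact h

theorem Holds.setReg_ne {x y : ℕ} {v : ℕ} {s : RamState} {d : Data}
    (h : Holds s y d) (hx : 0 < x := by omega) (hy : y ≠ x := by omega) :
    Holds (s.setReg x v) y d := by
  unfold Holds
  rw [RamState.setReg_reg_ne _ _ hy, RamState.setReg_reg_ne _ _ (by omega)]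
  exact h

theorem Steps.copy_holds {x y : ℕ} {s : RamState} {d : Data} (hs : 0 < s.reg 0)
    (h : Holds s y d) (hx : 0 < x := by omega) :
    Steps (.copy x y) s 1 fun s' => Frame x s s' ∧ Holds s' x d :=
  .copy ⟨.setReg hs, .setReg_self h⟩

/-- Allocate a cell with the contents of registers `a` and `b`, and put its address into `x`. -/
def Prog.alloc (x a b : ℕ) : Prog :=
  .seq (.copy x 0) (.seq (.store 0 a) (.seq (.succ 0) (.seq (.store 0 b) (.succ 0))))

theorem Steps.alloc {x a b : ℕ} {s : RamState} {d e : Data} (hs : 0 < s.reg 0)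
    (ha : Holds s a d) (hb : Holds s b e) (ha0 : 0 < a := by omega) (hb0 : 0 < b := by omega)
    (hax : a < x := by omega) (hbx : b < x := by omega) :
    Steps (.alloc x a b) s 5 fun s' => Frame x s s' ∧ Holds s' x (.cons d e) := by
  refine .seq (K := 1) (L := 4) (.copy rfl) ?_
  rintro _ rfl
  refine .seq (K := 1) (L := 3) (.store rfl) ?_
  rintro _ rfl
  refine .seq (K := 1) (L := 2) (.succ rfl) ?_
  rintro _ rfl
  refine .seq (K := 1) (L := 1) (.store rfl) ?_
  rintro _ rfl
  refine .succ ?_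
  have e0 : (0 : ℕ) ≠ x := by omega
  have ea : a ≠ x := by omega
  have eb : b ≠ x := by omega
  have ha' : a ≠ 0 := by omega
  have hb' : b ≠ 0 := by omega
  have hx' : x ≠ 0 := by omega
  simp only [RamState.setReg_reg_self, RamState.setMem_reg, RamState.setReg_reg_ne _ _ e0,
    RamState.setReg_reg_ne _ _ ea, RamState.setReg_reg_ne _ _ hb', RamState.setReg_reg_ne _ _ eb]
  set h := s.reg 0 with hh
  have hmem : ∀ c < h, ((((s.setReg x h).setMem h (s.reg a)).setReg 0 (h + 1)).setMem (h + 1)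
      (s.reg b)).mem c = s.mem c := by
    intro c hc
    rw [RamState.setMem_mem_ne _ _ (by omega), RamState.setReg_mem,
      RamState.setMem_mem_ne _ _ (by omega), RamState.setReg_mem]
  refine ⟨⟨hs, ?_, hmem, ?_⟩, ?_⟩
  · rw [RamState.setReg_reg_self]; omega
  · intro r hr hrx
    rw [RamState.setReg_reg_ne _ _ (by omega), RamState.setMem_reg,
      RamState.setReg_reg_ne _ _ (by omega), RamState.setMem_reg,
      RamState.setReg_reg_ne _ _ (by omega)]
  · unfold Holds
    rw [RamState.setReg_reg_self, RamState.setReg_reg_ne _ _ hx', RamState.setMem_reg,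
      RamState.setReg_reg_ne _ _ hx', RamState.setMem_reg, RamState.setReg_reg_self]
    refine ⟨hs, by omega, ?_, ?_⟩
    · rw [RamState.setReg_mem, RamState.setMem_mem_ne _ _ (by omega), RamState.setReg_mem,
        RamState.setMem_mem_self]
      exact TreeAt.mono (by omega) hmem ha
    · rw [RamState.setReg_mem, RamState.setMem_mem_self]
      exact TreeAt.mono (by omega) hmem hb

/-! ### Realizable functions -/

/-- A family of programs turns the tree `γ i`, given in a register, into the tree `b i` within
`c i` steps. -/
def RT {I : Type} (γ b : I → Data) (c : I → ℕ) : Prop :=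
  ∃ p : ℕ → Prog, ∀ i m s, 0 < m → 0 < s.reg 0 → Holds s m (γ i) →
    Steps (p m) s (c i) fun s' => Frame m s s' ∧ Holds s' m (b i)

/-- The situation in the body of a loop over a list. -/
structure FoldIx {I : Type} {B A : I → Type} (P : ∀ i, B i → A i → Prop) : Type where
  i : I
  b : B i
  a : A i
  h : P i b a

/-- Encodings of objects by trees. -/
class Enc (α : Type) : Type where
  enc : α → Data

open Enc (enc)
open Equiv (Perm)

namespace RT

variable {I J : Type} {γ a b : I → Data} {c c' : I → ℕ}

theorem mono (h : RT γ a c) (hc : ∀ i, c i ≤ c' i) : RT γ a c' := by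
  obtain ⟨p, hp⟩ := h
  exact ⟨p, fun i m s hm hs hγ => (hp i m s hm hs hγ).mono (hc i) fun _ h => h⟩

/-- One program serves all indices, so restricting or reparametrizing the index type costs nothing.
Side conditions, such as loop invariants, are carried in the index. -/
theorem reindex (h : RT γ a c) (f : J → I) :
    RT (fun j => γ (f j)) (fun j => a (f j)) (fun j => c (f j)) := by
  obtain ⟨p, hp⟩ := h
  exact ⟨p, fun j => hp (f j)⟩

theorem self : RT γ γ fun _ => 1 :=
  ⟨fun m => .copy m m, fun _ _ _ hm hs hγ => (Steps.copy_holds hs hγ hm)⟩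

theorem comp (h : RT γ a c) (h' : RT a b c') : RT γ b fun i => c i + c' i := by
  obtain ⟨p, hp⟩ := h
  obtain ⟨q, hq⟩ := h'
  refine ⟨fun m => .seq (p m) (q m), fun i m s hm hs hγ => .seq (hp i m s hm hs hγ) ?_⟩
  rintro s' ⟨hf, ha⟩
  exact (hq i m s' hm hf.pos' ha).mono le_rfl fun _ h => ⟨hf.trans h.1, h.2⟩

/-- Evaluation in the next register. -/
theorem next {p : ℕ → Prog} {i : I} {m x : ℕ} {s : RamState} {K : ℕ}
    (hp : ∀ i m s, 0 < m → 0 < s.reg 0 → Holds s m (γ i) →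
      Steps (p m) s (c i) fun s' => Frame m s s' ∧ Holds s' m (b i))
    (hs : 0 < s.reg 0) (hγ : Holds s m (γ i)) (hx : 0 < x := by omega)
    (hK : K = 1 + c i := by rfl) :
    Steps (.seq (.copy x m) (p x)) s K fun s' => Frame x s s' ∧ Holds s' x (b i) := by
  subst hK
  refine .seq (Steps.copy_holds hs hγ hx) ?_
  rintro s' ⟨hf, ha⟩
  exact (hp i x s' hx hf.pos' ha).mono le_rfl fun _ h => ⟨hf.trans h.1, h.2⟩

/-- Each component is computed on a copy of the argument in a higher register, since a program may
overwrite all registers from its own on; the argument in register `m` survives for the second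
component. -/
theorem pair (ha : RT γ a c) (hb : RT γ b c') :
    RT γ (fun i => .cons (a i) (b i)) fun i => c i + c' i + 8 := by
  obtain ⟨p, hp⟩ := ha
  obtain ⟨q, hq⟩ := hb
  refine ⟨fun m => .seq (.seq (.copy (m + 1) m) (p (m + 1)))
    (.seq (.seq (.copy (m + 2) m) (q (m + 2)))
    (.seq (.alloc (m + 3) (m + 1) (m + 2)) (.copy m (m + 3)))), fun i m s hm hs hγ => ?_⟩
  refine (Steps.seq (next hp hs hγ) (L := (1 + c' i) + (5 + 1)) ?_).mono (by simp; omega) fun _ h => h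
  rintro s₁ ⟨hf₁, h₁⟩
  refine .seq (next hq hf₁.pos' (hγ.frame hf₁)) ?_
  rintro s₂ ⟨hf₂, h₂⟩
  refine .seq (Steps.alloc hf₂.pos' (h₁.frame hf₂) h₂) ?_
  rintro s₃ ⟨hf₃, h₃⟩
  refine (Steps.copy_holds hf₃.pos' h₃).mono le_rfl ?_
  rintro s₄ ⟨hf₄, h₄⟩
  exact ⟨(hf₁.trans (hf₂.trans hf₃ (k := m + 1)) (k := m + 1)).trans hf₄, h₄⟩

theorem fst (h : RT γ (fun i => .cons (a i) (b i)) c) : RT γ a fun i => c i + 1 := by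
  obtain ⟨p, hp⟩ := h
  refine ⟨fun m => .seq (p m) (.load m m), fun i m s hm hs hγ => .seq (hp i m s hm hs hγ) ?_⟩
  rintro s' ⟨hf, h⟩
  exact .load ⟨hf.trans (.setReg hf.pos' (m := m)) (k := m), .setReg_self h.2.2.1⟩

theorem snd (h : RT γ (fun i => .cons (a i) (b i)) c) : RT γ b fun i => c i + 2 := by
  obtain ⟨p, hp⟩ := h
  refine ⟨fun m => .seq (p m) (.seq (.succ m) (.load m m)),
    fun i m s hm hs hγ => .seq (L := 1 + 1) (hp i m s hm hs hγ) ?_⟩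
  rintro s' ⟨hf, h⟩
  refine .seq (.succ rfl) ?_
  rintro _ rfl
  have hm' : (0 : ℕ) ≠ m := by omega
  refine .load ⟨hf.trans ((Frame.setReg hf.pos' (m := m)).trans (.setReg (m := m) ?_) (k := m)),
    .setReg_self ?_⟩
  · rw [RamState.setReg_reg_ne _ _ hm']; exact hf.pos'
  · rw [RamState.setReg_reg_ne _ _ hm', RamState.setReg_mem, RamState.setReg_reg_self]
    exact h.2.2.2

theorem atom (k : ℕ) : RT γ (fun _ => .atom k) fun _ => k + 1 := by
  induction k with
  | zero =>
    exact ⟨fun m => .zero m, fun i m s hm hs _ => .zero ⟨.setReg hs, .setReg_self rfl⟩⟩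
  | succ k ih =>
    obtain ⟨p, hp⟩ := ih
    refine ⟨fun m => .seq (p m) (.succ m), fun i m s hm hs hγ => .seq (hp i m s hm hs hγ) ?_⟩
    rintro s' ⟨hf, h⟩
    refine .succ ⟨hf.trans (.setReg hf.pos' (m := m)) (k := m), .setReg_self ?_⟩
    exact congrArg (· + 1) h

theorem succ {x : I → ℕ} (h : RT γ (fun i => .atom (x i)) c) :
    RT γ (fun i => .atom (x i + 1)) fun i => c i + 1 := by
  obtain ⟨p, hp⟩ := h
  refine ⟨fun m => .seq (p m) (.succ m), fun i m s hm hs hγ => .seq (hp i m s hm hs hγ) ?_⟩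
  rintro s' ⟨hf, h⟩
  exact .succ ⟨hf.trans (.setReg hf.pos' (m := m)) (k := m), .setReg_self (congrArg (· + 1) h)⟩

/-- Each branch need only work on the indices that take it. The sum of both costs bounds either one
without a case distinction. -/
theorem ltCase {x y : I → ℕ} {k k' : I → ℕ} (hx : RT γ (fun i => .atom (x i)) c)
    (hy : RT γ (fun i => .atom (y i)) c')
    (ha : RT (I := {i // x i < y i}) (fun i => γ i) (fun i => a i) fun i => k i)
    (hb : RT (I := {i // ¬ x i < y i}) (fun i => γ i) (fun i => a i) fun i => k' i) :
    RT γ a fun i => c i + c' i + k i + k' i + 3 := by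
  obtain ⟨px, hpx⟩ := hx
  obtain ⟨py, hpy⟩ := hy
  obtain ⟨pa, hpa⟩ := ha
  obtain ⟨pb, hpb⟩ := hb
  refine ⟨fun m => .seq (.seq (.copy (m + 1) m) (px (m + 1)))
    (.seq (.seq (.copy (m + 2) m) (py (m + 2))) (.ifLt (m + 1) (m + 2) (pa m) (pb m))),
    fun i m s hm hs hγ => ?_⟩
  refine (Steps.seq (next hpx hs hγ) (L := (1 + c' i) + (k i + k' i + 1)) ?_).mono (by simp; omega)
    fun _ h => h
  rintro s₁ ⟨hf₁, h₁⟩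
  refine .seq (next hpy hf₁.pos' (hγ.frame hf₁)) ?_
  rintro s₂ ⟨hf₂, h₂⟩
  have e₁ : s₂.reg (m + 1) = x i := h₁.frame hf₂
  have e₂ : s₂.reg (m + 2) = y i := h₂
  have hf : Frame (m + 1) s s₂ := hf₁.trans hf₂
  refine .ifLt (fun h => ?_) (fun h => ?_)
  · exact (hpa ⟨i, by rwa [e₁, e₂] at h⟩ m s₂ hm hf₂.pos' (hγ.frame hf)).mono (by simp) fun _ h =>
      ⟨hf.trans h.1, h.2⟩
  · exact (hpb ⟨i, by rwa [e₁, e₂] at h⟩ m s₂ hm hf₂.pos' (hγ.frame hf)).mono (by simp) fun _ h =>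
      ⟨hf.trans h.1, h.2⟩

/-- Case distinction between a leaf `0` and an inner node. -/
theorem consCase {x : I → Data} {k k' : I → ℕ} (hx : RT γ x c)
    (hcase : ∀ i, x i = .atom 0 ∨ ∃ d e, x i = .cons d e)
    (ha : RT (I := {i // x i = .atom 0}) (fun i => γ i) (fun i => a i) fun i => k i)
    (hb : RT (I := {i // ∃ d e, x i = .cons d e}) (fun i => .cons (γ i) (x i)) (fun i => a i)
      fun i => k' i) :
    RT γ a fun i => c i + k i + k' i + 10 := by
  obtain ⟨px, hpx⟩ := hx
  obtain ⟨pa, hpa⟩ := ha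
  obtain ⟨pb, hpb⟩ := hb
  refine ⟨fun m => .seq (.seq (.copy (m + 1) m) (px (m + 1)))
    (.seq (.zero (m + 2)) (.ifLt (m + 2) (m + 1)
      (.seq (.alloc (m + 3) m (m + 1)) (.seq (pb (m + 3)) (.copy m (m + 3)))) (pa m))),
    fun i m s hm hs hγ => ?_⟩
  refine (Steps.seq (next hpx hs hγ) (L := 1 + ((5 + (k' i + 1) + k i) + 1)) ?_).mono (by simp; omega)
    fun _ h => h
  rintro s₁ ⟨hf₁, h₁⟩
  refine .seq (.zero (Q := fun s' => Frame (m + 2) s₁ s' ∧ Holds s' (m + 2) (.atom 0))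
    ⟨.setReg hf₁.pos', .setReg_self rfl⟩) ?_
  rintro s₂ ⟨hf₂, h₂⟩
  have hf : Frame (m + 1) s s₂ := hf₁.trans hf₂
  have h₁' := h₁.frame hf₂
  have hγ' := hγ.frame hf
  have e₂ : s₂.reg (m + 2) = 0 := h₂
  refine .ifLt (fun h => ?_) (fun h => ?_)
  -- Trees carry no tags. Addresses of cells are positive, so a positive content can only be an
  -- inner node once all leaves other than `0` are excluded by `hcase`.
  · have hc : ∃ d e, x i = .cons d e := by
      rcases hcase i with h0 | h0
      · rw [h0] at h₁'
        have : s₂.reg (m + 1) = 0 := h₁'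
        omega
      · exact h0
    refine (Steps.seq (Steps.alloc hf₂.pos' hγ' h₁') (L := k' i + 1) ?_).mono (by omega)
      fun _ h => h
    rintro s₃ ⟨hf₃, h₃⟩
    refine .seq (hpb ⟨i, hc⟩ (m + 3) s₃ (by omega) hf₃.pos' h₃) ?_
    rintro s₄ ⟨hf₄, h₄⟩
    refine (Steps.copy_holds hf₄.pos' h₄ hm).mono le_rfl fun s₅ h => ⟨?_, h.2⟩
    exact (hf.trans (hf₃.trans hf₄ (k := m + 3)) (k := m + 1)).trans h.1
  · have hc : x i = .atom 0 := by
      rcases hcase i with h0 | ⟨d, e, h0⟩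
      · exact h0
      · rw [h0] at h₁'
        have : 0 < s₂.reg (m + 1) := h₁'.1
        omega
    exact (hpa ⟨i, hc⟩ m s₂ hm hf₂.pos' hγ').mono (by simp) fun _ h => ⟨hf.trans h.1, h.2⟩

end RT

instance : Enc ℕ := ⟨.atom⟩
instance {n : ℕ} : Enc (Fin n) := ⟨fun i => .atom i⟩
instance : Enc Bool := ⟨fun b => .atom b.toNat⟩
instance {α β : Type} [Enc α] [Enc β] : Enc (α × β) := ⟨fun p => .cons (enc p.1) (enc p.2)⟩
instance {α : Type} [Enc α] : Enc (List α) := ⟨fun l => l.foldr (fun a d => .cons (enc a) d) (.atom 0)⟩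
instance {α : Type} [Enc α] : Enc (Option α) :=
  ⟨fun o => o.elim (.atom 0) fun a => .cons (enc a) (.atom 0)⟩

theorem enc_list_cons {α : Type} [Enc α] (a : α) (l : List α) :
    enc (a :: l) = .cons (enc a) (enc l) := rfl

/-- A loop over a list. The states that occur in the body are those reached by the loop. -/
theorem RT.foldl {I : Type} {γ : I → Data} {B A : I → Type} [∀ i, Enc (B i)] [∀ i, Enc (A i)]
    {f : ∀ i, B i → A i → B i} {l : ∀ i, List (A i)} {z : ∀ i, B i}
    {cl cz K : I → ℕ}
    (hl : RT γ (fun i => enc (l i)) cl) (hz : RT γ (fun i => enc (z i)) cz)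
    (hf : RT (I := FoldIx fun i b a => ∃ l₁ l₂, l i = l₁ ++ a :: l₂ ∧ b = List.foldl (f i) (z i) l₁)
      (fun p => .cons (γ p.i) (.cons (enc p.b) (enc p.a))) (fun p => enc (f p.i p.b p.a))
      (fun p => K p.i)) :
    RT γ (fun i => enc ((l i).foldl (f i) (z i)))
      fun i => cl i + cz i + (l i).length * (K i + 20) + 10 := by
  obtain ⟨pl, hpl⟩ := hl
  obtain ⟨pz, hpz⟩ := hz
  obtain ⟨pf, hpf⟩ := hf
  refine ⟨fun m => .seq (.seq (.copy (m + 1) m) (pl (m + 1)))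
    (.seq (.seq (.copy (m + 2) m) (pz (m + 2)))
    (.seq (.zero (m + 3))
    (.seq (.whileLt (m + 3) (m + 1)
      (.seq (.load (m + 4) (m + 1)) (.seq (.alloc (m + 5) (m + 2) (m + 4))
        (.seq (.alloc (m + 6) m (m + 5)) (.seq (pf (m + 6))
        (.seq (.copy (m + 2) (m + 6)) (.seq (.succ (m + 1)) (.load (m + 1) (m + 1)))))))))
      (.copy m (m + 2))))), fun i m s hm hs hγ => ?_⟩
  -- Register `m` keeps the argument, `m + 1` the rest of the list, `m + 2` the accumulator and `m +
  -- 3` the number zero. The empty list is the leaf `0`, so the loop stops when register `m + 1`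
  -- becomes zero.
  let Q : ℕ → RamState → Prop := fun k s' => Frame (m + 1) s s' ∧ s'.reg (m + 3) = 0 ∧
    ∃ l₁ l₂, l i = l₁ ++ l₂ ∧ l₂.length = k ∧
      Holds s' (m + 1) (enc l₂) ∧ Holds s' (m + 2) (enc (l₁.foldl (f i) (z i)))
  refine (Steps.seq (next hpl hs hγ) (L := (1 + cz i) + (1 + (((l i).length * (K i + 15 + 1) + 1)
    + 1))) ?_).mono (by
      have : (l i).length * (K i + 15 + 1) ≤ (l i).length * (K i + 20) :=
        Nat.mul_le_mul_left _ (by omega)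
      beta_reduce
      omega) fun _ h => h
  rintro s₁ ⟨hf₁, h₁⟩
  refine .seq (next hpz hf₁.pos' (hγ.frame hf₁)) ?_
  rintro s₂ ⟨hf₂, h₂⟩
  refine .seq (.zero (Q := fun s' => Frame (m + 3) s₂ s' ∧ Holds s' (m + 3) (.atom 0))
    ⟨.setReg hf₂.pos' (m := m + 3) (x := m + 3), .setReg_self rfl⟩) ?_
  rintro s₃ ⟨hf₃, h₃⟩
  refine .seq (R := Q 0) (Steps.whileLt (Inv := Q) ?_ ?_ _ s₃ ?_) ?_
  · rintro k s₄ ⟨hF, hz0, l₁, l₂, hl, hlen, hL, hA⟩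
    obtain ⟨x, l₃, rfl⟩ := List.exists_cons_of_length_eq_add_one hlen
    rw [enc_list_cons] at hL
    refine ⟨by rw [hz0]; exact hL.1, ?_⟩
    refine (Steps.seq (K := 1) (L := 5 + (5 + (K i + (1 + (1 + 1)))))
      (.load (Q := fun s' => Frame (m + 4) s₄ s' ∧ Holds s' (m + 4) (enc x))
      ⟨.setReg hF.pos' (m := m + 4), .setReg_self hL.2.2.1⟩) ?_).mono (by simp; omega) fun _ h => h
    rintro s₅ ⟨hf₅, h₅⟩
    refine .seq (Steps.alloc hf₅.pos' (hA.frame hf₅) h₅) ?_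
    rintro s₆ ⟨hf₆, h₆⟩
    refine .seq (Steps.alloc hf₆.pos'
      ((hγ.frame hF).frame (hf₅.trans hf₆ (k := m + 4))) h₆) ?_
    rintro s₇ ⟨hf₇, h₇⟩
    refine .seq (hpf ⟨i, _, x, l₁, l₃, hl, rfl⟩ (m + 6) s₇ (by omega) hf₇.pos' h₇) ?_
    rintro s₈ ⟨hf₈, h₈⟩
    have hG : Frame (m + 4) s₄ s₈ :=
      hf₅.trans (hf₆.trans (hf₇.trans hf₈ (k := m + 6)) (k := m + 5))
    have hL₈ : Holds s₈ (m + 1) (.cons (enc x) (enc l₃)) := Holds.frame hL hG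
    have hz₈ : s₈.reg (m + 3) = 0 := by rw [hG.reg _ (by omega) (by omega), hz0]
    refine .seq (.copy rfl) ?_
    rintro _ rfl
    refine .seq (.succ rfl) ?_
    rintro _ rfl
    have hp₈ := hG.pos'
    refine .load ⟨?_, ?_, l₁ ++ [x], l₃, by simp [hl], by simpa using hlen, ?_, ?_⟩
    · refine (hF.trans hG (k := m + 1)).trans
        ((Frame.setReg hp₈ (m := m + 1)).trans ((Frame.setReg (m := m + 1) ?_).trans
          (Frame.setReg (m := m + 1) ?_) (k := m + 1)) (k := m + 1))
      · simpa [RamState.setReg] using hp₈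
      · simpa [RamState.setReg] using hp₈
    · simpa [RamState.setReg] using hz₈
    · refine .setReg_self ?_
      simpa [RamState.setReg] using hL₈.2.2.2
    · refine .setReg_ne (.setReg_ne (.setReg_self ?_))
      rw [List.foldl_append]
      exact h₈
  · rintro s₄ ⟨hF, hz0, l₁, l₂, hl, hlen, hL, hA⟩
    rw [List.length_eq_zero_iff] at hlen
    subst hlen
    have : s₄.reg (m + 1) = 0 := hL
    omega
  · exact ⟨hf₁.trans (hf₂.trans hf₃ (k := m + 2)), h₃, [], l i, rfl, rfl,
      h₁.frame (hf₂.trans hf₃ (k := m + 2)), h₂.frame hf₃⟩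
  · rintro s₄ ⟨hF, hz0, l₁, l₂, hl, hlen, hL, hA⟩
    rw [List.length_eq_zero_iff] at hlen
    subst hlen
    rw [List.append_nil] at hl
    rw [← hl] at hA
    exact (Steps.copy_holds hF.pos' hA hm).mono le_rfl fun _ h => ⟨hF.trans h.1, h.2⟩

/-! ### Polynomial time -/

/-- `c` is bounded by a polynomial in `s`. -/
def PB {I : Type} (s c : I → ℕ) : Prop := ∃ d : ℕ, ∀ i, c i ≤ (s i + 2) ^ d

namespace PB

variable {I J : Type} {s c c' : I → ℕ}

theorem mono (h : PB s c) (hc : ∀ i, c' i ≤ c i) : PB s c' := by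
  obtain ⟨d, hd⟩ := h
  exact ⟨d, fun i => (hc i).trans (hd i)⟩

theorem self : PB s s := ⟨1, fun i => by simp⟩

/-- The base `s i + 2` is at least two and `k < 2 ^ k`, so a constant can be absorbed by the
exponent. -/
theorem const (k : ℕ) : PB s fun _ => k :=
  ⟨k, fun i => k.lt_two_pow_self.le.trans (Nat.pow_le_pow_left (by omega) k)⟩

theorem mul (h : PB s c) (h' : PB s c') : PB s fun i => c i * c' i := by
  obtain ⟨d, hd⟩ := h
  obtain ⟨e, he⟩ := h'
  exact ⟨d + e, fun i => by rw [pow_add]; exact Nat.mul_le_mul (hd i) (he i)⟩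

theorem add (h : PB s c) (h' : PB s c') : PB s fun i => c i + c' i := by
  obtain ⟨d, hd⟩ := h
  obtain ⟨e, he⟩ := h'
  refine ⟨d + e + 1, fun i => ?_⟩
  have h1 : (s i + 2) ^ d ≤ (s i + 2) ^ (d + e) := Nat.pow_le_pow_right (by omega) (by omega)
  have h2 : (s i + 2) ^ e ≤ (s i + 2) ^ (d + e) := Nat.pow_le_pow_right (by omega) (by omega)
  have h3 : (s i + 2) ^ (d + e) * 2 ≤ (s i + 2) ^ (d + e + 1) := by
    rw [pow_succ]; exact Nat.mul_le_mul_left _ (by omega)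
  have := hd i
  have := he i
  beta_reduce
  omega

theorem reindex (h : PB s c) (f : J → I) : PB (fun j => s (f j)) fun j => c (f j) := by
  obtain ⟨d, hd⟩ := h
  exact ⟨d, fun j => hd (f j)⟩

end PB

/-- `b` can be computed from `γ` in time polynomial in the parameter `s`. -/
def T {I : Type} (s : I → ℕ) (γ b : I → Data) : Prop := ∃ c, PB s c ∧ RT γ b c

/-- An element of a set or list that depends on a parameter. -/
structure MemIx {I : Type} {A : I → Type} (P : ∀ i, A i → Prop) : Type where
  i : I
  a : A i
  h : P i a

namespace T

variable {I J : Type} {s : I → ℕ} {γ a b : I → Data}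

theorem congr (h : T s γ a) (e : ∀ i, a i = b i) : T s γ b := by
  rwa [← funext e]

theorem reindex (h : T s γ a) (f : J → I) :
    T (fun j => s (f j)) (fun j => γ (f j)) (fun j => a (f j)) := by
  obtain ⟨c, hc, h⟩ := h
  exact ⟨_, hc.reindex f, h.reindex f⟩

theorem self : T s γ γ := ⟨_, .const 1, .self⟩

theorem comp (h : T s γ a) (h' : T s a b) : T s γ b := by
  obtain ⟨c, hc, h⟩ := h
  obtain ⟨c', hc', h'⟩ := h'
  exact ⟨_, hc.add hc', h.comp h'⟩

theorem pair (h : T s γ a) (h' : T s γ b) : T s γ fun i => .cons (a i) (b i) := by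
  obtain ⟨c, hc, h⟩ := h
  obtain ⟨c', hc', h'⟩ := h'
  exact ⟨_, (hc.add hc').add (.const 8), h.pair h'⟩

theorem fst (h : T s γ fun i => .cons (a i) (b i)) : T s γ a := by
  obtain ⟨c, hc, h⟩ := h
  exact ⟨_, hc.add (.const 1), h.fst⟩

theorem snd (h : T s γ fun i => .cons (a i) (b i)) : T s γ b := by
  obtain ⟨c, hc, h⟩ := h
  exact ⟨_, hc.add (.const 2), h.snd⟩

theorem atom (k : ℕ) : T s γ fun _ => .atom k := ⟨_, .const (k + 1), .atom k⟩

theorem succ {x : I → ℕ} (h : T s γ fun i => enc (x i)) : T s γ fun i => enc (x i + 1) := by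
  obtain ⟨c, hc, h⟩ := h
  exact ⟨_, hc.add (.const 1), h.succ⟩

theorem up (h : T s γ a) : T s (fun i => .cons (γ i) (b i)) a := (fst self).comp h

theorem nat (k : ℕ) : T s γ fun _ => enc k := atom k

/-- The body of a loop or of a case receives the surrounding argument paired with local data.
Whatever is computable from the argument stays computable there; `wk₂` and `wk₃` serve nested
bodies. -/
theorem wk (h : T s γ a) (f : J → I) {δ : J → Data} :
    T (fun j => s (f j)) (fun j => .cons (γ (f j)) (δ j)) fun j => a (f j) :=
  (h.reindex f).up

theorem wk₂ {K : Type} (h : T s γ a) (f : J → I) (g : K → J) {δ ε : K → Data} :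
    T (fun k => s (f (g k))) (fun k => .cons (.cons (γ (f (g k))) (δ k)) (ε k))
      fun k => a (f (g k)) :=
  (h.reindex fun k => f (g k)).up.up

theorem wk₃ {K L : Type} (h : T s γ a) (f : J → I) (g : K → J) (e : L → K) {δ ε ζ : L → Data} :
    T (fun k => s (f (g (e k))))
      (fun k => .cons (.cons (.cons (γ (f (g (e k)))) (δ k)) (ε k)) (ζ k))
      fun k => a (f (g (e k))) :=
  (h.reindex fun k => f (g (e k))).up.up.up

theorem sub (h : T s γ a) {P : I → Prop} :
    T (I := {i // P i}) (fun i => s i) (fun i => γ i) fun i => a i :=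
  h.reindex Subtype.val

/-- The running time on a part of the index set, extended to the whole index set. -/
theorem extend {P : I → Prop}
    (h : T (I := {i // P i}) (fun i => s i) (fun i => γ i) fun i => a i) :
    ∃ c : I → ℕ, PB s c ∧
      RT (I := {i // P i}) (fun i => γ i) (fun i => a i) fun i => c i := by
  obtain ⟨c, ⟨d, hd⟩, h⟩ := h
  exact ⟨fun i => (s i + 2) ^ d, ⟨d, fun _ => le_rfl⟩, h.mono hd⟩

theorem ltCase {x y : I → ℕ} (hx : T s γ fun i => .atom (x i)) (hy : T s γ fun i => .atom (y i))
    (ha : T (I := {i // x i < y i}) (fun i => s i) (fun i => γ i) fun i => a i)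
    (hb : T (I := {i // ¬ x i < y i}) (fun i => s i) (fun i => γ i) fun i => a i) : T s γ a := by
  obtain ⟨c, hc, hx⟩ := hx
  obtain ⟨c', hc', hy⟩ := hy
  obtain ⟨k, hk, ha⟩ := ha.extend
  obtain ⟨k', hk', hb⟩ := hb.extend
  exact ⟨_, (((hc.add hc').add hk).add hk').add (.const 3), hx.ltCase hy ha hb⟩

theorem consCase {x : I → Data} (hx : T s γ x)
    (hcase : ∀ i, x i = .atom 0 ∨ ∃ d e, x i = .cons d e)
    (ha : T (I := {i // x i = .atom 0}) (fun i => s i) (fun i => γ i) fun i => a i)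
    (hb : T (I := {i // ∃ d e, x i = .cons d e}) (fun i => s i) (fun i => .cons (γ i) (x i))
      fun i => a i) : T s γ a := by
  obtain ⟨c, hc, hx⟩ := hx
  obtain ⟨k, hk, ha⟩ := ha.extend
  obtain ⟨k', ⟨d', hd'⟩, hb⟩ := hb
  exact ⟨_, ((hc.add hk).add (.add ⟨d', fun _ => le_rfl⟩ (.const 0))).add (.const 10),
    hx.consCase hcase ha (hb.mono hd')⟩

theorem natLt {x y : I → ℕ} (hx : T s γ fun i => enc (x i)) (hy : T s γ fun i => enc (y i)) :
    T s γ fun i => enc (decide (x i < y i)) :=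
  ltCase (x := x) (y := y) hx hy ((atom 1).congr fun i => by rw [decide_eq_true i.2]; rfl)
    ((atom 0).congr fun i => by rw [decide_eq_false i.2]; rfl)

/-- Case distinction on a truth value. -/
theorem boolCase {t : I → Bool} (ht : T s γ fun i => enc (t i))
    (ha : T (I := {i // t i = true}) (fun i => s i) (fun i => γ i) fun i => a i)
    (hb : T (I := {i // t i = false}) (fun i => s i) (fun i => γ i) fun i => a i) : T s γ a := by
  refine ltCase (atom 0) ht ?_ ?_
  · let f : {i // 0 < (t i).toNat} → {i // t i = true} :=
      fun i => ⟨i.1, by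
        have h := i.2
        by_contra h'
        rw [Bool.not_eq_true] at h'
        simp [h'] at h⟩
    exact ha.reindex f
  · let f : {i // ¬ 0 < (t i).toNat} → {i // t i = false} :=
      fun i => ⟨i.1, by
        have h := i.2
        by_contra h'
        rw [Bool.not_eq_false] at h'
        simp [h'] at h⟩
    exact hb.reindex f

theorem cond {A : I → Type} [∀ i, Enc (A i)] {t : I → Bool} {x y : ∀ i, A i}
    (ht : T s γ fun i => enc (t i)) (hx : T s γ fun i => enc (x i)) (hy : T s γ fun i => enc (y i)) :
    T s γ fun i => enc (bif t i then x i else y i) :=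
  ht.boolCase (hx.sub.congr fun i => by rw [i.2]; rfl) (hy.sub.congr fun i => by rw [i.2]; rfl)

theorem bool (t : Bool) : T s γ fun _ => enc t := atom _

theorem not {t : I → Bool} (h : T s γ fun i => enc (t i)) : T s γ fun i => enc (!t i) :=
  (h.cond (bool false) (bool true)).congr fun i => by cases t i <;> rfl

theorem and {t u : I → Bool} (h : T s γ fun i => enc (t i)) (h' : T s γ fun i => enc (u i)) :
    T s γ fun i => enc (t i && u i) :=
  (h.cond h' (bool false)).congr fun i => by cases t i <;> rfl

theorem or {t u : I → Bool} (h : T s γ fun i => enc (t i)) (h' : T s γ fun i => enc (u i)) :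
    T s γ fun i => enc (t i || u i) :=
  (h.cond (bool true) h').congr fun i => by cases t i <;> rfl

theorem natEq {x y : I → ℕ} (hx : T s γ fun i => enc (x i)) (hy : T s γ fun i => enc (y i)) :
    T s γ fun i => enc (decide (x i = y i)) :=
  ((hx.natLt hy).not.and (hy.natLt hx).not).congr fun i => by
    congr 1
    rw [Bool.eq_iff_iff]
    simp only [Bool.and_eq_true, Bool.not_eq_true', decide_eq_false_iff_not, decide_eq_true_eq]
    omega

/-! ### Polynomial time functions on lists and options -/

section Lists

variable {A B : I → Type} [∀ i, Enc (A i)] [∀ i, Enc (B i)]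

/-- The states in the body of a loop are those that the loop reaches. -/
theorem foldlReach {f : ∀ i, B i → A i → B i} {l : ∀ i, List (A i)} {z : ∀ i, B i}
    (hl : T s γ fun i => enc (l i)) (hz : T s γ fun i => enc (z i))
    (hlen : PB s fun i => (l i).length)
    (hf : T (I := FoldIx fun i b a => ∃ l₁ l₂, l i = l₁ ++ a :: l₂ ∧ b = List.foldl (f i) (z i) l₁)
      (fun p => s p.i)
      (fun p => .cons (γ p.i) (.cons (enc p.b) (enc p.a))) fun p => enc (f p.i p.b p.a)) :
    T s γ fun i => enc ((l i).foldl (f i) (z i)) := by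
  obtain ⟨c, hc, hl⟩ := hl
  obtain ⟨c', hc', hz⟩ := hz
  obtain ⟨k, ⟨d, hd⟩, hf⟩ := hf
  exact ⟨_, ((hc.add hc').add (hlen.mul (PB.add ⟨d, fun _ => le_rfl⟩ (.const 20)))).add
    (.const 10), hl.foldl hz (hf.mono hd)⟩

/-- A loop with an invariant. -/
theorem foldl {f : ∀ i, B i → A i → B i} {l : ∀ i, List (A i)} {z : ∀ i, B i}
    (Inv : ∀ i, B i → Prop)
    (hl : T s γ fun i => enc (l i)) (hz : T s γ fun i => enc (z i))
    (hlen : PB s fun i => (l i).length)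
    (h0 : ∀ i, Inv i (z i)) (hS : ∀ i b a, Inv i b → a ∈ l i → Inv i (f i b a))
    (hf : T (I := FoldIx fun i b a => Inv i b ∧ a ∈ l i) (fun p => s p.i)
      (fun p => .cons (γ p.i) (.cons (enc p.b) (enc p.a))) fun p => enc (f p.i p.b p.a)) :
    T s γ fun i => enc ((l i).foldl (f i) (z i)) := by
  have key : ∀ i l₁, (∀ a ∈ l₁, a ∈ l i) → Inv i (List.foldl (f i) (z i) l₁) := by
    intro i l₁ h
    induction l₁ using List.reverseRecOn with
    | nil => exact h0 i
    | append_singleton l₁ a ih =>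
      rw [List.foldl_append]
      exact hS _ _ _ (ih fun a ha => h a (by simp [ha])) (h a (by simp))
  let g : (FoldIx fun i b a => ∃ l₁ l₂, l i = l₁ ++ a :: l₂ ∧ b = List.foldl (f i) (z i) l₁) →
      FoldIx fun i b a => Inv i b ∧ a ∈ l i := fun p => ⟨p.i, p.b, p.a, by
    obtain ⟨l₁, l₂, h, h'⟩ := p.h
    rw [h']
    exact ⟨key _ _ fun a ha => by simp [h, ha], by simp [h]⟩⟩
  exact foldlReach hl hz hlen (hf.reindex g)

/-- A loop without invariant. -/
theorem foldl₀ {f : ∀ i, B i → A i → B i} {l : ∀ i, List (A i)} {z : ∀ i, B i}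
    (hl : T s γ fun i => enc (l i)) (hz : T s γ fun i => enc (z i))
    (hlen : PB s fun i => (l i).length)
    (hf : T (I := FoldIx fun i (_ : B i) a => True ∧ a ∈ l i) (fun p => s p.i)
      (fun p => .cons (γ p.i) (.cons (enc p.b) (enc p.a))) fun p => enc (f p.i p.b p.a)) :
    T s γ fun i => enc ((l i).foldl (f i) (z i)) :=
  foldl (fun _ _ => True) hl hz hlen (fun _ => trivial) (fun _ _ _ _ _ => trivial) hf

theorem acc {x : ∀ i, B i} : T s (fun i => .cons (γ i) (.cons (enc (x i)) (a i)))
    fun i => enc (x i) :=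
  self.snd.fst

theorem item {x : ∀ i, A i} : T s (fun i => .cons (γ i) (.cons (b i) (enc (x i))))
    fun i => enc (x i) :=
  self.snd.snd

theorem elem {x : ∀ i, A i} : T s (fun i => .cons (γ i) (enc (x i))) fun i => enc (x i) :=
  self.snd

theorem nil : T s γ fun i => enc ([] : List (A i)) := atom 0

theorem none : T s γ fun i => enc (Option.none : Option (A i)) := atom 0

theorem some {x : ∀ i, A i} (h : T s γ fun i => enc (x i)) :
    T s γ fun i => enc (Option.some (x i)) := h.pair (atom 0)

theorem cons {x : ∀ i, A i} {l : ∀ i, List (A i)} (h : T s γ fun i => enc (x i))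
    (hl : T s γ fun i => enc (l i)) : T s γ fun i => enc (x i :: l i) := h.pair hl

theorem mk {x : ∀ i, A i} {y : ∀ i, B i} (h : T s γ fun i => enc (x i))
    (h' : T s γ fun i => enc (y i)) : T s γ fun i => enc (x i, y i) := h.pair h'

theorem proj₁ {x : ∀ i, A i × B i} (h : T s γ fun i => enc (x i)) :
    T s γ fun i => enc (x i).1 := h.fst

theorem proj₂ {x : ∀ i, A i × B i} (h : T s γ fun i => enc (x i)) :
    T s γ fun i => enc (x i).2 := h.snd

theorem reverse {l : ∀ i, List (A i)} (h : T s γ fun i => enc (l i))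
    (hlen : PB s fun i => (l i).length) : T s γ fun i => enc (l i).reverse :=
  (foldl₀ (f := fun _ b a => a :: b) (z := fun _ => []) h nil hlen (cons item acc)).congr
    fun i => by simp

theorem append {l l' : ∀ i, List (A i)} (h : T s γ fun i => enc (l i))
    (h' : T s γ fun i => enc (l' i)) (hlen : PB s fun i => (l i).length) :
    T s γ fun i => enc (l i ++ l' i) :=
  (foldl₀ (f := fun _ b a => a :: b) (h.reverse hlen) h' (by simpa using hlen)
    (cons item acc)).congr fun i => by simp

/-- Case distinction on an optional value. -/
theorem optionCase {o : ∀ i, Option (A i)} (ho : T s γ fun i => enc (o i))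
    (ha : T (I := {i // o i = Option.none}) (fun i => s i) (fun i => γ i) fun i => a i)
    (hb : T (I := MemIx fun i x => o i = Option.some x) (fun p => s p.i)
      (fun p => .cons (γ p.i) (enc p.a)) fun p => a p.i) : T s γ a := by
  refine ho.consCase (fun i => ?_) ?_ ?_
  · cases o i with
    | none => exact .inl rfl
    | some x => exact .inr ⟨_, _, rfl⟩
  · let f : {i // enc (o i) = .atom 0} → {i // o i = Option.none} := fun i => ⟨i.1, by
      obtain ⟨i, h⟩ := i
      cases h' : o i with
      | none => rfl
      | some x => rw [h'] at h; cases h⟩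
    exact ha.reindex f
  · have hf : ∀ i : {i // ∃ d e, enc (o i) = .cons d e}, ∃ x, o i = Option.some x := by
      rintro ⟨i, d, e, h⟩
      refine Option.ne_none_iff_exists'.1 fun h' => ?_
      rw [h'] at h
      cases h
    choose f hf using hf
    let g : {i // ∃ d e, enc (o i) = .cons d e} → MemIx fun i x => o i = Option.some x :=
      fun i => ⟨i.1, f i, hf i⟩
    -- The node found is the encoding of `some x`, a pair of `enc x` and the leaf `0`; its first
    -- component is the payload.
    refine T.comp (pair self.fst (fst (b := fun _ => .atom 0) ?_)) (hb.reindex g)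
    exact self.snd.congr fun i => by rw [hf i]; rfl

/-- Case distinction on a list. -/
theorem listCase {l : ∀ i, List (A i)} (hl : T s γ fun i => enc (l i))
    (ha : T (I := {i // l i = []}) (fun i => s i) (fun i => γ i) fun i => a i)
    (hb : T (I := MemIx fun i (x : A i × List (A i)) => l i = x.1 :: x.2) (fun p => s p.i)
      (fun p => .cons (γ p.i) (enc p.a)) fun p => a p.i) : T s γ a := by
  refine hl.consCase (fun i => ?_) ?_ ?_
  · cases l i with
    | nil => exact .inl rfl
    | cons x l => exact .inr ⟨_, _, rfl⟩
  · let f : {i // enc (l i) = .atom 0} → {i // l i = []} := fun i => ⟨i.1, by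
      obtain ⟨i, h⟩ := i
      cases h' : l i with
      | nil => rfl
      | cons x l => rw [h'] at h; cases h⟩
    exact ha.reindex f
  · have hf : ∀ i : {i // ∃ d e, enc (l i) = .cons d e}, ∃ x : A i × List (A i),
        l i = x.1 :: x.2 := by
      rintro ⟨i, d, e, h⟩
      obtain ⟨x, m, h'⟩ := List.exists_cons_of_ne_nil (l := l i) fun h' => by
        rw [h'] at h
        cases h
      exact ⟨(x, m), h'⟩
    choose f hf using hf
    let g : {i // ∃ d e, enc (l i) = .cons d e} →
        MemIx fun i (x : A i × List (A i)) => l i = x.1 :: x.2 := fun i => ⟨i.1, f i, hf i⟩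
    exact T.comp (self.congr fun i => by rw [hf i]; rfl) (hb.reindex g)

theorem elim {o : ∀ i, Option (A i)} {z : ∀ i, B i} {f : ∀ i, A i → B i}
    (ho : T s γ fun i => enc (o i)) (hz : T s γ fun i => enc (z i))
    (hf : T (I := MemIx fun i x => o i = Option.some x) (fun p => s p.i)
      (fun p => .cons (γ p.i) (enc p.a)) fun p => enc (f p.i p.a)) :
    T s γ fun i => enc ((o i).elim (z i) (f i)) :=
  ho.optionCase (hz.sub.congr fun i => by rw [i.2]; rfl) (hf.congr fun p => by rw [p.h]; rfl)

/-- The loop collects the results in reverse. `map`, `filter`, `all`, `find?` and `findSome?` are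
reduced to this one; the searches run through the whole list, which a polynomial bound tolerates. -/
theorem filterMap {l : ∀ i, List (A i)} {f : ∀ i, A i → Option (B i)}
    (hl : T s γ fun i => enc (l i)) (hlen : PB s fun i => (l i).length)
    (hf : T (I := MemIx fun i x => x ∈ l i) (fun p => s p.i)
      (fun p => .cons (γ p.i) (enc p.a)) fun p => enc (f p.i p.a)) :
    T s γ fun i => enc ((l i).filterMap (f i)) := by
  have key : ∀ i (m : List (B i)), (l i).foldl (fun b a => (f i a).elim b (· :: b)) m =
      ((l i).filterMap (f i)).reverse ++ m := by
    intro i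
    induction l i with
    | nil => simp
    | cons x l ih =>
      intro m
      rw [List.foldl_cons, ih, List.filterMap_cons]
      cases f i x <;> simp
  refine ((foldl₀ (f := fun i b a => (f i a).elim b (· :: b)) (z := fun _ => []) hl nil hlen
    (elim (I := FoldIx fun i (_ : List (B i)) a => True ∧ a ∈ l i) (A := fun p => B p.i) ?_ acc (cons elem (up acc)))).reverse ?_).congr
      fun i => by rw [key]; simp
  · exact (pair self.fst item).comp (hf.reindex fun p : FoldIx fun i (_ : List (B i)) a =>
      True ∧ a ∈ l i => ⟨p.i, p.a, p.h.2⟩)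
  · refine hlen.mono fun i => ?_
    rw [key]
    simpa using List.length_filterMap_le _ _

theorem map {l : ∀ i, List (A i)} {f : ∀ i, A i → B i}
    (hl : T s γ fun i => enc (l i)) (hlen : PB s fun i => (l i).length)
    (hf : T (I := MemIx fun i x => x ∈ l i) (fun p => s p.i)
      (fun p => .cons (γ p.i) (enc p.a)) fun p => enc (f p.i p.a)) :
    T s γ fun i => enc ((l i).map (f i)) :=
  (hl.filterMap (f := fun i a => Option.some (f i a)) hlen hf.some).congr fun i => by
    rw [← List.filterMap_eq_map]; rfl

theorem filter {l : ∀ i, List (A i)} {f : ∀ i, A i → Bool}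
    (hl : T s γ fun i => enc (l i)) (hlen : PB s fun i => (l i).length)
    (hf : T (I := MemIx fun i x => x ∈ l i) (fun p => s p.i)
      (fun p => .cons (γ p.i) (enc p.a)) fun p => enc (f p.i p.a)) :
    T s γ fun i => enc ((l i).filter (f i)) :=
  (hl.filterMap (f := fun i a => bif f i a then Option.some a else Option.none) hlen
    (hf.cond elem.some none)).congr fun i => by
      induction l i with
      | nil => rfl
      | cons x l ih =>
        rw [List.filterMap_cons, List.filter_cons]
        cases f i x <;> simp_all [enc]

theorem head? {l : ∀ i, List (A i)} (hl : T s γ fun i => enc (l i)) :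
    T s γ fun i => enc (l i).head? :=
  hl.listCase ((atom 0).congr fun i => by rw [i.2]; rfl)
    ((T.some (T.proj₁ elem)).congr fun p => by rw [p.h]; rfl)

theorem headD {l : ∀ i, List (A i)} {z : ∀ i, A i} (hl : T s γ fun i => enc (l i))
    (hz : T s γ fun i => enc (z i)) : T s γ fun i => enc ((l i).headD (z i)) :=
  hl.listCase (hz.sub.congr fun i => by rw [i.2]; rfl)
    ((T.proj₁ elem).congr fun p => by rw [p.h]; rfl)

theorem tail {l : ∀ i, List (A i)} (hl : T s γ fun i => enc (l i)) :
    T s γ fun i => enc (l i).tail :=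
  hl.listCase ((atom 0).congr fun i => by rw [i.2]; rfl)
    ((T.proj₂ elem).congr fun p => by rw [p.h]; rfl)

theorem isEmpty {l : ∀ i, List (A i)} (hl : T s γ fun i => enc (l i)) :
    T s γ fun i => enc (l i).isEmpty :=
  hl.listCase ((bool true).congr fun i => by rw [i.2]; rfl)
    ((bool false).congr fun p => by rw [p.h]; rfl)

theorem all {l : ∀ i, List (A i)} {f : ∀ i, A i → Bool}
    (hl : T s γ fun i => enc (l i)) (hlen : PB s fun i => (l i).length)
    (hf : T (I := MemIx fun i x => x ∈ l i) (fun p => s p.i)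
      (fun p => .cons (γ p.i) (enc p.a)) fun p => enc (f p.i p.a)) :
    T s γ fun i => enc ((l i).all (f i)) :=
  (hl.filter (f := fun i a => !f i a) hlen hf.not).isEmpty.congr fun i => by
    congr 1
    rw [Bool.eq_iff_iff]
    simp

theorem find? {l : ∀ i, List (A i)} {f : ∀ i, A i → Bool}
    (hl : T s γ fun i => enc (l i)) (hlen : PB s fun i => (l i).length)
    (hf : T (I := MemIx fun i x => x ∈ l i) (fun p => s p.i)
      (fun p => .cons (γ p.i) (enc p.a)) fun p => enc (f p.i p.a)) :
    T s γ fun i => enc ((l i).find? (f i)) :=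
  (hl.filter hlen hf).head?.congr fun i => by rw [List.head?_filter]

theorem findSome? {l : ∀ i, List (A i)} {f : ∀ i, A i → Option (B i)}
    (hl : T s γ fun i => enc (l i)) (hlen : PB s fun i => (l i).length)
    (hf : T (I := MemIx fun i x => x ∈ l i) (fun p => s p.i)
      (fun p => .cons (γ p.i) (enc p.a)) fun p => enc (f p.i p.a)) :
    T s γ fun i => enc ((l i).findSome? (f i)) :=
  (hl.filterMap hlen hf).head?.congr fun i => by rw [List.head?_filterMap]

theorem flatMap {l : ∀ i, List (A i)} {f : ∀ i, A i → List (B i)}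
    (hl : T s γ fun i => enc (l i)) (hlen : PB s fun i => (l i).length)
    (hlen' : PB (I := MemIx fun i x => x ∈ l i) (fun p => s p.i) fun p => (f p.i p.a).length)
    (hf : T (I := MemIx fun i x => x ∈ l i) (fun p => s p.i)
      (fun p => .cons (γ p.i) (enc p.a)) fun p => enc (f p.i p.a)) :
    T s γ fun i => enc ((l i).flatMap (f i)) := by
  refine ((foldl₀ (f := fun i b a => (f i a).foldl (fun b a => a :: b) b) (z := fun _ => []) hl
    nil hlen (foldl₀ (I := FoldIx fun i (_ : List (B i)) a => True ∧ a ∈ l i)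
      (B := fun p => List (B p.i)) (A := fun p => B p.i) (l := fun p => f p.i p.a)
      (s := fun p => s p.i) (f := fun _ b a => a :: b) (z := fun p => p.b)
      ?_ acc ?_ (cons item acc))).reverse ?_).congr fun i => ?_
  · let g : (FoldIx fun i (_ : List (B i)) a => True ∧ a ∈ l i) → MemIx fun i x => x ∈ l i :=
      fun p => ⟨p.i, p.a, p.h.2⟩
    exact (pair self.fst item).comp (hf.reindex g)
  · let g : (FoldIx fun i (_ : List (B i)) a => True ∧ a ∈ l i) → MemIx fun i x => x ∈ l i :=
      fun p => ⟨p.i, p.a, p.h.2⟩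
    exact hlen'.reindex g
  · obtain ⟨d, hd⟩ := hlen'
    refine (hlen.mul ⟨d, fun _ => le_rfl⟩).mono fun i => ?_
    -- The bound on a single piece is uniform in the element, so the total length is at most the
    -- number of elements times it.
    have : ∀ (m : List (A i)) (hm : ∀ x ∈ m, x ∈ l i) (b : List (B i)),
        (m.foldl (fun b a => (f i a).foldl (fun b a => a :: b) b) b).length ≤
          m.length * (s i + 2) ^ d + b.length := by
      intro m hm
      induction m with
      | nil => simp
      | cons x m ih =>
        intro b
        have h1 := ih (fun y hy => hm y (by simp [hy])) ((f i x).foldl (fun b a => a :: b) b)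
        have h2 := hd ⟨i, x, hm x (by simp)⟩
        simp only [List.foldl_cons, List.length_cons, Nat.add_mul] at h1 ⊢
        simp at h1 h2 ⊢
        omega
    simpa using this (l i) (fun _ h => h) []
  · have : ∀ b : List (B i), (l i).foldl (fun b a => (f i a).foldl (fun b a => a :: b) b) b =
        ((l i).flatMap (f i)).reverse ++ b := by
      induction l i with
      | nil => simp
      | cons x m ih => intro b; rw [List.foldl_cons, ih]; simp
    rw [this]
    simp

/-- The indices of a list. -/
theorem range {l : ∀ i, List (A i)} (hl : T s γ fun i => enc (l i))
    (hlen : PB s fun i => (l i).length) : T s γ fun i => enc (List.range (l i).length) := by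
  have key : ∀ i, (l i).foldl (fun (b : ℕ × List ℕ) _ => (b.1 + 1, b.1 :: b.2)) (0, []) =
      ((l i).length, (List.range (l i).length).reverse) := by
    intro i
    induction l i using List.reverseRecOn with
    | nil => rfl
    | append_singleton l x ih => simp [ih, List.range_succ]
  refine (reverse (T.proj₂ (foldl₀ (f := fun _ (b : ℕ × List ℕ) _ => (b.1 + 1, b.1 :: b.2))
    (z := fun _ => (0, [])) hl (mk (nat 0) nil) hlen
    (mk (succ (T.proj₁ acc)) (cons (T.proj₁ acc) (T.proj₂ acc))))) ?_).congr fun i => ?_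
  · simpa [key] using hlen
  · simp [key]

/-- Split a list at a given place. -/
theorem splitAt {l : ∀ i, List (A i)} {k : I → ℕ} (hk : T s γ fun i => enc (k i))
    (hl : T s γ fun i => enc (l i)) (hlen : PB s fun i => (l i).length) :
    T s γ fun i => enc ((l i).take (k i), (l i).drop (k i)) := by
  have key : ∀ i, (l i).foldl (fun (b : ℕ × List (A i) × List (A i)) a =>
      bif decide (b.1 < k i) then (b.1 + 1, a :: b.2.1, b.2.2) else (b.1 + 1, b.2.1, a :: b.2.2))
      (0, [], []) = ((l i).length, ((l i).take (k i)).reverse, ((l i).drop (k i)).reverse) := by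
    intro i
    induction l i using List.reverseRecOn with
    | nil => simp
    | append_singleton l x ih =>
      simp only [List.foldl_append, ih, List.foldl_cons, List.foldl_nil, List.length_append,
        List.length_singleton, List.take_append, List.drop_append]
      by_cases h : l.length < k i
      · obtain ⟨c, hc⟩ : ∃ c, k i - l.length = c + 1 := ⟨k i - l.length - 1, by omega⟩
        simp [h, hc]
      · simp [h, show k i - l.length = 0 by omega]
  have h := foldl₀ (f := fun i (b : ℕ × List (A i) × List (A i)) a =>
      bif decide (b.1 < k i) then (b.1 + 1, a :: b.2.1, b.2.2) else (b.1 + 1, b.2.1, a :: b.2.2))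
    (z := fun _ => (0, [], [])) hl (mk (nat 0) (mk nil nil)) hlen
    (cond (natLt (T.proj₁ acc) (hk.wk FoldIx.i))
      (mk (succ (T.proj₁ acc)) (mk (cons item (T.proj₁ (T.proj₂ acc))) (T.proj₂ (T.proj₂ acc))))
      (mk (succ (T.proj₁ acc)) (mk (T.proj₁ (T.proj₂ acc)) (cons item (T.proj₂ (T.proj₂ acc))))))
  refine (mk (reverse (T.proj₁ (T.proj₂ h)) ?_) (reverse (T.proj₂ (T.proj₂ h)) ?_)).congr
    fun i => ?_
  · exact hlen.mono fun i => by rw [key]; simp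
  · exact hlen.mono fun i => by rw [key]; simp
  · rw [key]; simp

end Lists

end T

/-! ### Tables of permutation groups -/

section Groups

variable {n : ℕ}

/-- Does `g` fix every point below `j`? -/
def fixesBelow (g : Perm (Fin n)) (j : Fin n) : Bool :=
  (List.finRange n).all fun i => !decide (i < j) || decide (g i = i)

@[simp] theorem fixesBelow_iff {g : Perm (Fin n)} {j : Fin n} :
    fixesBelow g j = true ↔ ∀ i < j, g i = i := by
  simp only [fixesBelow, List.all_eq_true, List.mem_finRange, forall_const, Bool.or_eq_true,
    Bool.not_eq_true', decide_eq_false_iff_not, decide_eq_true_eq]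
  exact forall_congr' fun i => by tauto

/-- The first member of the table, or else the identity, that fixes the points below `j` and
takes `j` to `x`. -/
def look (T : List (Perm (Fin n))) (j x : Fin n) : Option (Perm (Fin n)) :=
  (1 :: T).find? fun u => fixesBelow u j && decide (u j = x)

theorem look_some {T : List (Perm (Fin n))} {j x : Fin n} {u : Perm (Fin n)}
    (h : look T j x = some u) : u ∈ 1 :: T ∧ (∀ i < j, u i = i) ∧ u j = x := by
  have h1 := List.mem_of_find?_eq_some h
  have h2 := List.find?_some h
  simp only [Bool.and_eq_true, fixesBelow_iff, decide_eq_true_eq] at h2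
  exact ⟨h1, h2⟩

theorem look_isSome {T : List (Perm (Fin n))} {j x : Fin n} :
    (look T j x).isSome ↔ ∃ u ∈ 1 :: T, (∀ i < j, u i = i) ∧ u j = x := by
  simp only [look, List.find?_isSome, Bool.and_eq_true, fixesBelow_iff, decide_eq_true_eq]

-- The identity heads the searched list, so the trivial position yields the identity itself and
-- never another entry. This makes factorizations unique at fixed points.
@[simp] theorem look_self (T : List (Perm (Fin n))) (j : Fin n) : look T j j = some 1 := by
  have h : (fixesBelow (1 : Perm (Fin n)) j && decide ((1 : Perm (Fin n)) j = j)) = true := by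
    simp
  exact List.find?_cons_of_pos (p := fun u : Perm (Fin n) => fixesBelow u j && decide (u j = j)) h

/-- One step of sifting. -/
def siftStep (T : List (Perm (Fin n))) (g : Perm (Fin n)) (j : Fin n) : Perm (Fin n) :=
  bif fixesBelow g j then (look T j (g j)).elim g fun u => u⁻¹ * g else g

/-- Sift a permutation through a table. -/
def sift (T : List (Perm (Fin n))) (g : Perm (Fin n)) : Perm (Fin n) :=
  (List.finRange n).foldl (siftStep T) g

/-- One step of the computation of a canonical representative. -/
def canonStep (T : List (Perm (Fin n))) (g : Perm (Fin n)) (j : Fin n) : Perm (Fin n) :=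
  ((List.finRange n).findSome? fun v => look T j (g v)).elim g fun u => u⁻¹ * g

/-- A canonical element of the coset of `g`. -/
def canon (T : List (Perm (Fin n))) (g : Perm (Fin n)) : Perm (Fin n) :=
  (List.finRange n).foldl (canonStep T) g

/-- The relation may mention the number of levels already treated. Two folds run side by side
because canonical representatives from different tables have to be compared. -/
theorem foldl_finRange_rel {β β' : Type} (f : β → Fin n → β) (f' : β' → Fin n → β')
    (R : ℕ → β → β' → Prop) {z : β} {z' : β'} (h0 : R 0 z z')
    (hs : ∀ (j : Fin n) b b', R j b b' → R (j + 1) (f b j) (f' b' j)) :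
    R n ((List.finRange n).foldl f z) ((List.finRange n).foldl f' z') := by
  have key : ∀ k ≤ n, R k (((List.finRange n).take k).foldl f z)
      (((List.finRange n).take k).foldl f' z') := by
    intro k
    induction k with
    | zero => simpa using h0
    | succ k ih =>
      intro hk
      have hk' : k < (List.finRange n).length := by simpa using hk
      rw [List.take_succ_eq_append_getElem hk']
      simpa using hs ⟨k, hk⟩ _ _ (ih (by omega))
  have := key n le_rfl
  rwa [List.take_of_length_le (by simp)] at this

theorem foldl_finRange_induct {β : Type} (f : β → Fin n → β) (P : ℕ → β → Prop) {z : β}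
    (h0 : P 0 z) (hs : ∀ (j : Fin n) b, P j b → P (j + 1) (f b j)) :
    P n ((List.finRange n).foldl f z) :=
  foldl_finRange_rel f f (fun k b _ => P k b) (z' := z) h0 fun j b _ h => hs j b h

/-! ### Sifting and the closure of a table -/

/-- The group generated by a list. -/
def gen (T : List (Perm (Fin n))) : Subgroup (Perm (Fin n)) :=
  Subgroup.closure {g | g ∈ T}

theorem mem_gen {T : List (Perm (Fin n))} {g : Perm (Fin n)} (h : g ∈ T) : g ∈ gen T :=
  Subgroup.subset_closure h

theorem mem_gen' {T : List (Perm (Fin n))} {g : Perm (Fin n)} (h : g ∈ 1 :: T) : g ∈ gen T := by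
  rcases List.mem_cons.1 h with rfl | h
  · exact one_mem _
  · exact mem_gen h

theorem gen_le {T : List (Perm (Fin n))} {H : Subgroup (Perm (Fin n))} :
    gen T ≤ H ↔ ∀ g ∈ T, g ∈ H := Subgroup.closure_le _

theorem inv_fix {u : Perm (Fin n)} {i : Fin n} (h : u i = i) : u⁻¹ i = i := by
  rw [Equiv.Perm.inv_eq_iff_eq, h]

/-- Dividing by the entry that agrees with the residue at `j` makes the residue fix `j` as well.
Either this succeeds at all levels and the residue is the identity, or it is stuck at an empty
position. -/
theorem sift_spec (T : List (Perm (Fin n))) (g : Perm (Fin n)) :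
    (∃ s ∈ gen T, sift T g = s * g) ∧ (sift T g = 1 ∨
      ∃ j, (∀ i < j, sift T g i = i) ∧ look T j (sift T g j) = none) := by
  have := foldl_finRange_induct (siftStep T) (fun k r => (∃ s ∈ gen T, r = s * g) ∧
    ((∀ i : Fin n, (i : ℕ) < k → r i = i) ∨
      ∃ j : Fin n, (j : ℕ) < k ∧ (∀ i < j, r i = i) ∧ look T j (r j) = none)) (z := g)
    ⟨⟨1, one_mem _, by simp⟩, .inl fun i hi => absurd hi (by omega)⟩ ?_
  · refine ⟨this.1, this.2.imp (fun h => Equiv.ext fun i => h i i.2) ?_⟩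
    rintro ⟨j, -, h⟩
    exact ⟨j, h⟩
  · rintro j r ⟨⟨s, hs, rfl⟩, h | ⟨j', hj', h1, h2⟩⟩
    · have hfix : fixesBelow (s * g) j = true := fixesBelow_iff.2 fun i hi => h i hi
      rw [siftStep, hfix, cond_true]
      cases hl : look T j ((s * g) j) with
      | none => exact ⟨⟨s, hs, rfl⟩, .inr ⟨j, by omega, fun i hi => h i hi, hl⟩⟩
      | some u =>
        obtain ⟨hu, hu1, hu2⟩ := look_some hl
        refine ⟨⟨u⁻¹ * s, mul_mem (inv_mem (mem_gen' hu)) hs, by simp [mul_assoc]⟩,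
          .inl fun i hi => ?_⟩
        rw [Option.elim_some, Perm.mul_apply]
        rcases Nat.lt_succ_iff_lt_or_eq.1 hi with hi | hi
        · rw [h i hi]; exact inv_fix (hu1 i hi)
        · rw [Fin.ext hi, ← hu2]; simp
    -- Once stuck at `j'`, the residue moves `j'`, because the position of `j'` itself is always
    -- filled by the identity. All later steps are therefore idle.
    · have hfix : fixesBelow (s * g) j = false := by
        rw [Bool.eq_false_iff, Ne, fixesBelow_iff]
        intro h
        rw [h j' hj', look_self] at h2
        cases h2
      rw [siftStep, hfix, cond_false]
      exact ⟨⟨s, hs, rfl⟩, .inr ⟨j', by omega, h1, h2⟩⟩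

/-- Add the residue of `g` to the table. -/
def adjoin (T : List (Perm (Fin n))) (g : Perm (Fin n)) : List (Perm (Fin n)) :=
  bif decide (sift T g = 1) then T else sift T g :: T

/-- The members of the table are distinguished by the positions that they fill. -/
def Slotted (T : List (Perm (Fin n))) : Prop :=
  ∃ S : List (Fin n × Fin n), S.Nodup ∧ S.length = T.length ∧
    ∀ p ∈ S, (look T p.1 p.2).isSome

theorem Slotted.nil : Slotted ([] : List (Perm (Fin n))) := ⟨[], by simp⟩

theorem Slotted.length_le {T : List (Perm (Fin n))} (h : Slotted T) : T.length ≤ n * n := by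
  obtain ⟨S, hS, hl, -⟩ := h
  simpa [hl] using hS.length_le_card

/-- A nontrivial residue is stuck at an empty position, which it fills when it is added; filled
positions stay filled. So the new entry gets a position of its own. -/
theorem Slotted.adjoin {T : List (Perm (Fin n))} (h : Slotted T) (g : Perm (Fin n)) :
    Slotted (adjoin T g) := by
  rw [_root_.adjoin]
  by_cases hg : sift T g = 1
  · simpa [hg] using h
  · simp only [hg, decide_false, cond_false]
    obtain ⟨j, hj, hl⟩ := (sift_spec T g).2.resolve_left hg
    obtain ⟨S, hS, hlen, hs⟩ := h
    refine ⟨(j, sift T g j) :: S, List.nodup_cons.2 ⟨fun hm => ?_, hS⟩, by simp [hlen], ?_⟩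
    · simpa [hl] using hs _ hm
    · intro p hp
      rw [look_isSome]
      rcases List.mem_cons.1 hp with rfl | hp
      · exact ⟨_, by simp, hj, rfl⟩
      · obtain ⟨u, hu, h⟩ := look_isSome.1 (hs p hp)
        exact ⟨u, by simp at hu ⊢; tauto, h⟩

theorem subset_adjoin (T : List (Perm (Fin n))) (g : Perm (Fin n)) : T ⊆ adjoin T g := by
  rw [adjoin]
  cases decide (sift T g = 1) <;> simp

theorem length_le_adjoin (T : List (Perm (Fin n))) (g : Perm (Fin n)) :
    T.length ≤ (adjoin T g).length := by
  rw [adjoin]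
  cases decide (sift T g = 1) <;> simp

theorem sift_eq_one_of_length {T : List (Perm (Fin n))} {g : Perm (Fin n)}
    (h : (adjoin T g).length = T.length) : sift T g = 1 ∧ adjoin T g = T := by
  by_cases hg : sift T g = 1
  · simp [adjoin, hg]
  · simp [adjoin, hg] at h

/-- The residue is `s * g` with `s` in the group of the table, so adding it has the same effect on
the group as adding `g`. -/
theorem gen_adjoin (T : List (Perm (Fin n))) (g : Perm (Fin n)) :
    gen (adjoin T g) = gen T ⊔ Subgroup.zpowers g := by
  obtain ⟨⟨s, hs, he⟩, -⟩ := sift_spec T g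
  have hT : gen T ≤ gen (adjoin T g) := gen_le.2 fun u hu => mem_gen (subset_adjoin T g hu)
  have hsift : sift T g ∈ gen (adjoin T g) := by
    by_cases hg : sift T g = 1
    · rw [hg]; exact one_mem _
    · exact mem_gen (by simp [adjoin, hg])
  apply le_antisymm
  · refine gen_le.2 fun u hu => ?_
    have hsup : sift T g ∈ gen T ⊔ Subgroup.zpowers g := by
      rw [he]
      exact mul_mem (Subgroup.mem_sup_left hs)
        (Subgroup.mem_sup_right (Subgroup.mem_zpowers g))
    by_cases hg : sift T g = 1
    · simp only [adjoin, hg, decide_true, cond_true] at hu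
      exact Subgroup.mem_sup_left (mem_gen hu)
    · simp only [adjoin, hg, decide_false, cond_false, List.mem_cons] at hu
      rcases hu with rfl | hu
      · exact hsup
      · exact Subgroup.mem_sup_left (mem_gen hu)
  · refine sup_le hT (Subgroup.zpowers_le.2 ?_)
    have := mul_mem (inv_mem (hT hs)) hsift
    rwa [he, inv_mul_cancel_left] at this

/-- Add the residues of all products of two members of the table. -/
def closeStep (T : List (Perm (Fin n))) : List (Perm (Fin n)) :=
  ((1 :: T).flatMap fun a => (1 :: T).map fun b => a * b).foldl adjoin T

/-- A list of length `n * n + 1`. -/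
def clock (n : ℕ) : List ℕ := 0 :: (List.range n).flatMap fun _ => List.range n

theorem length_clock (n : ℕ) : (clock n).length = n * n + 1 := by
  simp [clock]

/-- A table of the group generated by a list. -/
def build (gens : List (Perm (Fin n))) : List (Perm (Fin n)) :=
  (clock n).foldl (fun T _ => closeStep T) (gens.foldl adjoin [])

theorem Slotted.foldl {T : List (Perm (Fin n))} (h : Slotted T) (l : List (Perm (Fin n))) :
    Slotted (l.foldl _root_.adjoin T) := by
  induction l generalizing T with
  | nil => exact h
  | cons g l ih => exact ih (h.adjoin g)

theorem Slotted.closeStep {T : List (Perm (Fin n))} (h : Slotted T) : Slotted (closeStep T) := h.foldl _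

theorem length_le_foldl (T l : List (Perm (Fin n))) : T.length ≤ (l.foldl adjoin T).length := by
  induction l generalizing T with
  | nil => exact le_rfl
  | cons g l ih => exact (length_le_adjoin T g).trans (ih _)

/-- Tables only grow. If the length at the end is that at the beginning, then no residue was added
at any time. -/
theorem sift_eq_one_of_foldl {T l : List (Perm (Fin n))}
    (h : (l.foldl adjoin T).length = T.length) :
    (∀ g ∈ l, sift T g = 1) ∧ l.foldl adjoin T = T := by
  induction l generalizing T with
  | nil => simp
  | cons g l ih =>
    rw [List.foldl_cons] at h
    have h1 := length_le_foldl (adjoin T g) l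
    obtain ⟨hg, hT⟩ := sift_eq_one_of_length (le_antisymm (h1.trans h.le) (length_le_adjoin T g))
    rw [hT] at h
    rw [List.foldl_cons, hT]
    obtain ⟨h2, h3⟩ := ih h
    exact ⟨by simpa [hg] using h2, h3⟩

theorem gen_foldl (T l : List (Perm (Fin n))) : gen (l.foldl adjoin T) = gen T ⊔ gen l := by
  induction l generalizing T with
  | nil =>
    have : gen ([] : List (Perm (Fin n))) = ⊥ := by simp [gen]
    rw [List.foldl_nil, this, sup_bot_eq]
  | cons g l ih =>
    rw [List.foldl_cons, ih, gen_adjoin, sup_assoc]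
    congr 1
    rw [gen, gen, Subgroup.zpowers_eq_closure, ← Subgroup.closure_union]
    congr 1
    ext
    simp

theorem gen_closeStep (T : List (Perm (Fin n))) : gen (closeStep T) = gen T := by
  rw [closeStep, gen_foldl, sup_eq_left, gen_le]
  intro g hg
  simp only [List.mem_flatMap, List.mem_map] at hg
  obtain ⟨a, ha, b, hb, rfl⟩ := hg
  exact mul_mem (mem_gen' ha) (mem_gen' hb)

/-- All products of two members of the table sift to the identity. -/
def IsClosedTable (T : List (Perm (Fin n))) : Prop :=
  ∀ a ∈ 1 :: T, ∀ b ∈ 1 :: T, sift T (a * b) = 1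

/-- A round that changes nothing is followed by idle rounds only; every other round adds at least
one entry. -/
theorem iterate_closeStep {T : List (Perm (Fin n))} (k : ℕ) :
    (closeStep (closeStep^[k] T) = closeStep^[k] T) ∨ k ≤ (closeStep^[k] T).length := by
  induction k with
  | zero => simp
  | succ k ih =>
    rw [Function.iterate_succ_apply']
    rcases ih with ih | ih
    · rw [ih]; exact .inl ih
    · by_cases h : (closeStep (closeStep^[k] T)).length = (closeStep^[k] T).length
      · have := (sift_eq_one_of_foldl h).2
        rw [← closeStep] at this
        rw [this]
        exact .inl this
      · have : (closeStep^[k] T).length ≤ (closeStep (closeStep^[k] T)).length := length_le_foldl _ _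
        exact .inr (by omega)

theorem build_eq (gens : List (Perm (Fin n))) :
    build gens = closeStep^[n * n + 1] (gens.foldl adjoin []) := by
  rw [build, List.foldl_const, length_clock]

theorem slotted_iterate {T : List (Perm (Fin n))} (h : Slotted T) (k : ℕ) :
    Slotted (closeStep^[k] T) := by
  induction k with
  | zero => exact h
  | succ k ih => rw [Function.iterate_succ_apply']; exact ih.closeStep

theorem slotted_build (gens : List (Perm (Fin n))) : Slotted (build gens) := by
  rw [build_eq]
  exact slotted_iterate (Slotted.nil.foldl gens) _

theorem gen_build (gens : List (Perm (Fin n))) : gen (build gens) = gen gens := by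
  have h : ∀ k (T : List (Perm (Fin n))), gen (closeStep^[k] T) = gen T := by
    intro k T
    induction k with
    | zero => rfl
    | succ k ih => rw [Function.iterate_succ_apply', gen_closeStep, ih]
  rw [build_eq, h, gen_foldl, show gen ([] : List (Perm (Fin n))) = ⊥ by simp [gen], bot_sup_eq]

/-- There are `n * n + 1` rounds but at most `n * n` entries, so the table has become stationary. An
idle round means that all the products tested in it sift to the identity. -/
theorem isClosedTable_build (gens : List (Perm (Fin n))) : IsClosedTable (build gens) := by
  have h := iterate_closeStep (T := gens.foldl adjoin []) (n * n + 1)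
  have hl := (slotted_build gens).length_le
  rw [build_eq] at hl ⊢
  have hfix := h.resolve_right (by omega)
  set T := closeStep^[n * n + 1] (gens.foldl adjoin [])
  have := (sift_eq_one_of_foldl (congrArg List.length hfix)).1
  intro a ha b hb
  exact this _ (List.mem_flatMap.2 ⟨a, ha, List.mem_map.2 ⟨b, hb, rfl⟩⟩)

/-! ### Closed tables contain their group level by level -/

/-- The table contains the group `Θ` level by level. -/
structure IsTable (T : List (Perm (Fin n))) (Θ : Subgroup (Perm (Fin n))) : Prop where
  mem : ∀ u ∈ T, u ∈ Θ
  look : ∀ g ∈ Θ, ∀ j, (∀ i < j, g i = i) → (look T j (g j)).isSome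

/-- `g` is a product of table entries of the levels from `k` on. -/
inductive Sifts (T : List (Perm (Fin n))) : ℕ → Perm (Fin n) → Prop
  | done : Sifts T n 1
  | step (j : Fin n) {u s : Perm (Fin n)} (hu : look T j (u j) = some u)
      (hs : Sifts T (j + 1) s) : Sifts T j (u * s)

namespace Sifts

variable {T : List (Perm (Fin n))}

theorem fix {k : ℕ} {g : Perm (Fin n)} (h : Sifts T k g) (i : Fin n) (hi : (i : ℕ) < k) :
    g i = i := by
  induction h with
  | done => rfl
  | step j hu _ ih =>
    rw [Perm.mul_apply, ih (by omega)]
    exact (look_some hu).2.1 i hi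

theorem exists_eq {k : ℕ} {g : Perm (Fin n)} (h : Sifts T k g) (j : Fin n) (hj : (j : ℕ) = k) :
    ∃ u s, look T j (u j) = some u ∧ Sifts T (j + 1) s ∧ g = u * s := by
  cases h with
  | done => omega
  | step j' hu hs =>
    obtain rfl := Fin.ext hj
    exact ⟨_, _, hu, hs, rfl⟩

theorem one_mul {j : Fin n} {g : Perm (Fin n)} (h : Sifts T (j + 1) g) : Sifts T j g := by
  have := Sifts.step (u := 1) j (by simp) h
  rwa [_root_.one_mul] at this

/-- The quotients taken while sifting, read backwards, are the factors of `g`. -/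
theorem of_sift {g : Perm (Fin n)} (h : sift T g = 1) : Sifts T 0 g := by
  -- The invariant is an implication: a factorization of the current residue from level `k` on would
  -- extend to one of `g`. At the end the residue is the identity, which has one.
  have := foldl_finRange_induct (siftStep T) (fun k r => Sifts T k r → Sifts T 0 g) (z := g)
    (fun h => h) ?_
  · refine this ?_
    rw [← sift, h]
    exact .done
  · intro j r ih hr
    refine ih ?_
    rw [siftStep] at hr
    cases hf : fixesBelow r j with
    | false => rw [hf] at hr; exact hr.one_mul
    | true =>
      rw [hf, cond_true] at hr
      cases hl : look T j (r j) with
      | none => rw [hl] at hr; exact hr.one_mul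
      | some u =>
        rw [hl] at hr
        have := Sifts.step (u := u) j (by rw [(look_some hl).2.2, hl]) hr
        simpa using this

/-- Where `g` fixes the point of a level, the factor of that level fixes it too and is the identity
by `look_self`, so it can be dropped. -/
theorem raise {g : Perm (Fin n)} (h : Sifts T 0 g) (k : ℕ) (hk : k ≤ n)
    (hg : ∀ i : Fin n, (i : ℕ) < k → g i = i) : Sifts T k g := by
  induction k with
  | zero => exact h
  | succ k ih =>
    obtain ⟨u, s, hu, hs, rfl⟩ := (ih (by omega) fun i hi => hg i (by omega)).exists_eq ⟨k, hk⟩ rfl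
    have h1 := hg ⟨k, hk⟩ (by simp)
    rw [Perm.mul_apply, hs.fix _ (by simp)] at h1
    rw [h1, look_self, Option.some_inj] at hu
    rwa [← hu, _root_.one_mul]

/-- The left factor is split into table entries of levels from `k` on, which are multiplied on one
after the other. -/
theorem mul_of {k : ℕ} (hk : ∀ v ∈ 1 :: T, (∀ i : Fin n, (i : ℕ) < k → v i = i) → ∀ y,
    Sifts T k y → Sifts T k (v * y)) {m : ℕ} {x y : Perm (Fin n)} (hx : Sifts T m x)
    (hm : k ≤ m) (hy : Sifts T k y) : Sifts T k (x * y) := by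
  induction hx with
  | done => rwa [_root_.one_mul]
  | step j hu _ ih =>
    rw [mul_assoc]
    obtain ⟨h1, h2, -⟩ := look_some hu
    exact hk _ h1 (fun i hi => h2 i (by change (i : ℕ) < j; omega)) _ (ih (by omega))

/-- This is the core of the Schreier-Sims argument, by induction from the deepest level upwards.
Write `y = u * s` with `u` of level `k`. As `v * u` sifts to the identity, it equals `u' * s'` with
`u'` of level `k`, and `s' * s` is factored on level `k + 1` by the induction hypothesis. -/
theorem mem_mul (hT : IsClosedTable T) {k : ℕ} (hkn : k ≤ n) :
    ∀ v ∈ 1 :: T, (∀ i : Fin n, (i : ℕ) < k → v i = i) → ∀ y, Sifts T k y → Sifts T k (v * y) := by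
  induction hkn using Nat.decreasingInduction with
  | self =>
    intro v _ hv y hy
    have : v = 1 := Equiv.ext fun i => hv i i.2
    rwa [this, _root_.one_mul]
  | of_succ k hk ih =>
    intro v hvT hv y hy
    obtain ⟨u, s, hu, hs, rfl⟩ := hy.exists_eq ⟨k, hk⟩ rfl
    have hu' := look_some hu
    have h1 := (of_sift (hT v hvT u hu'.1)).raise k hk.le fun i hi => by
      rw [Perm.mul_apply, hu'.2.1 i hi, hv i hi]
    obtain ⟨u', s', hu'', hs', he⟩ := h1.exists_eq ⟨k, hk⟩ rfl
    rw [← mul_assoc, he, mul_assoc]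
    exact .step _ hu'' (mul_of ih hs' le_rfl hs)

end Sifts

/-- By `Sifts.mem_mul` on level `0` every element of the generated group is a product of entries of
increasing levels. If it fixes the points below `j`, its first possible nontrivial factor is an
entry of level `j` with the same image of `j`. -/
theorem IsClosedTable.isTable {T : List (Perm (Fin n))} (hT : IsClosedTable T) :
    IsTable T (gen T) := by
  refine ⟨fun u hu => mem_gen hu, fun g hg j hj => ?_⟩
  have h1 : Sifts T 0 (1 : Perm (Fin n)) := by
    have h := hT 1 (by simp) 1 (by simp)
    rw [one_mul] at h
    exact .of_sift h
  have : Sifts T 0 g := by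
    clear hj
    -- In a finite group the generators generate the group as a monoid, so inverses of entries need
    -- not be considered.
    rw [gen, ← Subgroup.mem_toSubmonoid, Subgroup.closure_toSubmonoid_of_finite] at hg
    induction hg using Submonoid.closure_induction_left with
    | one => exact h1
    | mul_left x hx y _ ih =>
      exact Sifts.mem_mul hT (Nat.zero_le n) x (List.mem_cons_of_mem _ hx)
        (fun i hi => absurd hi (by omega)) y ih
  obtain ⟨u, s, hu, hs, rfl⟩ := (this.raise j j.2.le fun i hi => hj i hi).exists_eq j rfl
  rw [Perm.mul_apply, hs.fix _ (by simp), hu]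
  rfl

theorem isTable_build (gens : List (Perm (Fin n))) : IsTable (build gens) (gen gens) := by
  rw [← gen_build]
  exact (isClosedTable_build gens).isTable

/-! ### Canonical representatives of cosets -/

namespace IsTable

variable {T T' : List (Perm (Fin n))} {Θ Θ' : Subgroup (Perm (Fin n))}

/-- An element of `Θ` leaves a residue in `Θ`, and this cannot get stuck because every position that
`Θ` needs is filled. -/
theorem gen_eq (h : IsTable T Θ) : gen T = Θ := by
  refine le_antisymm (gen_le.2 h.mem) fun g hg => ?_
  obtain ⟨⟨s, hs, he⟩, h1⟩ := sift_spec T g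
  have hsΘ : s ∈ Θ := gen_le.2 h.mem hs
  have : sift T g = 1 := by
    refine h1.resolve_right ?_
    rintro ⟨j, hj, hl⟩
    have := h.look (sift T g) (he ▸ mul_mem hsΘ hg) j hj
    rw [hl] at this
    cases this
  rw [eq_inv_of_mul_eq_one_right (he.symm.trans this)]
  exact inv_mem hs

theorem mem' (h : IsTable T Θ) {u : Perm (Fin n)} (hu : u ∈ 1 :: T) : u ∈ Θ :=
  h.gen_eq ▸ mem_gen' hu

theorem look_isSome_iff (h : IsTable T Θ) {j x : Fin n} :
    (_root_.look T j x).isSome ↔ ∃ g ∈ Θ, (∀ i < j, g i = i) ∧ g j = x := by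
  constructor
  · intro hl
    obtain ⟨u, hu, h1⟩ := look_isSome.1 hl
    exact ⟨u, h.mem' hu, h1⟩
  · rintro ⟨g, hg, h1, rfl⟩
    exact h.look g hg j h1

theorem canon_mem (h : IsTable T Θ) (g : Perm (Fin n)) : ∃ θ ∈ Θ, canon T g = θ * g := by
  refine foldl_finRange_induct (canonStep T) (fun _ r => ∃ θ ∈ Θ, r = θ * g)
    ⟨1, one_mem _, by simp⟩ ?_
  rintro j _ ⟨θ, hθ, rfl⟩
  rw [canonStep]
  cases hl : (List.finRange n).findSome? fun v => _root_.look T j ((θ * g) v) with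
  | none => exact ⟨θ, hθ, rfl⟩
  | some u =>
    obtain ⟨v, -, hv⟩ := List.exists_of_findSome?_eq_some hl
    exact ⟨u⁻¹ * θ, mul_mem (inv_mem (h.mem' (look_some hv).1)) hθ, by simp [mul_assoc]⟩

/-- Level `j` moves to `j` the image of the first `v` that can be moved there by elements of `Θ`
fixing the points below `j`. This choice depends only on orbits. The freedom that remains is an
element of `Θ` fixing all points treated so far, and at the end only the identity is left. -/
theorem canon_eq (h : IsTable T Θ) (h' : IsTable T' Θ) {θ : Perm (Fin n)} (hθ : θ ∈ Θ)
    (g : Perm (Fin n)) : canon T g = canon T' (θ * g) := by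
  have := foldl_finRange_rel (canonStep T) (canonStep T') (fun k a b => ∃ θ ∈ Θ,
    (∀ i : Fin n, (i : ℕ) < k → θ i = i) ∧ b = θ * a) (z := g) (z' := θ * g)
    ⟨θ, hθ, fun i hi => absurd hi (by omega), rfl⟩ ?_
  · obtain ⟨θ, -, h1, h2⟩ := this
    have : θ = 1 := Equiv.ext fun i => h1 i i.2
    rw [this, one_mul] at h2
    exact h2.symm
  · rintro j a _ ⟨θ, hθ, hfix, rfl⟩
    have hiff : ∀ v, (_root_.look T j (a v)).isSome ↔ (_root_.look T' j ((θ * a) v)).isSome := by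
      intro v
      rw [h.look_isSome_iff, h'.look_isSome_iff]
      constructor
      · rintro ⟨g, hg, h1, h2⟩
        exact ⟨θ * g, mul_mem hθ hg, fun i hi => by rw [Perm.mul_apply, h1 i hi, hfix i hi],
          by rw [Perm.mul_apply, h2, Perm.mul_apply]⟩
      · rintro ⟨g, hg, h1, h2⟩
        exact ⟨θ⁻¹ * g, mul_mem (inv_mem hθ) hg,
          fun i hi => by rw [Perm.mul_apply, h1 i hi, inv_fix (hfix i hi)],
          by rw [Perm.mul_apply, h2, Perm.mul_apply]; simp⟩
    -- The search cannot fail: the preimage of `j` qualifies through the identity.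
    have hex : ((List.finRange n).findSome? fun v => _root_.look T j (a v)).isSome := by
      rw [List.findSome?_isSome_iff]
      exact ⟨a⁻¹ j, by simp, by simp⟩
    obtain ⟨u, hu⟩ := Option.isSome_iff_exists.1 hex
    obtain ⟨l₁, v, l₂, hl, hv, hl₁⟩ := List.findSome?_eq_some_iff.1 hu
    obtain ⟨u', hu'⟩ := Option.isSome_iff_exists.1 ((hiff v).1 (by rw [hv]; rfl))
    have hu'' : ((List.finRange n).findSome? fun v => _root_.look T' j ((θ * a) v)) = some u' := by
      refine List.findSome?_eq_some_iff.2 ⟨l₁, v, l₂, hl, hu', fun x hx => ?_⟩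
      have := hiff x
      rw [hl₁ x hx] at this
      simpa using this
    rw [canonStep, canonStep, hu, hu'']
    obtain ⟨m1, f1, e1⟩ := look_some hv
    obtain ⟨m2, f2, e2⟩ := look_some hu'
    -- The states become `u⁻¹ * a` and `u'⁻¹ * (θ * a)`, whose quotient is this element. It fixes
    -- `j` since `u` takes `j` to `a v` and `u'` takes `j` to `(θ * a) v`.
    refine ⟨u'⁻¹ * θ * u, mul_mem (mul_mem (inv_mem (h'.mem' m2)) hθ) (h.mem' m1), ?_,
      by simp [mul_assoc]⟩
    intro i hi
    rw [Perm.mul_apply, Perm.mul_apply]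
    rcases Nat.lt_succ_iff_lt_or_eq.1 hi with hi | hi
    · rw [f1 i hi, hfix i hi, inv_fix (f2 i hi)]
    · rw [Fin.ext hi, e1, Equiv.Perm.inv_eq_iff_eq, e2, Perm.mul_apply]

/-- This turns membership in a coset into a comparison of representatives; the search uses it to
recognize the labelings that belong to `Λ`. -/
theorem canon_eq_iff (h : IsTable T Θ) {g g' : Perm (Fin n)} :
    canon T g' = canon T g ↔ g' * g⁻¹ ∈ Θ := by
  constructor
  · intro he
    obtain ⟨θ, hθ, e⟩ := h.canon_mem g
    obtain ⟨θ', hθ', e'⟩ := h.canon_mem g'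
    rw [e, e'] at he
    have : g' * g⁻¹ = θ'⁻¹ * θ := by
      rw [mul_inv_eq_iff_eq_mul, mul_assoc, ← he]; simp
    rw [this]
    exact mul_mem (inv_mem hθ') hθ
  · intro hm
    have := h.canon_eq h hm g
    rw [this]
    simp

end IsTable

/-! ### Normal forms of permutation groups -/

/-- The members of the table that fix the points up to `j`. -/
def stab (T : List (Perm (Fin n))) (j : Fin n) : List (Perm (Fin n)) :=
  T.filter fun u => fixesBelow u j && decide (u j = j)

/-- The subgroup of the elements that fix the points up to `j`. -/
def fixUpTo (Θ : Subgroup (Perm (Fin n))) (j : Fin n) : Subgroup (Perm (Fin n)) where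
  carrier := {g | g ∈ Θ ∧ ∀ i ≤ j, g i = i}
  mul_mem' := fun ha hb => ⟨mul_mem ha.1 hb.1, fun i hi => by
    rw [Perm.mul_apply, hb.2 i hi, ha.2 i hi]⟩
  one_mem' := ⟨one_mem _, fun _ _ => rfl⟩
  inv_mem' := fun ha => ⟨inv_mem ha.1, fun i hi => inv_fix (ha.2 i hi)⟩

/-- No new entries are required: positions of levels up to `j` are needed only for the identity, and
entries of deeper levels fix the points up to `j` anyway. -/
theorem IsTable.stab {T : List (Perm (Fin n))} {Θ : Subgroup (Perm (Fin n))} (h : IsTable T Θ)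
    (j : Fin n) : IsTable (stab T j) (fixUpTo Θ j) := by
  have hmem : ∀ u, u ∈ _root_.stab T j ↔ u ∈ T ∧ ∀ i ≤ j, u i = i := by
    intro u
    simp only [_root_.stab, List.mem_filter, Bool.and_eq_true, fixesBelow_iff, decide_eq_true_eq]
    refine and_congr_right fun _ => ⟨fun h i hi => ?_, fun h => ⟨fun i hi => h i hi.le, h j le_rfl⟩⟩
    rcases hi.lt_or_eq with hi | rfl
    · exact h.1 i hi
    · exact h.2
  refine ⟨fun u hu => ?_, fun g hg k hk => ?_⟩
  · rw [hmem] at hu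
    exact ⟨h.mem u hu.1, hu.2⟩
  · rcases le_or_gt k j with hkj | hkj
    · rw [hg.2 k hkj, look_self]; rfl
    · obtain ⟨u, hu, h1, h2⟩ := look_isSome.1 (h.look g hg.1 k hk)
      refine look_isSome.2 ⟨u, ?_, h1, h2⟩
      rcases List.mem_cons.1 hu with rfl | hu
      · simp
      · exact List.mem_cons_of_mem _ ((hmem u).2 ⟨hu, fun i hi => h1 i (hi.trans_lt hkj)⟩)

/-- A list of permutations that depends only on the group of the table and determines it. -/
def normalForm (T : List (Perm (Fin n))) : List (Perm (Fin n)) :=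
  (List.finRange n).flatMap fun j => (List.finRange n).filterMap fun x =>
    (look T j x).elim none fun u => some (canon (stab T j) u⁻¹)

/-- The elements of `Θ` that fix the points below `j` and take `j` to `x` form a left coset of
`fixUpTo Θ j`. Their inverses form a right coset, to which `canon` applies; so the chosen element
depends on `Θ`, `j` and `x` only. -/
theorem IsTable.normalForm_eq {T T' : List (Perm (Fin n))} {Θ : Subgroup (Perm (Fin n))}
    (h : IsTable T Θ) (h' : IsTable T' Θ) : normalForm T = normalForm T' := by
  rw [normalForm, normalForm]
  congr 1
  funext j
  congr 1
  funext x
  have hiff : (_root_.look T j x).isSome ↔ (_root_.look T' j x).isSome := by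
    rw [h.look_isSome_iff, h'.look_isSome_iff]
  cases hl : _root_.look T j x with
  | none =>
    rw [hl] at hiff
    rw [Option.not_isSome_iff_eq_none.1 (mt hiff.2 (by simp))]
    rfl
  | some u =>
    rw [hl] at hiff
    obtain ⟨u', hu'⟩ := Option.isSome_iff_exists.1 (hiff.1 rfl)
    rw [hu', Option.elim_some, Option.elim_some]
    obtain ⟨m1, f1, e1⟩ := look_some hl
    obtain ⟨m2, f2, e2⟩ := look_some hu'
    rw [(h.stab j).canon_eq (h'.stab j) (θ := u'⁻¹ * u) ?_ u⁻¹]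
    · simp
    · refine ⟨mul_mem (inv_mem (h'.mem' m2)) (h.mem' m1), fun i hi => ?_⟩
      rw [Perm.mul_apply]
      rcases hi.lt_or_eq with hi | rfl
      · rw [f1 i hi, inv_fix (f2 i hi)]
      · rw [e1, ← e2]; simp

/-- Replacing an entry by another element of the same left coset of `fixUpTo Θ j` leaves it in its
position, so the inverses of the normal form fill all positions again and determine the group. -/
theorem IsTable.normalForm_isTable {T : List (Perm (Fin n))} {Θ : Subgroup (Perm (Fin n))}
    (h : IsTable T Θ) : IsTable ((normalForm T).map fun g => g⁻¹) Θ := by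
  have hmem : ∀ w, w ∈ normalForm T ↔ ∃ j x u, _root_.look T j x = some u ∧
      w = canon (_root_.stab T j) u⁻¹ := by
    intro w
    simp only [normalForm, List.mem_flatMap, List.mem_finRange, true_and, List.mem_filterMap]
    refine exists_congr fun j => exists_congr fun x => ?_
    cases _root_.look T j x <;> simp [eq_comm]
  refine ⟨fun u hu => ?_, fun g hg j hj => ?_⟩
  · obtain ⟨w, hw, rfl⟩ := List.mem_map.1 hu
    obtain ⟨j, x, u, hl, rfl⟩ := (hmem w).1 hw
    obtain ⟨θ, hθ, he⟩ := (h.stab j).canon_mem u⁻¹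
    rw [he]
    exact inv_mem (mul_mem hθ.1 (inv_mem (h.mem' (look_some hl).1)))
  · obtain ⟨u, hu⟩ := Option.isSome_iff_exists.1 (h.look g hg j hj)
    obtain ⟨m, f, e⟩ := look_some hu
    obtain ⟨θ, hθ, he⟩ := (h.stab j).canon_mem u⁻¹
    refine look_isSome.2 ⟨(canon (_root_.stab T j) u⁻¹)⁻¹, List.mem_cons_of_mem _
      (List.mem_map.2 ⟨_, (hmem _).2 ⟨j, _, u, hu, rfl⟩, rfl⟩), fun i hi => ?_, ?_⟩
    · rw [he, mul_inv_rev, inv_inv, Perm.mul_apply, inv_fix (hθ.2 i hi.le), f i hi]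
    · rw [he, mul_inv_rev, inv_inv, Perm.mul_apply, inv_fix (hθ.2 j le_rfl), e]

theorem IsTable.eq_of_normalForm {T T' : List (Perm (Fin n))} {Θ Θ' : Subgroup (Perm (Fin n))}
    (h : IsTable T Θ) (h' : IsTable T' Θ') (he : normalForm T = normalForm T') : Θ = Θ' := by
  rw [← h.normalForm_isTable.gen_eq, he, h'.normalForm_isTable.gen_eq]

end Groups

/-! ### Lexicographic comparison and sorting -/

instance : Enc Ordering := ⟨fun o => .atom (match o with | .lt => 0 | .eq => 1 | .gt => 2)⟩

section Compare

variable {α : Type}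

/-- Comparison with respect to a linear order. -/
def ordCmp [LinearOrder α] (a b : α) : Ordering := cmp a b

/-- One step of a lexicographic comparison. -/
def cmpStep (c : α → α → Ordering) (b : Ordering × List α) (a : α) : Ordering × List α :=
  bif decide (b.1 = .eq) then b.2.head?.elim (.gt, []) fun x => (c a x, b.2.tail) else b

/-- Lexicographic comparison of lists. -/
def cmpLex (c : α → α → Ordering) (l l' : List α) : Ordering :=
  bif decide ((l.foldl (cmpStep c) (.eq, l')).1 = .eq) then
    bif (l.foldl (cmpStep c) (.eq, l')).2.isEmpty then .eq else .lt
  else (l.foldl (cmpStep c) (.eq, l')).1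

theorem foldl_cmpStep_of_ne (c : α → α → Ordering) (l : List α) {b : Ordering × List α}
    (h : b.1 ≠ .eq) : l.foldl (cmpStep c) b = b := by
  induction l with
  | nil => rfl
  | cons a l ih => rw [List.foldl_cons, show cmpStep c b a = b by simp [cmpStep, h], ih]

/-- The state holds the verdict so far and the unread part of the second list. Running out of it
gives `.gt`; a remainder after equal beginnings gives `.lt`. -/
theorem cmpLex_eq [LinearOrder α] (l l' : List α) : cmpLex ordCmp l l' = ordCmp l l' := by
  induction l generalizing l' with
  | nil => cases l' <;> simp [cmpLex, ordCmp, cmp, cmpUsing]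
  | cons a l ih =>
    cases l' with
    | nil =>
      have h : cmpStep ordCmp (.eq, []) a = (.gt, []) := rfl
      rw [cmpLex, List.foldl_cons, h, foldl_cmpStep_of_ne _ _ (by simp)]
      simp [ordCmp, cmp, cmpUsing]
    | cons x l' =>
      have h : cmpStep ordCmp (.eq, x :: l') a = (ordCmp a x, l') := rfl
      rw [cmpLex, List.foldl_cons, h]
      rcases lt_trichotomy a x with hax | rfl | hax
      · rw [ordCmp, hax.cmp_eq_lt, foldl_cmpStep_of_ne _ _ (by simp)]
        simp [ordCmp, cmp, cmpUsing, List.cons_lt_cons_iff, hax]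
      · rw [show ordCmp a a = .eq from cmp_self_eq_eq a, ← cmpLex, ih]
        simp only [ordCmp, cmp, cmpUsing, List.cons_lt_cons_iff, lt_irrefl, true_and, false_or]
        split_ifs <;> rfl
      · rw [ordCmp, hax.cmp_eq_gt, foldl_cmpStep_of_ne _ _ (by simp)]
        simp [ordCmp, cmp, cmpUsing, List.cons_lt_cons_iff, hax, hax.not_gt, hax.ne, hax.ne']

variable [LinearOrder α]

/-- Insert an element into a sorted list. -/
def sortInsert (l : List α) (a : α) : List α :=
  l.filter (fun b => decide (ordCmp b a = .lt)) ++
    a :: l.filter fun b => !decide (ordCmp b a = .lt)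

/-- Sort a list. -/
def sortList (l : List α) : List α := l.foldl sortInsert []

theorem sortInsert_perm (l : List α) (a : α) : (sortInsert l a).Perm (a :: l) :=
  List.perm_middle.trans ((List.filter_append_perm _ l).cons a)

theorem foldl_sortInsert_perm (l m : List α) : (l.foldl sortInsert m).Perm (l ++ m) := by
  induction l generalizing m with
  | nil => rfl
  | cons a l ih =>
    refine (ih _).trans (((sortInsert_perm m a).append_left l).trans ?_)
    exact List.perm_middle

theorem sortList_perm (l : List α) : (sortList l).Perm l := by
  exact (foldl_sortInsert_perm l []).trans (by simp)

theorem sortInsert_sorted {l : List α} (h : l.Pairwise (· ≤ ·)) (a : α) :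
    (sortInsert l a).Pairwise (· ≤ ·) := by
  simp only [sortInsert, List.pairwise_append, List.pairwise_cons, List.mem_filter,
    decide_eq_true_eq, ordCmp, cmp_eq_lt_iff, Bool.not_eq_true', decide_eq_false_iff_not, not_lt,
    List.mem_cons]
  refine ⟨h.filter _, ⟨fun b hb => hb.2, h.filter _⟩, ?_⟩
  rintro x ⟨-, hx⟩ y (rfl | ⟨-, hy⟩)
  · exact hx.le
  · exact hx.le.trans hy

theorem sortList_sorted (l : List α) : (sortList l).Pairwise (· ≤ ·) := by
  have : ∀ m : List α, m.Pairwise (· ≤ ·) → (l.foldl sortInsert m).Pairwise (· ≤ ·) := by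
    induction l with
    | nil => exact fun m h => h
    | cons a l ih => exact fun m h => ih _ (sortInsert_sorted h a)
  exact this [] List.Pairwise.nil

theorem sortList_eq {l l' : List α} (h : l.Perm l') : sortList l = sortList l' :=
  List.Perm.eq_of_pairwise' (sortList_sorted l) (sortList_sorted l')
    (((sortList_perm l).trans h).trans (sortList_perm l').symm)

end Compare

namespace T

variable {I J : Type} {s : I → ℕ} {γ a b : I → Data} {A : I → Type} [∀ i, Enc (A i)]

theorem ord (o : Ordering) : T s γ fun _ => enc o := atom _

theorem ordEq {x y : I → Ordering} (hx : T s γ fun i => enc (x i)) (hy : T s γ fun i => enc (y i)) :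
    T s γ fun i => enc (decide (x i = y i)) :=
  (natEq (x := fun i => match x i with | .lt => 0 | .eq => 1 | .gt => 2)
    (y := fun i => match y i with | .lt => 0 | .eq => 1 | .gt => 2) hx hy).congr fun i => by
      cases x i <;> cases y i <;> rfl

theorem cmpLex {l l' : ∀ i, List (A i)} {c : ∀ i, A i → A i → Ordering}
    (hl : T s γ fun i => enc (l i)) (hl' : T s γ fun i => enc (l' i))
    (hlen : PB s fun i => (l i).length)
    (hc : T (I := MemIx fun i (p : A i × A i) => p.1 ∈ l i ∧ p.2 ∈ l' i) (fun p => s p.i)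
      (fun p => .cons (γ p.i) (enc p.a)) fun p => enc (c p.i p.a.1 p.a.2)) :
    T s γ fun i => enc (cmpLex (c i) (l i) (l' i)) := by
  have h : T s γ fun i => enc ((l i).foldl (cmpStep (c i)) (Ordering.eq, l' i)) := by
    -- The invariant ensures that only members of the given lists are ever compared, so that bounds
    -- known for these members are available to `c`.
    refine foldl (fun i b => ∀ x ∈ b.2, x ∈ l' i) hl (mk (ord _) hl') hlen (fun i x hx => hx) ?_
      (cond (ordEq (T.proj₁ acc) (ord _)) (elim (head? (T.proj₂ acc)) (mk (ord _) nil)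
        (mk ?_ (tail (T.proj₂ (up acc))))) acc)
    · intro i b a hb _
      rw [cmpStep]
      cases decide (b.1 = Ordering.eq) with
      | false => exact hb
      | true =>
        rw [cond_true]
        cases hh : b.2.head? with
        | none => simp
        | some x => exact fun y hy => hb y (List.mem_of_mem_tail hy)
    · let g : (MemIx (I := FoldIx fun i (b : Ordering × List (A i)) a =>
          (∀ x ∈ b.2, x ∈ l' i) ∧ a ∈ l i) (A := fun p => A p.i) fun p x => p.b.2.head? = Option.some x) →
          MemIx fun i (p : A i × A i) => p.1 ∈ l i ∧ p.2 ∈ l' i :=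
        fun p => ⟨p.i.i, (p.i.a, p.a), p.i.h.2, p.i.h.1 _ (List.mem_of_mem_head? p.h)⟩
      exact (pair (up (self.fst)) (pair (up item) elem)).comp (hc.reindex g)
  exact cond (ordEq (T.proj₁ h) (ord _)) (cond (isEmpty (T.proj₂ h)) (ord _) (ord _)) (T.proj₁ h)

theorem natCmp {x y : I → ℕ} (hx : T s γ fun i => enc (x i)) (hy : T s γ fun i => enc (y i)) :
    T s γ fun i => enc (ordCmp (x i) (y i)) :=
  (cond (natLt hx hy) (ord .lt) (cond (natLt hy hx) (ord .gt) (ord .eq))).congr fun i => by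
    congr 1
    simp only [ordCmp, cmp, cmpUsing, Bool.cond_decide]

theorem cmpNats {l l' : I → List ℕ} (hl : T s γ fun i => enc (l i))
    (hl' : T s γ fun i => enc (l' i)) (hlen : PB s fun i => (l i).length) :
    T s γ fun i => enc (ordCmp (l i) (l' i)) :=
  (cmpLex (c := fun _ => ordCmp) hl hl' hlen (natCmp (T.proj₁ elem) (T.proj₂ elem))).congr
    fun i => by rw [cmpLex_eq]

theorem cmpWords {l l' : I → List (List ℕ)} (hl : T s γ fun i => enc (l i))
    (hl' : T s γ fun i => enc (l' i)) (hlen : PB s fun i => (l i).length)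
    (hlen' : PB (I := MemIx fun i x => x ∈ l i) (fun p => s p.i) fun p => p.a.length) :
    T s γ fun i => enc (ordCmp (l i) (l' i)) := by
  let g : (MemIx fun i (p : List ℕ × List ℕ) => p.1 ∈ l i ∧ p.2 ∈ l' i) →
    MemIx fun i x => x ∈ l i := fun p => ⟨p.i, p.a.1, p.h.1⟩
  exact (cmpLex (c := fun _ => ordCmp) hl hl' hlen (cmpNats (T.proj₁ elem) (T.proj₂ elem)
    (hlen'.reindex g))).congr fun i => by rw [cmpLex_eq]

theorem sortNats {l : I → List (List ℕ)} (hl : T s γ fun i => enc (l i))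
    (hlen : PB s fun i => (l i).length)
    (hlen' : PB (I := MemIx fun i x => x ∈ l i) (fun p => s p.i) fun p => p.a.length) :
    T s γ fun i => enc (sortList (l i)) := by
  let K := FoldIx fun i (b : List (List ℕ)) a => ∃ l₁ l₂, l i = l₁ ++ a :: l₂ ∧
    b = List.foldl sortInsert [] l₁
  -- The partially sorted list is a permutation of a prefix of `l`, and thus inherits the bounds on
  -- the length of the list and of its members.
  have hperm : ∀ p : K, ∃ l₁ l₂, l p.i = l₁ ++ p.a :: l₂ ∧ p.b.Perm l₁ := by
    intro p
    obtain ⟨l₁, l₂, h, h'⟩ := p.h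
    exact ⟨l₁, l₂, h, h' ▸ sortList_perm l₁⟩
  have hb : PB (fun p : K => s p.i) fun p => p.b.length := by
    refine (hlen.reindex fun p : K => p.i).mono fun p => ?_
    obtain ⟨l₁, l₂, h, h'⟩ := hperm p
    rw [h, h'.length_eq]
    simp
  let g : (MemIx fun (p : K) x => x ∈ p.b) → MemIx fun i x => x ∈ l i :=
    fun q => ⟨q.i.i, q.a, by
      obtain ⟨l₁, l₂, h, h'⟩ := hperm q.i
      rw [h]
      exact List.mem_append_left _ (h'.mem_iff.1 q.h)⟩
  have hc : T (I := MemIx fun (p : K) x => x ∈ p.b) (fun q => s q.i.i)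
      (fun q => .cons (.cons (γ q.i.i) (.cons (enc q.i.b) (enc q.i.a))) (enc q.a))
      fun q => enc (decide (ordCmp q.a q.i.a = .lt)) :=
    ordEq (cmpNats elem (up item) (hlen'.reindex g)) (ord _)
  refine foldlReach hl nil hlen (append (filter acc hb hc) (cons item (filter
    (f := fun p b => !decide (ordCmp b p.a = .lt)) acc hb hc.not)) ?_)
  exact hb.mono fun p => List.length_filter_le _ _

end T

/-! ### Computing with permutations -/

instance {n : ℕ} : Enc (Perm (Fin n)) := ⟨fun g => enc (permWord g)⟩

theorem enc_perm {n : ℕ} (g : Perm (Fin n)) : enc g = enc (permWord g) := rfl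

theorem length_permWord {n : ℕ} (g : Perm (Fin n)) : (permWord g).length = n := by
  simp [permWord]

theorem permWord_eq_map {n : ℕ} (g : Perm (Fin n)) :
    permWord g = (List.finRange n).map fun i => (g i : ℕ) := by
  rw [permWord, List.ofFn_eq_map]

/-- Encodings forget types: elements of `Fin n` and their values, or permutations and their tables,
are the same trees. Passing between them takes no time. -/
theorem enc_map {α β : Type} [Enc α] [Enc β] (f : α → β) (h : ∀ a, enc (f a) = enc a)
    (l : List α) : enc (l.map f) = enc l := by
  induction l with
  | nil => rfl
  | cons a l ih => rw [List.map_cons, enc_list_cons, enc_list_cons, h, ih]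

theorem permWord_injective {n : ℕ} : Function.Injective (permWord (n := n)) := by
  intro g h e
  rw [permWord, permWord, List.ofFn_inj] at e
  exact Equiv.ext fun i => Fin.ext (congrFun e i)

namespace T

variable {I : Type} {s : I → ℕ} {γ : I → Data} {n : I → ℕ}

theorem finLt {x y : ∀ i, Fin (n i)} (hx : T s γ fun i => enc (x i))
    (hy : T s γ fun i => enc (y i)) : T s γ fun i => enc (decide (x i < y i)) :=
  (natLt (x := fun i => (x i : ℕ)) (y := fun i => (y i : ℕ)) hx hy).congr fun i => by
    simp only [Fin.lt_def]

theorem finEq {x y : ∀ i, Fin (n i)} (hx : T s γ fun i => enc (x i))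
    (hy : T s γ fun i => enc (y i)) : T s γ fun i => enc (decide (x i = y i)) :=
  (natEq (x := fun i => (x i : ℕ)) (y := fun i => (y i : ℕ)) hx hy).congr fun i => by
    simp only [Fin.ext_iff]

/-- The value is the entry of the table at place `x`, the head of what remains when the first `x`
entries are split off. -/
theorem app {g : ∀ i, Perm (Fin (n i))} {x : ∀ i, Fin (n i)} (hn : PB s n)
    (hg : T s γ fun i => enc (g i)) (hx : T s γ fun i => enc (x i)) :
    T s γ fun i => enc (g i (x i)) :=
  (headD (z := fun _ => 0) (T.proj₂ (splitAt (k := fun i => (x i : ℕ))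
    (l := fun i => permWord (g i)) hx hg (by simpa [length_permWord] using hn)))
    (nat 0)).congr fun i => by
      have h : (x i : ℕ) < (permWord (g i)).length := by simp [length_permWord]
      rw [List.drop_eq_getElem_cons h]
      simp [permWord]
      rfl

variable (hn : PB s n) (hR : T s γ fun i => enc (List.finRange (n i)))
include hn hR

theorem perm {h : ∀ i, Perm (Fin (n i))}
    (hf : T (I := MemIx fun i (x : Fin (n i)) => x ∈ List.finRange (n i)) (fun p => s p.i)
      (fun p => .cons (γ p.i) (enc p.a)) fun p => enc (h p.i p.a)) :
    T s γ fun i => enc (h i) :=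
  (map (f := fun i x => h i x) hR (by simpa using hn) hf).congr fun i => by
    rw [enc_perm, permWord_eq_map,
      ← enc_map (fun x : Fin (n i) => (x : ℕ)) (fun _ => rfl), List.map_map]
    rfl

theorem permOne : T s γ fun i => enc (1 : Perm (Fin (n i))) := perm hn hR elem

variable {g h : ∀ i, Perm (Fin (n i))} (hg : T s γ fun i => enc (g i))
  (hh : T s γ fun i => enc (h i))

include hg in
theorem permInv : T s γ fun i => enc (g i)⁻¹ := by
  let K := MemIx fun i (x : Fin (n i)) => x ∈ List.finRange (n i)
  have hf : T (I := K) (fun p => s p.i) (fun p => .cons (γ p.i) (enc p.a))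
      fun p => enc ((List.finRange (n p.i)).find? fun x => decide (g p.i x = p.a)) :=
    find? (f := fun (p : K) x => decide (g p.i x = p.a))
      (hR.wk MemIx.i) (by simpa using hn.reindex MemIx.i)
      (finEq (app ((hn.reindex MemIx.i).reindex MemIx.i)
        (hg.wk₂ MemIx.i MemIx.i) elem) (up elem))
  refine perm hn hR ((elim (f := fun _ x => x) hf elem elem).congr fun p => ?_)
  congr 1
  have : ((List.finRange (n p.i)).find? fun x => decide (g p.i x = p.a)) =
      Option.some ((g p.i)⁻¹ p.a) := by
    cases hf : (List.finRange (n p.i)).find? fun x => decide (g p.i x = p.a) with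
    | none =>
      rw [List.find?_eq_none] at hf
      exact absurd (hf ((g p.i)⁻¹ p.a) (by simp)) (by simp)
    | some x =>
      have := List.find?_some hf
      rw [decide_eq_true_eq] at this
      rw [← this]; simp
  rw [this]
  rfl

include hg hh

theorem permMul : T s γ fun i => enc (g i * h i) := by
  let K := MemIx fun i (x : Fin (n i)) => x ∈ List.finRange (n i)
  exact perm hn hR (app (x := fun p : K => h p.i p.a) (hn.reindex MemIx.i) (hg.wk MemIx.i)
    (app (hn.reindex MemIx.i) (hh.wk MemIx.i) elem))

theorem permEq : T s γ fun i => enc (decide (g i = h i)) :=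
  (all (f := fun i x => decide (g i x = h i x)) hR (by simpa using hn)
    (finEq (app (hn.reindex MemIx.i) (hg.wk MemIx.i) elem)
      (app (hn.reindex MemIx.i) (hh.wk MemIx.i) elem))).congr fun i => by
        congr 1
        rw [Bool.eq_iff_iff]
        simp [Equiv.ext_iff]

omit hh in
theorem fixesBelow {j : ∀ i, Fin (n i)} (hj : T s γ fun i => enc (j i)) :
    T s γ fun i => enc (fixesBelow (g i) (j i)) :=
  all hR (by simpa using hn) (or (finLt elem (hj.wk MemIx.i)).not
    (finEq (app (hn.reindex MemIx.i) (hg.wk MemIx.i) elem) elem))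

omit hg hh

variable {t : ∀ i, List (Perm (Fin (n i)))} (ht : T s γ fun i => enc (t i))
  (htl : PB s fun i => (t i).length)
include ht htl

theorem look {j x : ∀ i, Fin (n i)} (hj : T s γ fun i => enc (j i))
    (hx : T s γ fun i => enc (x i)) : T s γ fun i => enc (look (t i) (j i) (x i)) :=
  find? (cons (permOne hn hR) ht) (htl.add (.const 1))
    (and (fixesBelow (hn.reindex MemIx.i) (hR.wk MemIx.i) elem (hj.wk MemIx.i))
      (finEq (app (hn.reindex MemIx.i) elem (hj.wk MemIx.i)) (hx.wk MemIx.i)))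

omit hg in
theorem stab {j : ∀ i, Fin (n i)} (hj : T s γ fun i => enc (j i)) :
    T s γ fun i => enc (stab (t i) (j i)) :=
  filter ht htl
    (and (fixesBelow (hn.reindex MemIx.i) (hR.wk MemIx.i) elem (hj.wk MemIx.i))
      (finEq (app (hn.reindex MemIx.i) elem (hj.wk MemIx.i)) (hj.wk MemIx.i)))

include hg

theorem siftStep {j : ∀ i, Fin (n i)} (hj : T s γ fun i => enc (j i)) :
    T s γ fun i => enc (siftStep (t i) (g i) (j i)) :=
  cond (fixesBelow hn hR hg hj) (elim (look hn hR ht htl hj (app hn hg hj)) hg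
    (permMul (hn.reindex MemIx.i) (hR.wk MemIx.i)
      (permInv (hn.reindex MemIx.i) (hR.wk MemIx.i) elem) (hg.wk MemIx.i))) hg

theorem canonStep {j : ∀ i, Fin (n i)} (hj : T s γ fun i => enc (j i)) :
    T s γ fun i => enc (canonStep (t i) (g i) (j i)) :=
  elim (findSome? hR (by simpa using hn) (look (hn.reindex MemIx.i) (hR.wk MemIx.i)
    (ht.wk MemIx.i) (htl.reindex MemIx.i) (hj.wk MemIx.i)
    (app (hn.reindex MemIx.i) (hg.wk MemIx.i) elem))) hg
    (permMul (hn.reindex MemIx.i) (hR.wk MemIx.i)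
      (permInv (hn.reindex MemIx.i) (hR.wk MemIx.i) elem) (hg.wk MemIx.i))

theorem sift : T s γ fun i => enc (sift (t i) (g i)) :=
  foldl₀ hR hg (by simpa using hn) (siftStep (hn.reindex FoldIx.i) (hR.wk FoldIx.i) acc
    (ht.wk FoldIx.i) (htl.reindex FoldIx.i) item)

theorem canon : T s γ fun i => enc (canon (t i) (g i)) :=
  foldl₀ hR hg (by simpa using hn) (canonStep (hn.reindex FoldIx.i) (hR.wk FoldIx.i) acc
    (ht.wk FoldIx.i) (htl.reindex FoldIx.i) item)

theorem adjoin : T s γ fun i => enc (adjoin (t i) (g i)) :=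
  cond (permEq hn hR (sift hn hR hg ht htl) (permOne hn hR)) ht
    (cons (sift hn hR hg ht htl) ht)

omit hg

theorem normalForm : T s γ fun i => enc (normalForm (t i)) := by
  refine flatMap hR (by simpa using hn) ?_ (filterMap (hR.wk MemIx.i)
    (by simpa using hn.reindex MemIx.i) ?_)
  · refine (hn.reindex MemIx.i).mono fun p => ?_
    simpa using List.length_filterMap_le _ (List.finRange (n p.i))
  · refine elim (look ((hn.reindex MemIx.i).reindex MemIx.i) (hR.wk₂ MemIx.i MemIx.i)
      (ht.wk₂ MemIx.i MemIx.i) ((htl.reindex MemIx.i).reindex MemIx.i) (up elem) elem) none ?_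
    refine some (canon ?_ (hR.wk₃ MemIx.i MemIx.i MemIx.i)
      (permInv ?_ (hR.wk₃ MemIx.i MemIx.i MemIx.i) elem)
      (stab ?_ (hR.wk₃ MemIx.i MemIx.i MemIx.i) (ht.wk₃ MemIx.i MemIx.i MemIx.i) ?_ (up (up elem)))
      (.mono ?_ fun p => List.length_filter_le _ _))
    any_goals exact ((hn.reindex MemIx.i).reindex MemIx.i).reindex MemIx.i
    all_goals exact ((htl.reindex MemIx.i).reindex MemIx.i).reindex MemIx.i

omit htl in
-- `Slotted` is the loop invariant that keeps the growing table below `n * n` entries and thereby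
-- every round polynomial.
theorem adjoinAll (hs : ∀ i, Slotted (t i)) {l : ∀ i, List (Perm (Fin (n i)))}
    (hl : T s γ fun i => enc (l i)) (hll : PB s fun i => (l i).length) :
    T s γ fun i => enc ((l i).foldl _root_.adjoin (t i)) :=
  foldl (fun _ T => Slotted T) hl ht hll hs (fun _ _ _ h _ => h.adjoin _)
    (adjoin (hn.reindex FoldIx.i) (hR.wk FoldIx.i) item acc
      (((hn.mul hn).reindex FoldIx.i).mono fun p => p.h.1.length_le))

theorem closeStep (hs : ∀ i, Slotted (t i)) : T s γ fun i => enc (closeStep (t i)) := by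
  refine adjoinAll hn hR ht hs (flatMap (f := fun i a => (1 :: t i).map fun b => a * b) (cons (permOne hn hR) ht) (htl.add (.const 1)) ?_
    (map (cons (permOne (hn.reindex MemIx.i) (hR.wk MemIx.i)) (ht.wk MemIx.i))
      ((htl.add (.const 1)).reindex MemIx.i)
      (permMul ((hn.reindex MemIx.i).reindex MemIx.i) (hR.wk₂ MemIx.i MemIx.i) (up elem) elem))) ?_
  · simpa using (htl.add (.const 1)).reindex MemIx.i
  · exact ((htl.add (.const 1)).mul (htl.add (.const 1))).mono fun i => by
      simp [Nat.add_mul, add_comm, add_left_comm]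
      omega

theorem build : T s γ fun i => enc (build (t i)) := by
  have hr := range hR (by simpa using hn)
  simp only [List.length_finRange] at hr
  refine foldl (fun _ T => Slotted T) (cons (nat 0) (flatMap hr (by simpa using hn)
    (by simpa using hn.reindex MemIx.i) (hr.wk MemIx.i)))
    (adjoinAll hn hR nil (fun _ => Slotted.nil) ht htl)
    (by simpa [length_clock] using (hn.mul hn).add (.const 1)) (fun i => Slotted.nil.foldl _)
    (fun _ _ _ h _ => h.closeStep)
    (closeStep (hn.reindex FoldIx.i) (hR.wk FoldIx.i) acc
      (((hn.mul hn).reindex FoldIx.i).mono fun p => p.h.1.length_le) fun p => p.h.1)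

end T

/-! ### The words of a family, and the search for the smallest one -/

theorem length_normalForm_le {n : ℕ} (T : List (Perm (Fin n))) :
    (normalForm T).length ≤ n * n := by
  rw [normalForm, List.length_flatMap]
  refine (List.sum_le_card_nsmul _ n ?_).trans (by simp)
  intro x hx
  obtain ⟨j, -, rfl⟩ := List.mem_map.1 hx
  simpa using List.length_filterMap_le _ (List.finRange n)

/-- The normal form of a table, as a word. -/
def normalWord {n : ℕ} (T : List (Perm (Fin n))) : List ℕ := (normalForm T).flatMap permWord

theorem length_normalWord_le {n : ℕ} (T : List (Perm (Fin n))) :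
    (normalWord T).length ≤ n * n * n := by
  rw [normalWord, List.length_flatMap]
  refine (List.sum_le_card_nsmul _ n ?_).trans ?_
  · intro x hx
    obtain ⟨j, -, rfl⟩ := List.mem_map.1 hx
    rw [length_permWord]
  · rw [List.length_map, smul_eq_mul]
    exact Nat.mul_le_mul_right _ (length_normalForm_le T)

/-- The color of a coset, a representative, a table of its group, and its normal word. -/
abbrev Member (n : ℕ) : Type := ℕ × Perm (Fin n) × List (Perm (Fin n)) × List ℕ

/-- The word of a colored coset. -/
def keyWord {n : ℕ} (m : Member n) (r : Perm (Fin n)) : List ℕ :=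
  m.1 :: (permWord (canon m.2.2.1 (m.2.1 * r⁻¹)) ++ m.2.2.2)

/-- The word of a family. -/
def familyWord {n : ℕ} (ms : List (Member n)) (r : Perm (Fin n)) : List (List ℕ) :=
  sortList (ms.map fun m => keyWord m r)

/-- The smallest word found so far, a labeling that yields it, and the automorphisms found. -/
abbrev Best (n : ℕ) : Type := List (List ℕ) × Perm (Fin n) × List (Perm (Fin n))

/-- Process the labeling `r`. -/
def searchStep {n : ℕ} (tau : Perm (Fin n)) (tab : List (Perm (Fin n))) (ms : List (Member n))
    (b : Best n) (r : Perm (Fin n)) : Best n :=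
  bif decide (canon tab r = canon tab tau) then
    bif decide (ordCmp (familyWord ms r) b.1 = .lt) then (familyWord ms r, r, [])
    else bif decide (ordCmp (familyWord ms r) b.1 = .eq) then
      (b.1, b.2.1, adjoin b.2.2 (r * b.2.1⁻¹))
    else b
  else b

/-- The input of the search. -/
structure SearchIx : Type where
  n : ℕ
  tau : Perm (Fin n)
  tab : List (Perm (Fin n))
  ms : List (Member n)
  tab_length : tab.length ≤ n * n
  ms_length : ∀ m ∈ ms, m.2.2.1.length ≤ n * n ∧ m.2.2.2.length ≤ n * n * n

namespace SearchIx

/-- The encoding of the input of the search. -/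
def data (i : SearchIx) : Data :=
  enc (List.finRange i.n, i.tau, i.tab, i.ms)

/-- The parameter that bounds the running time of one step of the search. -/
def size (i : SearchIx) : ℕ := i.n + i.ms.length

theorem n_le : PB size n := PB.self.mono fun i => by rw [size]; omega

theorem ms_le : PB size fun i => i.ms.length := PB.self.mono fun i => by rw [size]; omega

theorem tab_le : PB size fun i => i.tab.length := (n_le.mul n_le).mono tab_length

theorem T_range : T size data fun i => enc (List.finRange i.n) := T.self.fst

theorem T_tau : T size data fun i => enc i.tau := T.self.snd.fst

theorem T_tab : T size data fun i => enc i.tab := T.self.snd.snd.fst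

theorem T_ms : T size data fun i => enc i.ms := T.self.snd.snd.snd

end SearchIx

namespace T

variable {I : Type} {s : I → ℕ} {γ : I → Data} {n : I → ℕ}
variable (hn : PB s n) (hR : T s γ fun i => enc (List.finRange (n i)))
include hn hR

theorem normalWord {t : ∀ i, List (Perm (Fin (n i)))} (ht : T s γ fun i => enc (t i))
    (htl : PB s fun i => (t i).length) : T s γ fun i => enc (normalWord (t i)) :=
  flatMap (normalForm hn hR ht htl) ((hn.mul hn).mono fun i => length_normalForm_le _)
    ((hn.reindex MemIx.i).mono fun p => by rw [length_permWord]) elem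

theorem keyWord {m : ∀ i, Member (n i)} {r : ∀ i, Perm (Fin (n i))}
    (hm : T s γ fun i => enc (m i)) (hr : T s γ fun i => enc (r i))
    (hml : PB s fun i => (m i).2.2.1.length) : T s γ fun i => enc (keyWord (m i) (r i)) := by
  refine cons (T.proj₁ hm) (append (l := fun i => permWord (_root_.canon (m i).2.2.1 ((m i).2.1 * (r i)⁻¹)))
    ?_ (T.proj₂ (T.proj₂ (T.proj₂ hm))) (hn.mono fun i => by rw [length_permWord]))
  exact canon hn hR (permMul hn hR (T.proj₁ (T.proj₂ hm)) (permInv hn hR hr))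
    (T.proj₁ (T.proj₂ (T.proj₂ hm))) hml

theorem familyWord {ms : ∀ i, List (Member (n i))} {r : ∀ i, Perm (Fin (n i))}
    (hm : T s γ fun i => enc (ms i)) (hr : T s γ fun i => enc (r i))
    (hml : PB s fun i => (ms i).length)
    (hb : ∀ i, ∀ m ∈ ms i, m.2.2.1.length ≤ n i * n i ∧ m.2.2.2.length ≤ n i * n i * n i) :
    T s γ fun i => enc (familyWord (ms i) (r i)) := by
  refine sortNats (map hm hml (keyWord (hn.reindex MemIx.i) (hR.wk MemIx.i) elem (hr.wk MemIx.i)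
    (((hn.mul hn).reindex MemIx.i).mono fun p => (hb p.i p.a p.h).1))) (by simpa using hml) ?_
  refine (((((PB.const 1).add hn).add ((hn.mul hn).mul hn))).reindex MemIx.i).mono fun p => ?_
  obtain ⟨m, hm, h⟩ := List.mem_map.1 p.h
  rw [← h, _root_.keyWord, List.length_cons, List.length_append, length_permWord]
  have := (hb p.i m hm).2
  omega

end T

theorem length_familyWord {n : ℕ} (ms : List (Member n)) (r : Perm (Fin n)) :
    (familyWord ms r).length = ms.length := by
  rw [familyWord, (sortList_perm _).length_eq, List.length_map]

theorem length_of_mem_familyWord {i : SearchIx} {r : Perm (Fin i.n)} {w : List ℕ}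
    (hw : w ∈ familyWord i.ms r) : w.length ≤ 1 + i.n + i.n * i.n * i.n := by
  rw [familyWord, (sortList_perm _).mem_iff] at hw
  obtain ⟨m, hm, rfl⟩ := List.mem_map.1 hw
  rw [keyWord, List.length_cons, List.length_append, length_permWord]
  have := (i.ms_length m hm).2
  omega

/-- The parameter is only `n` plus the number of members. The tables in the index have at most `n *
n` entries and the normal words at most `n ^ 3` letters, whatever lists of generators were given. -/
theorem T_searchStep : T (I := FoldIx fun (i : SearchIx) (b : Best i.n) (_ : Perm (Fin i.n)) => Slotted b.2.2)
    (fun p => p.i.size) (fun p => .cons p.i.data (.cons (enc p.b) (enc p.a)))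
    fun p => enc (searchStep p.i.tau p.i.tab p.i.ms p.b p.a) := by
  let K := FoldIx fun (i : SearchIx) (b : Best i.n) (_ : Perm (Fin i.n)) => Slotted b.2.2
  have hn := SearchIx.n_le.reindex fun p : K => p.i
  have hR := SearchIx.T_range.wk (fun p : K => p.i) (δ := fun p => .cons (enc p.b) (enc p.a))
  have hms := SearchIx.T_ms.wk (fun p : K => p.i) (δ := fun p => .cons (enc p.b) (enc p.a))
  have htab := SearchIx.T_tab.wk (fun p : K => p.i) (δ := fun p => .cons (enc p.b) (enc p.a))
  have htau := SearchIx.T_tau.wk (fun p : K => p.i) (δ := fun p => .cons (enc p.b) (enc p.a))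
  have htl := SearchIx.tab_le.reindex fun p : K => p.i
  have hml := SearchIx.ms_le.reindex fun p : K => p.i
  have hw : T (I := K) (fun p => p.i.size) (fun p => .cons p.i.data (.cons (enc p.b) (enc p.a)))
      fun p => enc (familyWord p.i.ms p.a) :=
    T.familyWord hn hR hms T.item hml fun p => p.i.ms_length
  have hc : T (I := K) (fun p => p.i.size) (fun p => .cons p.i.data (.cons (enc p.b) (enc p.a)))
      fun p => enc (ordCmp (familyWord p.i.ms p.a) p.b.1) := by
    -- The comparison needs length bounds on its left argument alone, so nothing has to be assumed
    -- about the stored word `p.b.1`.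
    refine T.cmpWords hw (T.proj₁ T.acc) (by simpa only [length_familyWord] using hml) ?_
    exact (((((PB.const 1).add hn).add ((hn.mul hn).mul hn))).reindex MemIx.i).mono fun q =>
      length_of_mem_familyWord q.h
  refine T.cond (T.permEq hn hR (T.canon hn hR T.item htab htl) (T.canon hn hR htau htab htl))
    (T.cond (T.ordEq hc (T.ord _)) (T.mk hw (T.mk T.item T.nil))
    (T.cond (T.ordEq hc (T.ord _)) (T.mk (T.proj₁ T.acc) (T.mk (T.proj₁ (T.proj₂ T.acc))
      (T.adjoin hn hR (T.permMul hn hR T.item (T.permInv hn hR (T.proj₁ (T.proj₂ T.acc))))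
        (T.proj₂ (T.proj₂ T.acc)) ((hn.mul hn).mono fun p => p.h.length_le)))) T.acc)) T.acc

theorem slotted_searchStep {n : ℕ} (tau : Perm (Fin n)) (tab : List (Perm (Fin n)))
    (ms : List (Member n)) (b : Best n) (r : Perm (Fin n)) (hb : Slotted b.2.2) :
    Slotted (searchStep tau tab ms b r).2.2 := by
  rw [searchStep]
  cases decide (canon tab r = canon tab tau) with
  | false => exact hb
  | true =>
    cases decide (ordCmp (familyWord ms r) b.1 = .lt) with
    | true => exact .nil
    | false =>
      cases decide (ordCmp (familyWord ms r) b.1 = .eq) with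
      | true => exact hb.adjoin _
      | false => exact hb

/-! ### The list of all permutations -/

/-- Multiply every member of a list by all transpositions of `a` with a point that is not above
`a`. -/
def permsStep {n : ℕ} (ps : List (Perm (Fin n))) (a : Fin n) : List (Perm (Fin n)) :=
  ((List.finRange n).filter fun b => !decide (a < b)).foldl
    (fun q b => ps.foldl (fun q f => (Equiv.swap a b * f) :: q) q) []

/-- All permutations. -/
def allPerms (n : ℕ) : List (Perm (Fin n)) := (List.finRange n).foldl permsStep [1]

theorem permsStep_eq {n : ℕ} (ps : List (Perm (Fin n))) (a : Fin n) :
    permsStep ps a = (((List.finRange n).filter fun b => !decide (a < b)).flatMap fun b =>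
      ps.map fun f => Equiv.swap a b * f).reverse := by
  have h1 : ∀ (b : Fin n) (l q : List (Perm (Fin n))),
      l.foldl (fun q f => (Equiv.swap a b * f) :: q) q =
        (l.map fun f => Equiv.swap a b * f).reverse ++ q := by
    intro b l
    induction l with
    | nil => simp
    | cons f l ih => intro q; rw [List.foldl_cons, ih]; simp
  have h2 : ∀ (l : List (Fin n)) (q : List (Perm (Fin n))),
      l.foldl (fun q b => ps.foldl (fun q f => (Equiv.swap a b * f) :: q) q) q =
      (l.flatMap fun b => ps.map fun f => Equiv.swap a b * f).reverse ++ q := by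
    intro l
    induction l with
    | nil => simp
    | cons b l ih => intro q; rw [List.foldl_cons, ih, h1]; simp
  rw [permsStep, h2, List.append_nil]

theorem length_not_lt {n : ℕ} (a : Fin n) :
    ((List.finRange n).filter fun b => !decide (a < b)).length = a + 1 := by
  have h : ((List.finRange n).filter fun b => !decide (a < b)).toFinset = Finset.Iic a := by
    ext b
    simp
  rw [← List.toFinset_card_of_nodup ((List.nodup_finRange n).filter _), h, Fin.card_Iic]

theorem length_permsStep {n : ℕ} (ps : List (Perm (Fin n))) (a : Fin n) :
    (permsStep ps a).length = (a + 1) * ps.length := by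
  rw [permsStep_eq, List.length_reverse, List.length_flatMap]
  simp [length_not_lt]

/-- A permutation that fixes all points above `a` is a transposition of `a` with its image, times
one that also fixes `a`. The length of the list is multiplied by `a + 1` in this step, which gives
exactly `n!`. -/
theorem allPerms_prefix {n : ℕ} : (∀ g, g ∈ allPerms n) ∧ (allPerms n).length = n.factorial := by
  have := foldl_finRange_induct (permsStep (n := n)) (fun k ps =>
    (∀ g : Perm (Fin n), (∀ i : Fin n, k ≤ i → g i = i) → g ∈ ps) ∧ ps.length = k.factorial)
    (z := [1]) ?_ ?_
  · exact ⟨fun g => this.1 g fun i hi => absurd i.2 (by omega), this.2⟩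
  · exact ⟨fun g hg => by simpa using Equiv.ext fun i => hg i (by omega), rfl⟩
  · rintro a ps ⟨h1, h2⟩
    constructor
    · intro g hg
      rw [permsStep_eq, List.mem_reverse, List.mem_flatMap]
      -- The image `g a` is not above `a`: points above `a` are fixed, and `g` is injective.
      refine ⟨g a, ?_, List.mem_map.2 ⟨Equiv.swap a (g a) * g, h1 _ fun i hi => ?_, by simp⟩⟩
      · simp only [List.mem_filter, List.mem_finRange, true_and, Bool.not_eq_true',
          decide_eq_false_iff_not]
        intro hlt
        have := g.injective (hg (g a) hlt)
        exact hlt.ne this.symm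
      · rcases (Fin.le_def.2 hi).lt_or_eq with hlt | rfl
        · have h := hg i hlt
          rw [Perm.mul_apply, h, Equiv.swap_apply_of_ne_of_ne hlt.ne']
          intro he
          exact hlt.ne (g.injective (he.symm.trans h.symm))
        · simp
    · rw [length_permsStep, h2, Nat.factorial_succ]

theorem mem_allPerms {n : ℕ} (g : Perm (Fin n)) : g ∈ allPerms n := allPerms_prefix.1 g

theorem length_allPerms (n : ℕ) : (allPerms n).length = n.factorial := allPerms_prefix.2

/-! ### The running time of the search -/

/-- `b` can be computed from `γ` in time `F` times a polynomial in the parameter `s`. -/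
def TF {I : Type} (F s : I → ℕ) (γ b : I → Data) : Prop :=
  ∃ c, PB s c ∧ RT γ b fun i => F i * c i

namespace TF

variable {I J : Type} {F s : I → ℕ} {γ a b : I → Data}

theorem of_T (hF : ∀ i, 0 < F i) (h : T s γ a) : TF F s γ a := by
  obtain ⟨c, hc, h⟩ := h
  exact ⟨c, hc, h.mono fun i => Nat.le_mul_of_pos_left _ (hF i)⟩

theorem comp (hF : ∀ i, 0 < F i) (h : TF F s γ a) (h' : T s a b) : TF F s γ b := by
  obtain ⟨c, hc, h⟩ := h
  obtain ⟨c', hc', h'⟩ := h'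
  refine ⟨_, hc.add hc', (h.comp h').mono fun i => ?_⟩
  rw [mul_add]
  exact Nat.add_le_add_left (Nat.le_mul_of_pos_left _ (hF i)) _

variable {A B : I → Type} [∀ i, Enc (A i)] [∀ i, Enc (B i)]
variable {f : ∀ i, B i → A i → B i} {l : ∀ i, List (A i)} {z : ∀ i, B i}

theorem foldlReach (hF : ∀ i, 0 < F i) (hl : TF F s γ fun i => enc (l i))
    (hz : TF F s γ fun i => enc (z i)) (hlen : PB s fun i => (l i).length)
    (hf : TF (I := FoldIx fun i b a => ∃ l₁ l₂, l i = l₁ ++ a :: l₂ ∧ b = List.foldl (f i) (z i) l₁)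
      (fun p => F p.i) (fun p => s p.i)
      (fun p => .cons (γ p.i) (.cons (enc p.b) (enc p.a))) fun p => enc (f p.i p.b p.a)) :
    TF F s γ fun i => enc ((l i).foldl (f i) (z i)) := by
  obtain ⟨c, hc, hl⟩ := hl
  obtain ⟨c', hc', hz⟩ := hz
  obtain ⟨k, ⟨d, hd⟩, hf⟩ := hf
  refine ⟨_, ((hc.add hc').add (hlen.mul (PB.add ⟨d, fun _ => le_rfl⟩ (.const 20)))).add
    (.const 10), (hl.foldl hz (K := fun i => F i * (s i + 2) ^ d)
      (hf.mono fun p => Nat.mul_le_mul_left _ (hd p))).mono fun i => ?_⟩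
  have h1 := hF i
  have h2 : F i * (s i + 2) ^ d + 20 ≤ F i * ((s i + 2) ^ d + 20) := by
    rw [mul_add]; omega
  have h3 := Nat.mul_le_mul_left (l i).length h2
  have h4 : (l i).length * (F i * ((s i + 2) ^ d + 20)) =
    F i * ((l i).length * ((s i + 2) ^ d + 20)) := by ring
  simp only [mul_add] at h3 h4 ⊢
  omega

/-- A long loop with a short body. -/
theorem foldlLong (Inv : ∀ i, B i → Prop) (hF : ∀ i, 0 < F i) (hl : TF F s γ fun i => enc (l i))
    (hz : TF F s γ fun i => enc (z i)) (hlen : ∀ i, (l i).length ≤ F i)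
    (h0 : ∀ i, Inv i (z i)) (hS : ∀ i b a, Inv i b → Inv i (f i b a))
    (hf : T (I := FoldIx fun i b (_ : A i) => Inv i b) (fun p => s p.i)
      (fun p => .cons (γ p.i) (.cons (enc p.b) (enc p.a))) fun p => enc (f p.i p.b p.a)) :
    TF F s γ fun i => enc ((l i).foldl (f i) (z i)) := by
  have key : ∀ i l₁, Inv i (List.foldl (f i) (z i) l₁) := by
    intro i l₁
    induction l₁ using List.reverseRecOn with
    | nil => exact h0 i
    | append_singleton l₁ a ih => rw [List.foldl_append]; exact hS _ _ _ ih
  let g : (FoldIx fun i b a => ∃ l₁ l₂, l i = l₁ ++ a :: l₂ ∧ b = List.foldl (f i) (z i) l₁) →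
      FoldIx fun i b (_ : A i) => Inv i b := fun p => ⟨p.i, p.b, p.a, by
    obtain ⟨l₁, l₂, h, h'⟩ := p.h
    rw [h']
    exact key _ _⟩
  obtain ⟨c, hc, hl⟩ := hl
  obtain ⟨c', hc', hz⟩ := hz
  obtain ⟨k, ⟨d, hd⟩, hf⟩ := hf.reindex g
  refine ⟨_, ((hc.add hc').add (PB.add ⟨d, fun _ => le_rfl⟩ (.const 20))).add
    (.const 10), (hl.foldl hz (K := fun i => (s i + 2) ^ d)
      (hf.mono hd)).mono fun i => ?_⟩
  have h1 := hF i
  -- Here the number of rounds may be as large as `F i` while each round is polynomial;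
  -- `TF.foldlReach` has these roles exchanged. Either way only one factor `F i` arises.
  have h3 := Nat.mul_le_mul_right ((s i + 2) ^ d + 20) (hlen i)
  simp only [mul_add] at h3 ⊢
  omega

end TF

namespace T

variable {I : Type} {s : I → ℕ} {γ : I → Data}

theorem swap {n : I → ℕ} (hn : PB s n) (hR : T s γ fun i => enc (List.finRange (n i)))
    {a b : ∀ i, Fin (n i)} (ha : T s γ fun i => enc (a i)) (hb : T s γ fun i => enc (b i)) :
    T s γ fun i => enc (Equiv.swap (a i) (b i)) :=
  perm hn hR ((cond (finEq elem (ha.wk MemIx.i)) (hb.wk MemIx.i)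
    (cond (finEq elem (hb.wk MemIx.i)) (ha.wk MemIx.i) elem)).congr fun p => by
      rw [Equiv.swap_apply_def]
      simp only [Bool.cond_decide])

theorem length {A : I → Type} [∀ i, Enc (A i)] {l : ∀ i, List (A i)}
    (hl : T s γ fun i => enc (l i)) (hlen : PB s fun i => (l i).length) :
    T s γ fun i => enc (l i).length :=
  (foldl₀ (f := fun _ (b : ℕ) _ => b + 1) (z := fun _ => 0) hl (nat 0) hlen (succ acc)).congr
    fun i => by
      congr 1
      induction l i using List.reverseRecOn with
      | nil => rfl
      | append_singleton l a ih => simp [ih]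

end T

theorem length_foldl_permsStep_le {n : ℕ} {ps : List (Perm (Fin n))} (l : List (Fin n)) :
    ps.length ≤ (l.foldl permsStep ps).length := by
  induction l generalizing ps with
  | nil => exact le_rfl
  | cons a l ih =>
    refine le_trans ?_ ih
    rw [length_permsStep]
    exact Nat.le_mul_of_pos_left _ (by omega)

/-- Of the three nested loops only the innermost one is long. It runs through a list of partial
permutations, never longer than the final list, which has length `n!`; the two outer ones have at
most `n` rounds. -/
theorem TF_allPerms : TF (fun i : SearchIx => i.n.factorial) SearchIx.size SearchIx.data
    fun i => enc (allPerms i.n) := by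
  have hF : ∀ i : SearchIx, 0 < i.n.factorial := fun i => Nat.factorial_pos _
  refine TF.foldlReach (f := fun i => permsStep (n := i.n)) hF (.of_T hF SearchIx.T_range)
    (.of_T hF (.cons (T.permOne SearchIx.n_le SearchIx.T_range) .nil))
    (by simpa using SearchIx.n_le) ?_
  let K := FoldIx fun (i : SearchIx) (b : List (Perm (Fin i.n))) (a : Fin i.n) =>
    ∃ l₁ l₂, List.finRange i.n = l₁ ++ a :: l₂ ∧ b = List.foldl permsStep [1] l₁
  have hF' : ∀ p : K, 0 < p.i.n.factorial := fun p => hF p.i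
  have hn := SearchIx.n_le.reindex fun p : K => p.i
  have hps : ∀ p : K, p.b.length ≤ p.i.n.factorial := by
    rintro ⟨i, b, a, l₁, l₂, h, h'⟩
    have h1 : b.length ≤ ((l₁ ++ a :: l₂).foldl permsStep [1]).length := by
      rw [List.foldl_append, ← h']
      exact length_foldl_permsStep_le _
    rw [← h] at h1
    exact h1.trans_eq (length_allPerms _)
  refine TF.foldlReach (l := fun p : K => (List.finRange p.i.n).filter fun b => !decide (p.a < b))
    (f := fun (p : K) q b => p.b.foldl (fun q f => (Equiv.swap p.a b * f) :: q) q)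
    (z := fun _ => []) hF' (.of_T hF' (T.filter (SearchIx.T_range.wk fun p : K => p.i)
      (by simpa using hn) (T.not (T.finLt (T.up T.item) T.elem)))) (.of_T hF' .nil)
    (hn.mono fun p => (List.length_filter_le _ _).trans (by simp)) ?_
  refine TF.foldlLong (I := FoldIx fun (p : K) (b : List (Perm (Fin p.i.n))) (a : Fin p.i.n) =>
    ∃ l₁ l₂, (List.finRange p.i.n).filter (fun b => !decide (p.a < b)) = l₁ ++ a :: l₂ ∧
    b = List.foldl (fun q b => p.b.foldl (fun q f => (Equiv.swap p.a b * f) :: q) q) [] l₁)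
    (l := fun p => p.i.b)
    (f := fun p q f => (Equiv.swap p.i.a p.a * f) :: q)
    (fun _ _ => True) (fun p => hF' p.i) (.of_T (fun p => hF' p.i) (T.up T.acc))
    (.of_T (fun p => hF' p.i) T.acc) (fun p => hps p.i) (fun _ => trivial)
    (fun _ _ _ _ => trivial) ?_
  refine T.cons (T.permMul ?_ ?_ (T.swap ?_ ?_ (T.up (T.up T.item)) (T.up T.item)) T.item) T.acc
  any_goals exact (hn.reindex FoldIx.i).reindex FoldIx.i
  all_goals exact SearchIx.T_range.wk₃ FoldIx.i FoldIx.i FoldIx.i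

/-- The initial state of the search. -/
def SearchIx.start (i : SearchIx) : Best i.n := (familyWord i.ms i.tau, i.tau, [])

theorem T_start : T SearchIx.size SearchIx.data fun i => enc i.start :=
  .mk (T.familyWord SearchIx.n_le SearchIx.T_range SearchIx.T_ms SearchIx.T_tau SearchIx.ms_le
    fun i => i.ms_length) (.mk SearchIx.T_tau .nil)

/-- The result of the search. -/
def SearchIx.best (i : SearchIx) : Best i.n :=
  (allPerms i.n).foldl (searchStep i.tau i.tab i.ms) i.start

theorem SearchIx.slotted_best (i : SearchIx) : Slotted i.best.2.2 := by
  rw [best]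
  induction allPerms i.n using List.reverseRecOn with
  | nil => exact .nil
  | append_singleton l r ih => rw [List.foldl_append]; exact slotted_searchStep _ _ _ _ _ ih

/-- The output of the search. -/
def SearchIx.out (i : SearchIx) : CosetCode i.n := ⟨i.best.2.1, i.best.2.2⟩

theorem SearchIx.length_gens_out (i : SearchIx) : i.out.gens.length ≤ i.n * i.n :=
  i.slotted_best.length_le

theorem TF_out : TF (fun i : SearchIx => i.n.factorial) SearchIx.size SearchIx.data
    fun i => enc i.out.word := by
  have hF : ∀ i : SearchIx, 0 < i.n.factorial := fun i => Nat.factorial_pos _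
  have hn := SearchIx.n_le
  have hl := (hn.mul hn).mono SearchIx.length_gens_out
  have h : TF (fun i : SearchIx => i.n.factorial) SearchIx.size SearchIx.data
      fun i => enc i.best := by
    exact TF.foldlLong (A := fun i => Perm (Fin i.n)) (B := fun i => Best i.n)
      (f := fun i => searchStep i.tau i.tab i.ms) (l := fun i => allPerms i.n)
      (z := SearchIx.start)
      (fun _ b => Slotted b.2.2) hF TF_allPerms (.of_T hF T_start)
      (fun i => (length_allPerms _).le) (fun _ => .nil)
      (fun _ _ _ h => slotted_searchStep _ _ _ _ _ h) T_searchStep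
  refine h.comp hF ?_
  have hg : T SearchIx.size (fun i => enc i.best) fun i => enc i.out.gens :=
    T.proj₂ (T.proj₂ T.self)
  have hr : T SearchIx.size (fun i => enc i.best) fun i => enc (permWord i.out.rep) :=
    T.proj₁ (T.proj₂ T.self)
  refine T.append hr (T.cons (T.length hg hl) (T.flatMap hg hl ?_ T.elem)) ?_
  · simpa [length_permWord] using hn.reindex MemIx.i
  · simpa [length_permWord] using hn

/-! ### The words of cosets and families -/

section Words

variable {V : Type u} {W : Type v} {n : ℕ}

theorem LabelingCoset.map_refl (A : LabelingCoset V n) : A.map (Equiv.refl V) = A := by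
  ext ρ
  exact ⟨fun ⟨lam, h, e⟩ => e ▸ h, fun h => ⟨ρ, h, rfl⟩⟩

theorem LabelingCoset.map_map {U : Type*} (A : LabelingCoset V n) (σ : V ≃ W) (τ : W ≃ U) :
    (A.map σ).map τ = A.map (σ.trans τ) := by
  ext ρ
  constructor
  · rintro ⟨_, ⟨lam, h, rfl⟩, rfl⟩
    exact ⟨lam, h, rfl⟩
  · rintro ⟨lam, h, rfl⟩
    exact ⟨_, ⟨lam, h, rfl⟩, rfl⟩

theorem ColoredFamily.map_map {U : Type*} (X : ColoredFamily V n) (σ : V ≃ W) (τ : W ≃ U) :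
    (X.map σ).map τ = X.map (σ.trans τ) := by
  funext A
  simp only [ColoredFamily.map, LabelingCoset.map_map]
  rfl

theorem ColoredFamily.map_refl (X : ColoredFamily V n) : X.map (Equiv.refl V) = X := by
  funext A
  exact congrArg X A.map_refl

/-- Products in `Perm` apply the right factor first, so under the numbering `ν` the coset `τΘ`
appears as the right coset of the group through `c.rep`. -/
theorem mem_toCoset {ν : V ≃ Fin n} {c : CosetCode n} {r : Perm (Fin n)} :
    ν.trans r ∈ (c.toCoset ν).carrier ↔ r * c.rep⁻¹ ∈ gen c.gens := by
  constructor
  · rintro ⟨θ, hθ, h⟩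
    have : r = θ * c.rep := Equiv.ext fun x => by
      simpa using congrArg (fun e : V ≃ Fin n => e (ν.symm x)) h
    rw [this, mul_inv_cancel_right]
    exact hθ
  · intro h
    exact ⟨_, h, Equiv.ext fun x => by simp⟩

theorem toCoset_eq_iff {ν : V ≃ Fin n} {c c' : CosetCode n} :
    c.toCoset ν = c'.toCoset ν ↔ gen c.gens = gen c'.gens ∧ c'.rep * c.rep⁻¹ ∈ gen c.gens := by
  constructor
  · intro h
    have hmem : ∀ r : Perm (Fin n), r * c.rep⁻¹ ∈ gen c.gens ↔ r * c'.rep⁻¹ ∈ gen c'.gens :=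
      fun r => by rw [← mem_toCoset (ν := ν), ← mem_toCoset (ν := ν), h]
    have h1 := (hmem c'.rep).2 (by simp)
    refine ⟨?_, h1⟩
    ext g
    have h2 := hmem (g * c'.rep)
    rw [mul_assoc, Subgroup.mul_mem_cancel_right _ h1, mul_inv_cancel_right] at h2
    exact h2
  · rintro ⟨h1, h2⟩
    ext ρ
    obtain ⟨r, rfl⟩ : ∃ r : Perm (Fin n), ρ = ν.trans r := ⟨ν.symm.trans ρ, by ext; simp⟩
    rw [mem_toCoset, mem_toCoset, ← h1]
    have : r * c.rep⁻¹ = r * c'.rep⁻¹ * (c'.rep * c.rep⁻¹) := by group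
    rw [this, Subgroup.mul_mem_cancel_right _ h2]

/-- Every coset has a code. -/
theorem exists_toCoset_eq (ν : V ≃ Fin n) (A : LabelingCoset V n) :
    ∃ c : CosetCode n, c.toCoset ν = A := by
  classical
  obtain ⟨τ, Θ, h⟩ := A.isCoset
  have hgen : gen (Finset.univ.filter (· ∈ Θ)).toList = Θ := by
    have : {g | g ∈ (Finset.univ.filter (· ∈ Θ)).toList} = (Θ : Set (Perm (Fin n))) := by
      ext g; simp
    rw [gen, this, Subgroup.closure_eq]
  refine ⟨⟨ν.symm.trans τ, (Finset.univ.filter (· ∈ Θ)).toList⟩, ?_⟩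
  ext ρ
  have : ν.trans (ν.symm.trans τ) = τ := by ext; simp
  simp only [CosetCode.toCoset, this, h]
  rw [← gen, hgen]

/-- Relabeling multiplies the representative and keeps the group of labels. This is why one table
per member suffices for all `n!` labelings. -/
theorem toCoset_map (ν : V ≃ Fin n) (c : CosetCode n) (r : Perm (Fin n)) :
    (c.toCoset ν).map (ν.trans r) =
      CosetCode.toCoset (Equiv.refl (Fin n)) ⟨c.rep * r⁻¹, c.gens⟩ := by
  ext ρ
  constructor
  · rintro ⟨_, ⟨θ, hθ, rfl⟩, rfl⟩
    exact ⟨θ, hθ, Equiv.ext fun x => by simp⟩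
  · rintro ⟨θ, hθ, rfl⟩
    exact ⟨_, ⟨θ, hθ, rfl⟩, Equiv.ext fun x => by simp⟩

/-- The data from which the words of a colored coset are computed. -/
def CosetCode.member (c : CosetCode n) (k : ℕ) : Member n :=
  (k, c.rep, build c.gens, normalWord (build c.gens))

theorem keyWord_eq_of_toCoset {c c' : CosetCode n} (k : ℕ)
    (h : c.toCoset (Equiv.refl (Fin n)) = c'.toCoset (Equiv.refl (Fin n))) :
    keyWord (c.member k) 1 = keyWord (c'.member k) 1 := by
  obtain ⟨h1, h2⟩ := toCoset_eq_iff.1 h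
  have t1 := isTable_build c.gens
  have t2 := isTable_build c'.gens
  rw [← h1] at t2
  simp only [keyWord, CosetCode.member, inv_one, mul_one, normalWord, t1.normalForm_eq t2,
    t1.canon_eq t2 h2 c.rep, inv_mul_cancel_right]

/-- Cutting the word into blocks of length `n` recovers the list. For `n = 0` the blocks are empty
and their number is lost. -/
theorem flatMap_permWord_injective (hn : 0 < n) :
    Function.Injective fun l : List (Perm (Fin n)) => l.flatMap permWord := by
  intro l
  induction l with
  | nil =>
    intro l' h
    cases l' with
    | nil => rfl
    | cons g l' =>
      have := congrArg List.length h
      simp [length_permWord] at this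
      omega
  | cons g l ih =>
    intro l' h
    cases l' with
    | nil =>
      have := congrArg List.length h
      simp [length_permWord] at this
      omega
    | cons g' l' =>
      simp only [List.flatMap_cons] at h
      obtain ⟨h1, h2⟩ := List.append_inj h (by simp [length_permWord])
      rw [permWord_injective h1, ih h2]

theorem toCoset_eq_of_keyWord {c c' : CosetCode n} {k k' : ℕ}
    (h : keyWord (c.member k) 1 = keyWord (c'.member k') 1) :
    k = k' ∧ c.toCoset (Equiv.refl (Fin n)) = c'.toCoset (Equiv.refl (Fin n)) := by
  simp only [keyWord, CosetCode.member, inv_one, mul_one, List.cons.injEq] at h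
  obtain ⟨h1, h2⟩ := List.append_inj h.2 (by simp [length_permWord])
  refine ⟨h.1, toCoset_eq_iff.2 ?_⟩
  have t1 := isTable_build c.gens
  have t2 := isTable_build c'.gens
  have hg : gen c.gens = gen c'.gens := by
    -- For `n = 0` the normal word says nothing, but there is only one group.
    rcases Nat.eq_zero_or_pos n with rfl | hn
    · exact Subsingleton.elim _ _
    · exact t1.eq_of_normalForm t2 (flatMap_permWord_injective hn h2)
  refine ⟨hg, ?_⟩
  obtain ⟨θ, hθ, e⟩ := t1.canon_mem c.rep
  obtain ⟨θ', hθ', e'⟩ := t2.canon_mem c'.rep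
  have h3 := permWord_injective h1
  rw [e, e'] at h3
  have : c'.rep * c.rep⁻¹ = θ'⁻¹ * θ := by
    rw [mul_inv_eq_iff_eq_mul, mul_assoc, h3]; simp
  rw [this]
  exact mul_mem (inv_mem (hg ▸ hθ')) hθ

/-- The word of a colored coset of the label set. -/
noncomputable def cosetWord (A : LabelingCoset (Fin n) n) (k : ℕ) : List ℕ :=
  keyWord ((exists_toCoset_eq (Equiv.refl (Fin n)) A).choose.member k) 1

theorem cosetWord_toCoset (c : CosetCode n) (k : ℕ) :
    cosetWord (c.toCoset (Equiv.refl (Fin n))) k = keyWord (c.member k) 1 :=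
  keyWord_eq_of_toCoset k (exists_toCoset_eq (Equiv.refl (Fin n)) _).choose_spec

theorem cosetWord_injective {A A' : LabelingCoset (Fin n) n} {k k' : ℕ}
    (h : cosetWord A k = cosetWord A' k') : k = k' ∧ A = A' := by
  obtain ⟨c, rfl⟩ := exists_toCoset_eq (Equiv.refl (Fin n)) A
  obtain ⟨c', rfl⟩ := exists_toCoset_eq (Equiv.refl (Fin n)) A'
  rw [cosetWord_toCoset, cosetWord_toCoset] at h
  exact toCoset_eq_of_keyWord h

theorem cosetWord_map (ν : V ≃ Fin n) (c : CosetCode n) (k : ℕ) (r : Perm (Fin n)) :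
    cosetWord ((c.toCoset ν).map (ν.trans r)) k = keyWord (c.member k) r := by
  rw [toCoset_map, cosetWord_toCoset]
  simp [keyWord, CosetCode.member]

instance : Finite (LabelingCoset (Fin n) n) :=
  Finite.of_injective LabelingCoset.carrier fun _ _ => LabelingCoset.ext

/-- The members of a family on the label set. -/
noncomputable def ColoredFamily.support (Y : ColoredFamily (Fin n) n) :
    Finset (LabelingCoset (Fin n) n) :=
  (Set.toFinite {A | Y A ≠ none}).toFinset

/-- The word of a family on the label set. -/
noncomputable def ColoredFamily.word (Y : ColoredFamily (Fin n) n) : List (List ℕ) :=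
  sortList (Y.support.toList.map fun A => cosetWord A ((Y A).getD 0))

theorem ColoredFamily.mem_word {Y : ColoredFamily (Fin n) n} {A : LabelingCoset (Fin n) n}
    {k : ℕ} : cosetWord A k ∈ Y.word ↔ Y A = some k := by
  rw [word, (sortList_perm _).mem_iff, List.mem_map]
  constructor
  · rintro ⟨B, hB, h⟩
    obtain ⟨h1, rfl⟩ := cosetWord_injective h
    simp only [support, Finset.mem_toList, Set.Finite.mem_toFinset, Set.mem_ofPred_eq] at hB
    obtain ⟨k', h'⟩ := Option.ne_none_iff_exists'.1 hB
    rw [h'] at h1 ⊢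
    rw [← h1]
    rfl
  · intro h
    exact ⟨A, by simp [support, h], by simp [h]⟩

/-- A coset has color `k` in the family exactly if its word with color `k` occurs in the list, so
the family can be read off. -/
theorem ColoredFamily.word_injective :
    Function.Injective (ColoredFamily.word (n := n)) := by
  intro Y Y' h
  funext A
  refine Option.ext fun k => ?_
  rw [← mem_word, ← mem_word, h]

/-- The data from which the words of a family are computed. -/
def InputCode.memberData (c : InputCode n) : List (Member n) :=
  c.members.map fun m => m.1.member m.2

/-- Sorting reduces this to equality of the two lists of words up to order. The multiplicities agree
because the code lists each coset exactly once. -/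
theorem InputCode.Encodes.familyWord_eq {c : InputCode n} {ν : V ≃ Fin n} {X : ColoredFamily V n}
    {Λ : LabelingCoset V n} (h : c.Encodes ν X Λ) (r : Perm (Fin n)) :
    familyWord c.memberData r = (X.map (ν.trans r)).word := by
  rw [familyWord, ColoredFamily.word]
  refine sortList_eq ?_
  set Y := X.map (ν.trans r) with hY
  have hmap : Function.Injective fun A : LabelingCoset V n => A.map (ν.trans r) := by
    intro A B hAB
    have := congrArg (fun A => LabelingCoset.map (ν.trans r).symm A) hAB
    simpa only [LabelingCoset.map_map, Equiv.self_trans_symm, LabelingCoset.map_refl] using this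
  have hX : ∀ A, Y (A.map (ν.trans r)) = X A := by
    intro A
    rw [hY, ColoredFamily.map, LabelingCoset.map_map, Equiv.self_trans_symm,
      LabelingCoset.map_refl]
  have hval : ∀ m ∈ c.members, Y ((m.1.toCoset ν).map (ν.trans r)) = some m.2 := fun m hm => by
    rw [hX]
    exact (h.family_iff _ _).2 ⟨m, hm, rfl, rfl⟩
  have hperm : (c.members.map fun m => (m.1.toCoset ν).map (ν.trans r)).Perm
      Y.support.toList := by
    rw [List.perm_ext_iff_of_nodup ?_ (Finset.nodup_toList _)]
    · intro A
      simp only [List.mem_map, ColoredFamily.support, Finset.mem_toList,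
        Set.Finite.mem_toFinset, Set.mem_ofPred_eq]
      constructor
      · rintro ⟨m, hm, rfl⟩
        rw [hval m hm]
        exact Option.some_ne_none _
      · intro hA
        obtain ⟨k, hk⟩ := Option.ne_none_iff_exists'.1 hA
        obtain ⟨m, hm, h1, -⟩ := (h.family_iff _ _).1 hk
        refine ⟨m, hm, ?_⟩
        rw [h1, LabelingCoset.map_map, Equiv.symm_trans_self, LabelingCoset.map_refl]
    · have := h.nodup.map hmap
      rwa [List.map_map] at this
  refine List.Perm.trans (List.Perm.of_eq ?_) (hperm.map _)
  rw [InputCode.memberData, List.map_map, List.map_map]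
  refine List.map_congr_left fun m hm => ?_
  simp only [Function.comp, hval m hm, Option.getD_some, cosetWord_map]

theorem InputCode.Encodes.card_eq {c : InputCode n} {ν : V ≃ Fin n} {X : ColoredFamily V n}
    {Λ : LabelingCoset V n} (h : c.Encodes ν X Λ) : X.card = c.members.length := by
  have : {A : LabelingCoset V n | X A ≠ none} =
      {A | A ∈ c.members.map fun m => m.1.toCoset ν} := by
    ext A
    simp only [Set.mem_ofPred_eq, List.mem_map]
    constructor
    · intro hA
      obtain ⟨k, hk⟩ := Option.ne_none_iff_exists'.1 hA
      obtain ⟨m, hm, h1, -⟩ := (h.family_iff _ _).1 hk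
      exact ⟨m, hm, h1⟩
    · rintro ⟨m, hm, rfl⟩
      rw [(h.family_iff _ m.2).2 ⟨m, hm, rfl, rfl⟩]
      exact Option.some_ne_none _
  classical
  rw [ColoredFamily.card, this, ← List.coe_toFinset, Set.ncard_coe_finset,
    List.toFinset_card_of_nodup h.nodup, List.length_map]

/-! ### The canonical labeling -/

theorem LabelingCoset.trans_mem {A : LabelingCoset V n} {a b c : V ≃ Fin n} (ha : a ∈ A.carrier)
    (hb : b ∈ A.carrier) (hc : c ∈ A.carrier) : a.trans (b.symm.trans c) ∈ A.carrier := by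
  obtain ⟨τ, Θ, h⟩ := A.isCoset
  rw [h] at ha hb hc ⊢
  obtain ⟨x, hx, rfl⟩ := ha
  obtain ⟨y, hy, rfl⟩ := hb
  obtain ⟨z, hz, rfl⟩ := hc
  refine ⟨z * y⁻¹ * x, mul_mem (mul_mem hz (inv_mem hy)) hx, Equiv.ext fun v => ?_⟩
  simp

/-- The members `ρ` of `Λ` for which the word of `X^ρ` is as small as possible. -/
def minimalLabelings (X : ColoredFamily V n) (Λ : LabelingCoset V n) : Set (Labeling V n) :=
  {ρ | ρ ∈ Λ.carrier ∧ ∀ ρ' ∈ Λ.carrier, (X.map ρ).word ≤ (X.map ρ').word}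

/-- Two smallest words are equal, and the word determines the family. -/
theorem map_eq_of_mem_minimalLabelings {X : ColoredFamily V n} {Λ : LabelingCoset V n}
    {ρ ρ' : Labeling V n} (h : ρ ∈ minimalLabelings X Λ) (h' : ρ' ∈ minimalLabelings X Λ) :
    X.map ρ = X.map ρ' :=
  ColoredFamily.word_injective (le_antisymm (h.2 _ h'.1) (h'.2 _ h.1))

theorem mem_minimalLabelings_of_map_eq {X : ColoredFamily V n} {Λ : LabelingCoset V n}
    {ρ ρ' : Labeling V n} (h : ρ ∈ minimalLabelings X Λ) (h' : ρ' ∈ Λ.carrier)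
    (e : X.map ρ' = X.map ρ) : ρ' ∈ minimalLabelings X Λ :=
  ⟨h', fun _ hr => e ▸ h.2 _ hr⟩

/-- The stabilizer of a family on the label set in a subgroup. -/
def stabilizerIn (Y : ColoredFamily (Fin n) n) (Δ : Subgroup (Perm (Fin n))) :
    Subgroup (Perm (Fin n)) where
  carrier := {g | g ∈ Δ ∧ Y.map g = Y}
  mul_mem' {a b} ha hb := ⟨mul_mem ha.1 hb.1, by
    have : Y.map (a * b) = (Y.map b).map a := (ColoredFamily.map_map _ _ _).symm
    rw [this, hb.2, ha.2]⟩
  one_mem' := ⟨one_mem _, Y.map_refl⟩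
  inv_mem' {a} ha := ⟨inv_mem ha.1, by
    have : (Y.map a).map a⁻¹ = Y := by
      rw [ColoredFamily.map_map]
      exact (congrArg Y.map (Equiv.self_trans_symm a)).trans Y.map_refl
    rw [ha.2] at this
    exact this⟩

theorem minimalLabelings_nonempty (X : ColoredFamily V n) (Λ : LabelingCoset V n) :
    (minimalLabelings X Λ).Nonempty := by
  obtain ⟨τ, Θ, h⟩ := Λ.isCoset
  have hne : τ ∈ Λ.carrier := by rw [h]; exact ⟨1, one_mem _, rfl⟩
  have : Finite V := Finite.of_equiv _ τ.symm
  obtain ⟨ρ, hρ, hmin⟩ := Set.exists_min_image Λ.carrier (fun ρ => (X.map ρ).word)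
    (Set.toFinite _) ⟨τ, hne⟩
  exact ⟨ρ, hρ, hmin⟩

/-- Fix one minimal `ρ`. The minimal labelings are the members of `Λ` that carry `X` to the same
family as `ρ`, that is, `ρ` followed by the elements of `Δ` that stabilize `X^ρ`. -/
theorem minimalLabelings_isCoset (X : ColoredFamily V n) (Λ : LabelingCoset V n) :
    ∃ (τ : Labeling V n) (Θ : Subgroup (Perm (Fin n))), minimalLabelings X Λ = cosetSet τ Θ := by
  obtain ⟨ρ, hρ⟩ := minimalLabelings_nonempty X Λ
  obtain ⟨τ, Δ, hΛ⟩ := Λ.isCoset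
  obtain ⟨δ, hδ, rfl⟩ : ρ ∈ cosetSet τ Δ := hΛ ▸ hρ.1
  refine ⟨τ.trans δ, stabilizerIn (X.map (τ.trans δ)) Δ, Set.ext fun ρ' => ⟨fun h => ?_, ?_⟩⟩
  · obtain ⟨δ', hδ', rfl⟩ : ρ' ∈ cosetSet τ Δ := hΛ ▸ h.1
    have e : τ.trans δ' = (τ.trans δ).trans (δ' * δ⁻¹ : Perm (Fin n)) :=
      Equiv.ext fun v => by simp
    refine ⟨δ' * δ⁻¹, ⟨mul_mem hδ' (inv_mem hδ), ?_⟩, e⟩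
    rw [ColoredFamily.map_map]
    have := map_eq_of_mem_minimalLabelings h hρ
    rwa [e] at this
  · rintro ⟨θ, ⟨hθ, h⟩, rfl⟩
    refine mem_minimalLabelings_of_map_eq hρ ?_ ?_
    · rw [hΛ]
      exact ⟨θ * δ, mul_mem hθ hδ, rfl⟩
    · rwa [← ColoredFamily.map_map]

/-- The canonical labeling of `(X; Λ)`. -/
def canonicalLabeling (X : ColoredFamily V n) (Λ : LabelingCoset V n) : LabelingCoset V n :=
  ⟨minimalLabelings X Λ, minimalLabelings_isCoset X Λ⟩

end Words

/-- Canonicity holds because `(X^σ)^(σ⁻¹λ) = X^λ`: corresponding labelings have equal words. For the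
third condition, a labeling in `Λ` is minimal exactly if it differs from `π` by an automorphism of
`X`. -/
theorem isCanonicalLabeling :
    IsCanonicalLabeling.{u} fun _ _ X Λ => canonicalLabeling X Λ where
  subset _ _ _ _ _ h := h.1
  canonical V W n σ X Λ := by
    ext ρ
    have e : ∀ lam : Labeling V n, (X.map σ).map (σ.symm.trans lam) = X.map lam := fun lam => by
      rw [ColoredFamily.map_map, ← Equiv.trans_assoc, Equiv.self_trans_symm, Equiv.refl_trans]
    constructor
    · rintro ⟨⟨lam, hl, rfl⟩, h⟩
      refine ⟨lam, ⟨hl, fun mu hm => ?_⟩, rfl⟩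
      have := h _ ⟨mu, hm, rfl⟩
      rwa [e, e] at this
    · rintro ⟨lam, ⟨hl, h⟩, rfl⟩
      refine ⟨⟨lam, hl, rfl⟩, ?_⟩
      rintro _ ⟨mu, hm, rfl⟩
      rw [e, e]
      exact h _ hm
  eq_aut V n X Λ π hπ := by
    ext ρ
    constructor
    · intro hρ
      refine ⟨ρ.trans π.symm, ⟨?_, ρ, hρ.1, π, hπ.1, rfl⟩, Equiv.ext fun v => by simp⟩
      have h := map_eq_of_mem_minimalLabelings hρ hπ
      change X.map (ρ.trans π.symm) = X
      rw [← ColoredFamily.map_map, h, ColoredFamily.map_map, Equiv.self_trans_symm,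
        ColoredFamily.map_refl]
    · rintro ⟨_, ⟨hσ, lam, hl, mu, hm, rfl⟩, rfl⟩
      refine mem_minimalLabelings_of_map_eq hπ (Λ.trans_mem hl hm hπ.1) ?_
      rw [← ColoredFamily.map_map, hσ]

/-! ### Correctness of the search -/

section Search

variable {n : ℕ}

/-- What holds after the labelings in `l` have been processed. -/
structure SearchInv (Y : ColoredFamily (Fin n) n) (Δ : Subgroup (Perm (Fin n)))
    (tau : Perm (Fin n)) (l : List (Perm (Fin n))) (b : Best n) : Prop where
  word_eq : b.1 = (Y.map b.2.1).word
  mem : b.2.1 * tau⁻¹ ∈ Δ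
  le : ∀ r ∈ l, r * tau⁻¹ ∈ Δ → b.1 ≤ (Y.map r).word
  mem_gen : ∀ r ∈ l, r * tau⁻¹ ∈ Δ → (Y.map r).word = b.1 → r * b.2.1⁻¹ ∈ gen b.2.2
  gen_le : gen b.2.2 ≤ stabilizerIn (Y.map b.2.1) Δ

theorem gen_nil : gen ([] : List (Perm (Fin n))) = ⊥ := by simp [gen]

/-- A smaller word restarts the search with the trivial group. An equal word means an equal family,
so the quotient of the two labelings is an automorphism and is adjoined. All other labelings are
irrelevant. -/
theorem SearchInv.step {Y : ColoredFamily (Fin n) n} {Δ : Subgroup (Perm (Fin n))}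
    {tau : Perm (Fin n)} {l : List (Perm (Fin n))} {b : Best n} (h : SearchInv Y Δ tau l b)
    {tab : List (Perm (Fin n))} (ht : IsTable tab Δ) {ms : List (Member n)}
    (hw : ∀ r, familyWord ms r = (Y.map r).word) (r : Perm (Fin n)) :
    SearchInv Y Δ tau (l ++ [r]) (searchStep tau tab ms b r) := by
  rw [searchStep]
  simp only [hw]
  by_cases hc : canon tab r = canon tab tau
  · have h1 := ht.canon_eq_iff.1 hc
    rw [decide_eq_true hc, cond_true]
    have hmem : ∀ {q}, q ∈ l ++ [r] → q ∈ l ∨ q = r := fun hq => by simpa using hq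
    rcases lt_trichotomy (Y.map r).word b.1 with hlt | heq | hgt
    · rw [show ordCmp (Y.map r).word b.1 = .lt from hlt.cmp_eq_lt]
      refine ⟨rfl, h1, fun q hq hqΔ => ?_, fun q hq hqΔ he => ?_, ?_⟩
      · rcases hmem hq with hq | rfl
        · exact hlt.le.trans (h.le q hq hqΔ)
        · exact le_rfl
      · rcases hmem hq with hq | rfl
        -- No earlier labeling attains the new word, so nothing is lost with the old automorphisms.
        · exact absurd (he.trans_lt hlt) (h.le q hq hqΔ).not_gt
        · exact (mul_inv_cancel q).symm ▸ one_mem _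
      · change gen [] ≤ _
        rw [gen_nil]
        exact bot_le
    · rw [show ordCmp (Y.map r).word b.1 = .eq by rw [heq]; exact cmp_self_eq_eq _]
      have hY : Y.map r = Y.map b.2.1 := ColoredFamily.word_injective (heq.trans h.word_eq)
      refine ⟨h.word_eq, h.mem, fun q hq hqΔ => ?_, fun q hq hqΔ he => ?_, ?_⟩
      · rcases hmem hq with hq | rfl
        · exact h.le q hq hqΔ
        · exact heq.ge
      · change _ ∈ gen (adjoin b.2.2 (r * b.2.1⁻¹))
        rw [gen_adjoin]
        rcases hmem hq with hq | rfl
        · exact Subgroup.mem_sup_left (h.mem_gen q hq hqΔ he)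
        · exact Subgroup.mem_sup_right (Subgroup.mem_zpowers _)
      · change gen (adjoin b.2.2 (r * b.2.1⁻¹)) ≤ stabilizerIn (Y.map b.2.1) Δ
        rw [gen_adjoin, sup_le_iff, Subgroup.zpowers_le]
        refine ⟨h.gen_le, ?_, ?_⟩
        · have := mul_mem h1 (inv_mem h.mem)
          simpa [mul_assoc] using this
        · rw [ColoredFamily.map_map]
          refine Eq.trans (congrArg Y.map (Equiv.ext fun v => ?_)) hY
          simp
    · rw [show ordCmp (Y.map r).word b.1 = .gt from hgt.cmp_eq_gt]
      refine ⟨h.word_eq, h.mem, fun q hq hqΔ => ?_, fun q hq hqΔ he => ?_, h.gen_le⟩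
      · rcases hmem hq with hq | rfl
        · exact h.le q hq hqΔ
        · exact hgt.le
      · rcases hmem hq with hq | rfl
        · exact h.mem_gen q hq hqΔ he
        · exact absurd he hgt.ne'
  · have h1 := mt ht.canon_eq_iff.2 hc
    rw [decide_eq_false hc, cond_false]
    refine ⟨h.word_eq, h.mem, fun q hq hqΔ => ?_, fun q hq hqΔ he => ?_, h.gen_le⟩
    all_goals
      rcases List.mem_append.1 hq with hq | hq
      · first | exact h.le q hq hqΔ | exact h.mem_gen q hq hqΔ he
      · rw [List.mem_singleton.1 hq] at hqΔ
        exact absurd hqΔ h1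

/-- The search for an input. -/
def InputCode.searchIx (c : InputCode n) : SearchIx where
  n := n
  tau := c.bound.rep
  tab := build c.bound.gens
  ms := c.memberData
  tab_length := (slotted_build _).length_le
  ms_length := fun m hm => by
    obtain ⟨a, -, rfl⟩ := List.mem_map.1 hm
    exact ⟨(slotted_build _).length_le, length_normalWord_le _⟩

/-- The output for an input. -/
def InputCode.out (c : InputCode n) : CosetCode n := c.searchIx.out

/-- When all permutations are processed, the invariant pins down the group: it stabilizes the best
family within the group of `Λ`, and it contains the quotient of any minimal labeling by the stored
one. -/
theorem InputCode.Encodes.toCoset_out {V : Type u} {c : InputCode n} {ν : V ≃ Fin n}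
    {X : ColoredFamily V n} {Λ : LabelingCoset V n} (h : c.Encodes ν X Λ) :
    c.out.toCoset ν = canonicalLabeling X Λ := by
  have hw : ∀ r, familyWord c.memberData r = ((X.map ν).map r).word := fun r => by
    rw [h.familyWord_eq, ColoredFamily.map_map]
  have ht := isTable_build c.bound.gens
  have hinv : ∀ l, SearchInv (X.map ν) (gen c.bound.gens) c.bound.rep l
      (l.foldl (searchStep c.bound.rep (build c.bound.gens) c.memberData)
        (familyWord c.memberData c.bound.rep, c.bound.rep, [])) := by
    intro l
    induction l using List.reverseRecOn with
    | nil =>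
      refine ⟨hw _, ?_, by simp, by simp, ?_⟩
      · exact (mul_inv_cancel c.bound.rep).symm ▸ one_mem _
      · change gen [] ≤ _
        rw [gen_nil]
        exact bot_le
    | append_singleton l r ih =>
      rw [List.foldl_append]
      exact ih.step ht hw r
  obtain ⟨b, hb, hout⟩ : ∃ b : Best n,
      SearchInv (X.map ν) (gen c.bound.gens) c.bound.rep (allPerms n) b ∧
      c.out = ⟨b.2.1, b.2.2⟩ := ⟨_, hinv _, rfl⟩
  have hΛ : ∀ r : Perm (Fin n), ν.trans r ∈ Λ.carrier ↔ r * c.bound.rep⁻¹ ∈ gen c.bound.gens :=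
    fun r => by rw [← h.bound_eq, mem_toCoset]
  have hmin : ν.trans b.2.1 ∈ minimalLabelings X Λ := by
    refine ⟨(hΛ _).2 hb.mem, fun ρ' hρ' => ?_⟩
    obtain ⟨r, rfl⟩ : ∃ r : Perm (Fin n), ρ' = ν.trans r := ⟨ν.symm.trans ρ', by ext; simp⟩
    rw [← ColoredFamily.map_map, ← ColoredFamily.map_map]
    exact hb.word_eq ▸ hb.le r (mem_allPerms r) ((hΛ r).1 hρ')
  ext ρ
  obtain ⟨r, rfl⟩ : ∃ r : Perm (Fin n), ρ = ν.trans r := ⟨ν.symm.trans ρ, by ext; simp⟩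
  rw [mem_toCoset, hout]
  change r * b.2.1⁻¹ ∈ gen b.2.2 ↔ ν.trans r ∈ minimalLabelings X Λ
  constructor
  · intro hr
    obtain ⟨h1, h2⟩ := hb.gen_le hr
    refine mem_minimalLabelings_of_map_eq hmin ((hΛ r).2 ?_) ?_
    · have := mul_mem h1 hb.mem
      rwa [mul_assoc, inv_mul_cancel_left] at this
    · have e : ν.trans r = (ν.trans b.2.1).trans (r * b.2.1⁻¹ : Perm (Fin n)) :=
        Equiv.ext fun v => by simp
      rw [e, ← ColoredFamily.map_map, ← ColoredFamily.map_map, h2]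
  · intro hr
    refine hb.mem_gen r (mem_allPerms r) ((hΛ r).1 hr.1) ?_
    have := map_eq_of_mem_minimalLabelings hr hmin
    rw [ColoredFamily.map_map, this, ← ColoredFamily.map_map]
    exact hb.word_eq.symm

end Search

/-! ### Reading the input -/

/-- Cut blocks of length `n` from a word, one for every member of `fuel`. -/
def parseBlocks {α : Type} (n : ℕ) (fuel : List α) (w : List ℕ) : List (List ℕ) × List ℕ :=
  fuel.foldl (fun b _ => (b.1 ++ [b.2.take n], b.2.drop n)) ([], w)

/-- Read the code of a coset. -/
def parseCoset (n : ℕ) (w : List ℕ) : (List ℕ × List (List ℕ)) × List ℕ :=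
  ((w.take n, (parseBlocks n ((w.drop n).tail.take ((w.drop n).headD 0)) (w.drop n).tail).1),
    (parseBlocks n ((w.drop n).tail.take ((w.drop n).headD 0)) (w.drop n).tail).2)

/-- Read the code of a colored coset. -/
def parseMember (n : ℕ) (b : List ((List ℕ × List (List ℕ)) × ℕ) × List ℕ) :
    List ((List ℕ × List (List ℕ)) × ℕ) × List ℕ :=
  (b.1 ++ [((parseCoset n b.2).1, (parseCoset n b.2).2.headD 0)], (parseCoset n b.2).2.tail)

/-- Read the codes of colored cosets. -/
def parseMembers (n : ℕ) (w : List ℕ) : List ((List ℕ × List (List ℕ)) × ℕ) :=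
  ((w.tail.take (w.headD 0)).foldl (fun b _ => parseMember n b) ([], w.tail)).1

section Spec

variable {n : ℕ}

theorem parseBlocks_eq {α : Type} (fuel : List α) (gens : List (Perm (Fin n))) (rest : List ℕ)
    (h : fuel.length = gens.length) :
    parseBlocks n fuel (gens.flatMap permWord ++ rest) = (gens.map permWord, rest) := by
  have key : ∀ (acc : List (List ℕ)),
      fuel.foldl (fun (b : List (List ℕ) × List ℕ) _ => (b.1 ++ [b.2.take n], b.2.drop n))
        (acc, gens.flatMap permWord ++ rest) = (acc ++ gens.map permWord, rest) := by
    induction fuel generalizing gens with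
    | nil =>
      intro acc
      rw [List.length_nil, eq_comm, List.length_eq_zero_iff] at h
      simp [h]
    | cons a fuel ih =>
      intro acc
      obtain ⟨g, gens, rfl⟩ := List.exists_cons_of_length_eq_add_one h.symm
      rw [List.foldl_cons, List.flatMap_cons, List.append_assoc,
        List.take_left' (length_permWord g), List.drop_left' (length_permWord g),
        ih gens (by simpa using h)]
      simp
  exact key []

/-- The content of a code, as words. -/
def CosetCode.untype (c : CosetCode n) : List ℕ × List (List ℕ) :=
  (permWord c.rep, c.gens.map permWord)

theorem length_flatMap_permWord (l : List (Perm (Fin n))) :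
    (l.flatMap permWord).length = l.length * n := by
  simp [List.length_flatMap, length_permWord]

/-- Since loops run over lists, the number of generators is turned into a prefix of that length of
the remaining word. The prefix is long enough because every generator occupies `n > 0` cells, which
is why `n = 0` is treated separately. -/
theorem parseCoset_eq (hn : 0 < n) (c : CosetCode n) (rest : List ℕ) :
    parseCoset n (c.word ++ rest) = (c.untype, rest) := by
  have e : c.word ++ rest =
      permWord c.rep ++ (c.gens.length :: (c.gens.flatMap permWord ++ rest)) := by
    simp [CosetCode.word]
  have hl : c.gens.length ≤ (c.gens.flatMap permWord ++ rest).length := by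
    rw [List.length_append, length_flatMap_permWord]
    exact (Nat.le_mul_of_pos_right _ hn).trans (Nat.le_add_right _ _)
  rw [parseCoset, e, List.take_left' (length_permWord _), List.drop_left' (length_permWord _),
    List.tail_cons, List.headD_cons, parseBlocks_eq _ _ _ (by rw [List.length_take]; omega)]
  rfl

theorem length_coset_word (c : CosetCode n) : c.word.length = n + 1 + c.gens.length * n := by
  rw [CosetCode.word, List.length_append, length_permWord, List.length_cons,
    length_flatMap_permWord]
  omega

theorem parseMembers_eq (hn : 0 < n) (ms : List (CosetCode n × ℕ)) :
    parseMembers n (ms.length :: ms.flatMap fun m => m.1.word ++ [m.2]) =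
      ms.map fun m => (m.1.untype, m.2) := by
  have key : ∀ (fuel : List ℕ) (_ : fuel.length = ms.length) acc,
      (fuel.foldl (fun b _ => parseMember n b)
        (acc, ms.flatMap fun m => m.1.word ++ [m.2])).1 =
        acc ++ ms.map fun m => (m.1.untype, m.2) := by
    intro fuel
    induction fuel generalizing ms with
    | nil =>
      intro h acc
      rw [List.length_nil, eq_comm, List.length_eq_zero_iff] at h
      simp [h]
    | cons a fuel ih =>
      intro h acc
      obtain ⟨m, ms, rfl⟩ := List.exists_cons_of_length_eq_add_one h.symm
      rw [List.foldl_cons, parseMember, List.flatMap_cons, List.append_assoc,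
        parseCoset_eq hn, List.singleton_append, List.headD_cons, List.tail_cons,
        ih ms (by simpa using h)]
      simp
  rw [parseMembers, List.tail_cons, List.headD_cons, key, List.nil_append]
  -- The word of a member contains at least its color, so the rest of the input is long enough to
  -- count the members.
  rw [List.length_take, min_eq_left]
  rw [List.length_flatMap]
  refine le_trans ?_ (List.card_nsmul_le_sum _ 1 ?_)
  · simp
  · intro x hx
    obtain ⟨m, -, rfl⟩ := List.mem_map.1 hx
    simp

end Spec

namespace T

variable {I : Type} {s : I → ℕ} {γ : I → Data}

theorem take {A : I → Type} [∀ i, Enc (A i)] {l : ∀ i, List (A i)} {k : I → ℕ}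
    (hk : T s γ fun i => enc (k i)) (hl : T s γ fun i => enc (l i))
    (hlen : PB s fun i => (l i).length) : T s γ fun i => enc ((l i).take (k i)) :=
  proj₁ (splitAt hk hl hlen)

theorem drop {A : I → Type} [∀ i, Enc (A i)] {l : ∀ i, List (A i)} {k : I → ℕ}
    (hk : T s γ fun i => enc (k i)) (hl : T s γ fun i => enc (l i))
    (hlen : PB s fun i => (l i).length) : T s γ fun i => enc ((l i).drop (k i)) :=
  proj₂ (splitAt hk hl hlen)

variable {n : I → ℕ} {w : I → List ℕ} (hn : T s γ fun i => enc (n i))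
  (hw : T s γ fun i => enc (w i)) (hlen : ∀ i, (w i).length ≤ s i)

include hn hw hlen

theorem parseBlocks {fuel : I → List ℕ} (hf : T s γ fun i => enc (fuel i))
    (hfl : ∀ i, (fuel i).length ≤ s i) :
    T s γ fun i => enc (parseBlocks (n i) (fuel i) (w i)) := by
  refine foldlReach (z := fun i => ([], w i)) (f := fun i b _ => (b.1 ++ [b.2.take (n i)], b.2.drop (n i)))
    hf (mk nil hw) (PB.self.mono hfl) ?_
  have key : ∀ i (l : List ℕ), (l.foldl (fun (b : List (List ℕ) × List ℕ) _ =>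
      (b.1 ++ [b.2.take (n i)], b.2.drop (n i))) ([], w i)).1.length = l.length ∧
      (l.foldl (fun (b : List (List ℕ) × List ℕ) _ =>
      (b.1 ++ [b.2.take (n i)], b.2.drop (n i))) ([], w i)).2.length ≤ (w i).length := by
    intro i l
    induction l using List.reverseRecOn with
    | nil => simp
    | append_singleton l a ih =>
      rw [List.foldl_append]
      simp only [List.foldl_cons, List.foldl_nil, List.length_append, List.length_singleton,
        List.length_drop]
      omega
  let K := FoldIx fun i b a => ∃ l₁ l₂, fuel i = l₁ ++ a :: l₂ ∧ b =
    List.foldl (fun (b : List (List ℕ) × List ℕ) _ =>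
      (b.1 ++ [b.2.take (n i)], b.2.drop (n i))) ([], w i) l₁
  have h1 : PB (fun p : K => s p.i) fun p => p.b.1.length := PB.self.mono fun p => by
    obtain ⟨i, b, a, l₁, l₂, h, rfl⟩ := p
    have := hfl i
    rw [h, List.length_append, List.length_cons] at this
    simp only [key]
    omega
  have h2 : PB (fun p : K => s p.i) fun p => p.b.2.length := PB.self.mono fun p => by
    obtain ⟨i, b, a, l₁, l₂, h, rfl⟩ := p
    exact (key i l₁).2.trans (hlen i)
  exact mk (append (proj₁ acc) (cons (take (hn.wk FoldIx.i) (proj₂ acc) h2) nil) h1)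
    (drop (hn.wk FoldIx.i) (proj₂ acc) h2)

theorem parseCoset : T s γ fun i => enc (parseCoset (n i) (w i)) := by
  have hb := PB.self.mono hlen
  have hd := drop hn hw hb
  have ht := tail hd
  have hl : ∀ i, ((w i).drop (n i)).tail.length ≤ s i := fun i => by
    have := hlen i
    simp only [List.length_tail, List.length_drop]
    omega
  have hB := parseBlocks hn ht hl (take (headD hd (nat 0)) ht (PB.self.mono hl)) fun i =>
    (List.length_take_le' _ _).trans (hl i)
  exact mk (mk (take hn hw hb) (proj₁ hB)) (proj₂ hB)

omit hn hw hlen in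
theorem _root_.length_parseBlocks_le {α : Type} (n : ℕ) (fuel : List α) (w : List ℕ) :
    (_root_.parseBlocks n fuel w).2.length ≤ w.length := by
  rw [_root_.parseBlocks]
  induction fuel using List.reverseRecOn with
  | nil => simp
  | append_singleton l a ih =>
    rw [List.foldl_append]
    simp only [List.foldl_cons, List.foldl_nil, List.length_drop]
    omega

omit hn hw hlen in
theorem _root_.length_parseCoset_le (n : ℕ) (w : List ℕ) :
    (_root_.parseCoset n w).2.length ≤ w.length := by
  rw [_root_.parseCoset]
  refine (length_parseBlocks_le _ _ _).trans ?_
  simp only [List.length_tail, List.length_drop]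
  omega

theorem parseMembers : T s γ fun i => enc (parseMembers (n i) (w i)) := by
  have hl : ∀ i, (w i).tail.length ≤ s i := fun i => by
    have := hlen i
    simp only [List.length_tail]
    omega
  have hfl : ∀ i, ((w i).tail.take ((w i).headD 0)).length ≤ s i := fun i =>
    (List.length_take_le' _ _).trans (hl i)
  refine proj₁ (foldlReach (z := fun i => ([], (w i).tail)) (f := fun i b _ => parseMember (n i) b)
    (take (headD hw (nat 0)) (tail hw) (PB.self.mono hl)) (mk nil (tail hw)) (PB.self.mono hfl) ?_)
  have key : ∀ i (l : List ℕ), (l.foldl (fun b _ => parseMember (n i) b)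
      ([], (w i).tail)).1.length = l.length ∧
      (l.foldl (fun b _ => parseMember (n i) b) ([], (w i).tail)).2.length ≤ (w i).tail.length := by
    intro i l
    induction l using List.reverseRecOn with
    | nil => simp
    | append_singleton l a ih =>
      rw [List.foldl_append]
      simp only [List.foldl_cons, List.foldl_nil, List.length_append, List.length_singleton]
      refine ⟨?_, le_trans ?_ ih.2⟩
      · rw [parseMember, List.length_append, ih.1]; rfl
      · rw [parseMember]
        have := length_parseCoset_le (n i) (l.foldl (fun b _ => parseMember (n i) b) ([], (w i).tail)).2
        rw [List.length_tail]
        omega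
  let K := FoldIx fun i b a => ∃ l₁ l₂, (w i).tail.take ((w i).headD 0) = l₁ ++ a :: l₂ ∧ b =
    List.foldl (fun b _ => parseMember (n i) b) ([], (w i).tail) l₁
  have h1 : PB (fun p : K => s p.i) fun p => p.b.1.length := PB.self.mono fun p => by
    obtain ⟨i, b, a, l₁, l₂, h, rfl⟩ := p
    have := hfl i
    rw [h, List.length_append, List.length_cons] at this
    simp only [key]
    omega
  have h2 : ∀ p : K, p.b.2.length ≤ s p.i := fun p => by
    obtain ⟨i, b, a, l₁, l₂, h, rfl⟩ := p
    exact (key i l₁).2.trans (hl i)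
  have hP := parseCoset (I := K) (γ := fun p => .cons (γ p.i) (.cons (enc p.b) (enc p.a)))
    (hn.wk FoldIx.i) (proj₂ acc) h2
  exact mk (append (proj₁ acc) (cons (mk (proj₁ hP) (headD (proj₂ hP) (nat 0))) nil) h1)
    (tail (proj₂ hP))

end T

instance {n : ℕ} : Enc (CosetCode n) := ⟨fun c => .cons (enc c.rep) (enc c.gens)⟩

/-- The words obtained by parsing are already the trees that encode the typed code, so no conversion
takes place. -/
theorem enc_untype {n : ℕ} (c : CosetCode n) : enc c.untype = enc c := by
  change Data.cons (enc (permWord c.rep)) (enc (c.gens.map permWord)) = _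
  rw [enc_map permWord fun _ => rfl]
  rfl

/-- An input with a nonempty set of points. -/
structure InputIx : Type where
  n : ℕ
  pos : 0 < n
  c : InputCode n

namespace InputIx

/-- The length of the input. -/
def size (i : InputIx) : ℕ := i.c.word.length

/-- The input as a list. -/
def data (i : InputIx) : Data := enc i.c.word

theorem size_eq (i : InputIx) : i.size = 1 + i.c.bound.word.length + 1 +
    (i.c.members.flatMap fun m => m.1.word ++ [m.2]).length := by
  simp only [size, InputCode.word, List.length_cons, List.length_append]
  omega

theorem n_le (i : InputIx) : i.n ≤ i.size := by
  rw [size_eq, length_coset_word]; omega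

theorem gens_le (i : InputIx) : i.c.bound.gens.length ≤ i.size := by
  rw [size_eq, length_coset_word]
  have := Nat.le_mul_of_pos_right i.c.bound.gens.length i.pos
  omega

theorem members_le (i : InputIx) : i.c.members.length ≤ i.size := by
  have : i.c.members.length ≤ (i.c.members.flatMap fun m => m.1.word ++ [m.2]).length := by
    rw [List.length_flatMap]
    refine le_trans ?_ (List.card_nsmul_le_sum _ 1 ?_)
    · simp
    · intro x hx
      obtain ⟨m, -, rfl⟩ := List.mem_map.1 hx
      simp
  rw [size_eq]
  omega

theorem member_gens_le (i : InputIx) {m : CosetCode i.n × ℕ} (hm : m ∈ i.c.members) :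
    m.1.gens.length ≤ i.size := by
  have h : (m.1.word ++ [m.2]).length ≤
      (i.c.members.flatMap fun m => m.1.word ++ [m.2]).length := by
    rw [List.length_flatMap]
    exact List.single_le_sum (fun _ _ => Nat.zero_le _) _ (List.mem_map.2 ⟨m, hm, rfl⟩)
  rw [List.length_append, length_coset_word] at h
  have := Nat.le_mul_of_pos_right m.1.gens.length i.pos
  rw [size_eq]
  omega

theorem T_n : T size data fun i => enc i.n :=
  (T.headD (l := fun i : InputIx => i.c.word) T.self (T.nat 0)).congr fun _ => rfl

/-- The part of the input behind the first number. -/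
theorem T_tail : T size data fun i => enc i.c.word.tail :=
  T.tail (l := fun i : InputIx => i.c.word) T.self

theorem T_coset : T size data fun i => enc (i.c.bound.untype,
    i.c.members.length :: i.c.members.flatMap fun m => m.1.word ++ [m.2]) :=
  (T.parseCoset T_n T_tail fun i => by rw [List.length_tail, size]; omega).congr fun i => by
    rw [← parseCoset_eq i.pos]; rfl

theorem T_bound : T size data fun i => enc i.c.bound :=
  (T.proj₁ T_coset).congr fun _ => enc_untype _

theorem T_members : T size data fun i => enc i.c.members :=
  (T.parseMembers T_n (T.proj₂ T_coset) fun i => by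
    rw [size_eq, List.length_cons]; omega).congr fun i => by
    rw [parseMembers_eq i.pos]
    refine enc_map _ (fun m => ?_) _
    change Data.cons (enc m.1.untype) (enc m.2) = _
    rw [enc_untype]
    rfl

theorem T_rep : T size data fun i => enc i.c.bound.rep := T_bound.fst

theorem T_gens : T size data fun i => enc i.c.bound.gens := T_bound.snd

/-- The table of the representative of `Λ` is used as a list of length `n` to count along. -/
theorem T_range : T size data fun i => enc (List.finRange i.n) :=
  (T.range (l := fun i : InputIx => permWord i.c.bound.rep) T_rep
    (PB.self.mono fun i => by rw [length_permWord]; exact i.n_le)).congr fun i => by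
      rw [length_permWord, ← enc_map (fun x : Fin i.n => (x : ℕ)) (fun _ => rfl)]
      congr 1
      simp

/-- The given lists of generators are used up here, once, in time polynomial in the input length;
the search sees only short tables. -/
theorem T_searchIx : T size data fun i => i.c.searchIx.data := by
  have hn : PB size InputIx.n := PB.self.mono n_le
  have hb := T.build hn T_range T_gens (PB.self.mono gens_le)
  refine T.mk T_range (T.mk T_rep (T.mk hb ?_))
  let K := MemIx fun (i : InputIx) (m : CosetCode i.n × ℕ) => m ∈ i.c.members
  have hm : T (I := K) (fun p => p.i.size) (fun p => .cons p.i.data (enc p.a))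
    fun p => enc p.a := T.elem
  have hg : T (I := K) (fun p => p.i.size) (fun p => .cons p.i.data (enc p.a))
    fun p => enc p.a.1.gens := (T.proj₁ hm).snd
  have hr : T (I := K) (fun p => p.i.size) (fun p => .cons p.i.data (enc p.a))
    fun p => enc p.a.1.rep := (T.proj₁ hm).fst
  have hn' := hn.reindex fun p : K => p.i
  have hR : T (I := K) (fun p => p.i.size) (fun p => .cons p.i.data (enc p.a))
    fun p => enc (List.finRange p.i.n) := T_range.wk MemIx.i
  have hB := T.build hn' hR hg (PB.self.mono fun p => p.i.member_gens_le p.h)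
  exact T.map T_members (PB.self.mono members_le) (T.mk (T.proj₂ hm) (T.mk hr (T.mk hB
    (T.normalWord hn' hR hB ((hn'.mul hn').mono fun p => (slotted_build _).length_le)))))

end InputIx

/-! ### The program -/

/-- The rest `v` of the input `w` stands at the address in register `3`. -/
structure ReadsAt (w v : List ℕ) (n : ℕ) (s : RamState) : Prop where
  mem : s.mem = fun i => w.getD i 0
  reg_one : s.reg 1 = 0
  reg_two : s.reg 2 = n
  split : ∃ u, w = u ++ v ∧ s.reg 3 = u.length

namespace ReadsAt

variable {w v x : List ℕ} {n a : ℕ} {s s' : RamState}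

theorem mem_eq (h : ReadsAt w (a :: v) n s) : s.mem (s.reg 3) = a := by
  obtain ⟨u, hu, h3⟩ := h.split
  rw [h.mem, h3, hu]
  simp

theorem of_reg (h : ReadsAt w v n s) (hm : s'.mem = s.mem) (h1 : s'.reg 1 = s.reg 1)
    (h2 : s'.reg 2 = s.reg 2) (h3 : s'.reg 3 = s.reg 3) : ReadsAt w v n s' :=
  ⟨hm.trans h.mem, h1.trans h.reg_one, h2.trans h.reg_two, by rw [h3]; exact h.split⟩

theorem next (h : ReadsAt w (a :: v) n s) : ReadsAt w v n (s.setReg 3 (s.reg 3 + 1)) := by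
  obtain ⟨u, hu, h3⟩ := h.split
  exact ⟨h.mem, by simpa [RamState.setReg] using h.reg_one,
    by simpa [RamState.setReg] using h.reg_two, u ++ [a], by simp [hu], by simp [h3]⟩

end ReadsAt

/-- Skip a block whose length is in register `2`. -/
def Prog.skipBlock : Prog :=
  .seq (.copy 4 2) (.whileLt 1 4 (.seq (.succ 3) (.pred 4)))

/-- Register `1` is zero, `2` holds `n` and `3` the reading position. Registers `4`, `5` and `6`
count down letters, generators and members, so each level of skipping must respect the counters of
the outer ones. -/
theorem Steps.skipBlock {w v : List ℕ} {n : ℕ} (x : List ℕ) {s : RamState}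
    (h : ReadsAt w (x ++ v) n s) (hx : x.length = n) :
    Steps .skipBlock s (3 * n + 2) fun s' => ReadsAt w v n s' ∧ s'.reg 5 = s.reg 5 ∧
      s'.reg 6 = s.reg 6 := by
  let Q : ℕ → RamState → Prop := fun k s' => s'.reg 4 = k ∧ s'.reg 5 = s.reg 5 ∧
    s'.reg 6 = s.reg 6 ∧ ∃ y, y.length = k ∧ ReadsAt w (y ++ v) n s'
  refine (Steps.seq (K := 1) (L := n * (2 + 1) + 1) (Q := Q 0) (.copy rfl) ?_).mono (by omega) ?_
  · rintro _ rfl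
    refine Steps.whileLt (Inv := Q) ?_ ?_ n _ ?_
    · rintro k s₁ ⟨h4, h5, h6, y, hy, hr⟩
      obtain ⟨a, y, rfl⟩ := List.exists_cons_of_length_eq_add_one hy
      refine ⟨by rw [hr.reg_one, h4]; omega, ?_⟩
      refine .seq (K := 1) (L := 1) (.succ rfl) ?_
      rintro _ rfl
      refine .pred ⟨?_, ?_, ?_, y, by simpa using hy, (ReadsAt.next hr).of_reg rfl ?_ ?_ ?_⟩ <;>
        simp [RamState.setReg, h4, h5, h6]
    · rintro s₁ ⟨h4, -, -, y, hy, hr⟩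
      rw [h4]
      omega
    · refine ⟨?_, ?_, ?_, x, hx, h.of_reg rfl ?_ ?_ ?_⟩ <;> simp [RamState.setReg, h.reg_two]
  · rintro s' ⟨-, h5, h6, y, hy, hr⟩
    rw [List.length_eq_zero_iff] at hy
    subst hy
    exact ⟨hr, h5, h6⟩

/-- Skip the code of a coset. -/
def Prog.skipCoset : Prog :=
  .seq .skipBlock (.seq (.load 5 3) (.seq (.succ 3)
    (.whileLt 1 5 (.seq .skipBlock (.pred 5)))))

theorem Steps.skipCoset {w v : List ℕ} {n : ℕ} (c : CosetCode n) {s : RamState}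
    (h : ReadsAt w (c.word ++ v) n s) :
    Steps .skipCoset s ((c.gens.length + 1) * (3 * n + 5)) fun s' => ReadsAt w v n s' ∧
      s'.reg 6 = s.reg 6 := by
  let Q : ℕ → RamState → Prop := fun k s' => s'.reg 5 = k ∧
    s'.reg 6 = s.reg 6 ∧ ∃ y : List (Perm (Fin n)), y.length = k ∧
      ReadsAt w (y.flatMap permWord ++ v) n s'
  have e : c.word ++ v =
      permWord c.rep ++ (c.gens.length :: (c.gens.flatMap permWord ++ v)) := by
    simp [CosetCode.word]
  rw [e] at h
  refine (Steps.seq (L := 1 + (1 + (c.gens.length * (3 * n + 2 + 1 + 1) + 1))) (Q := Q 0)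
    (Steps.skipBlock _ h (length_permWord _)) ?_).mono ?_ ?_
  · rintro s₁ ⟨h₁, -, h6⟩
    refine .seq (.load rfl) ?_
    rintro _ rfl
    refine .seq (.succ rfl) ?_
    rintro _ rfl
    have hg := h₁.mem_eq
    refine Steps.whileLt (Inv := Q) ?_ ?_ c.gens.length _ ?_
    · rintro k s₂ ⟨h5, h6, y, hy, hr⟩
      obtain ⟨g, y, rfl⟩ := List.exists_cons_of_length_eq_add_one hy
      refine ⟨by rw [hr.reg_one, h5]; omega, ?_⟩
      rw [List.flatMap_cons, List.append_assoc] at hr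
      refine .seq (K := 3 * n + 2) (L := 1) (Steps.skipBlock _ hr (length_permWord _)) ?_
      rintro s₃ ⟨h₃, h5', h6'⟩
      refine .pred ⟨?_, ?_, y, by simpa using hy, h₃.of_reg rfl ?_ ?_ ?_⟩ <;>
        simp [RamState.setReg, h5, h5', h6, h6']
    · rintro s₂ ⟨h5, -, y, hy, hr⟩
      rw [h5]
      omega
    · refine ⟨?_, ?_, c.gens, rfl, (ReadsAt.next h₁).of_reg rfl ?_ ?_ ?_⟩ <;>
        simp [RamState.setReg, hg, h6]
  · have : c.gens.length * (3 * n + 2 + 1 + 1) ≤ c.gens.length * (3 * n + 5) :=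
      Nat.mul_le_mul_left _ (by omega)
    rw [Nat.add_mul]
    omega
  · rintro s' ⟨-, h6, y, hy, hr⟩
    rw [List.length_eq_zero_iff] at hy
    subst hy
    exact ⟨hr, h6⟩

/-- Find the end of the input. -/
def Prog.skipInput : Prog :=
  .seq (.succ 3) (.seq .skipCoset (.seq (.load 6 3) (.seq (.succ 3)
    (.whileLt 1 6 (.seq .skipCoset (.seq (.succ 3) (.pred 6)))))))

/-- A bound on the number of steps of `Prog.skipInput`. -/
def InputIx.skipCost (i : InputIx) : ℕ :=
  1 + ((i.size + 1) * (3 * i.size + 5) + (1 + (1 +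
    (i.size * ((i.size + 1) * (3 * i.size + 5) + (1 + 1) + 1) + 1))))

/-- The heap must start behind the input, whose length is not stored anywhere. Its end is found by
walking through the code. -/
theorem Steps.skipInput (i : InputIx) {s : RamState} (h : ReadsAt i.c.word i.c.word i.n s) :
    Steps .skipInput s i.skipCost fun s' => ReadsAt i.c.word [] i.n s' := by
  let Q : ℕ → RamState → Prop := fun k s' => s'.reg 6 = k ∧ ∃ y : List (CosetCode i.n × ℕ),
    y.length = k ∧ (∀ m ∈ y, m ∈ i.c.members) ∧
      ReadsAt i.c.word (y.flatMap fun m => m.1.word ++ [m.2]) i.n s'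
  have hcost : ∀ g, g ≤ i.size → (g + 1) * (3 * i.n + 5) ≤ (i.size + 1) * (3 * i.size + 5) := by
    intro g hg
    have := i.n_le
    exact Nat.mul_le_mul (by omega) (by omega)
  have hmem := i.members_le
  refine (Steps.seq (K := 1) (L := (i.size + 1) * (3 * i.size + 5) + (1 + (1 +
    (i.c.members.length * ((i.size + 1) * (3 * i.size + 5) + (1 + 1) + 1) + 1)))) (Q := Q 0)
    (.succ rfl) ?_).mono ?_ ?_
  · rintro _ rfl
    refine .seq ((Steps.skipCoset i.c.bound (ReadsAt.next h)).mono (hcost _ i.gens_le)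
      fun _ h => h) ?_
    rintro s₁ ⟨h₁, -⟩
    refine .seq (.load rfl) ?_
    rintro _ rfl
    refine .seq (.succ rfl) ?_
    rintro _ rfl
    have hg := h₁.mem_eq
    refine Steps.whileLt (Inv := Q) ?_ ?_ i.c.members.length _ ?_
    · rintro k s₂ ⟨h6, y, hy, hsub, hr⟩
      obtain ⟨m, y, rfl⟩ := List.exists_cons_of_length_eq_add_one hy
      refine ⟨by rw [hr.reg_one, h6]; omega, ?_⟩
      rw [List.flatMap_cons, List.append_assoc] at hr
      refine .seq (L := 1 + 1) ((Steps.skipCoset _ hr).mono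
        (hcost _ (i.member_gens_le (hsub m (by simp)))) fun _ h => h) ?_
      rintro s₃ ⟨h₃, h6'⟩
      refine .seq (K := 1) (L := 1) (.succ rfl) ?_
      rintro _ rfl
      refine .pred ⟨?_, y, by simpa using hy, fun m hm => hsub m (by simp [hm]),
        (ReadsAt.next h₃).of_reg rfl ?_ ?_ ?_⟩ <;> simp [RamState.setReg, h6, h6']
    · rintro s₂ ⟨h6, y, hy, hr⟩
      rw [h6]
      omega
    · refine ⟨?_, i.c.members, rfl, fun _ h => h, (ReadsAt.next h₁).of_reg rfl ?_ ?_ ?_⟩ <;>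
        simp [RamState.setReg, hg]
  · have := Nat.mul_le_mul_right ((i.size + 1) * (3 * i.size + 5) + (1 + 1) + 1) hmem
    rw [InputIx.skipCost]
    omega
  · rintro s' ⟨-, y, hy, -, hr⟩
    rw [List.length_eq_zero_iff] at hy
    subst hy
    exact hr

/-- Turn the word below the address in register `3` into a list in register `4`. -/
def Prog.readList : Prog :=
  .seq (.copy 0 3) (.seq (.zero 4)
    (.whileLt 1 3 (.seq (.pred 3) (.seq (.load 5 3) (.seq (.alloc 6 5 4) (.copy 4 6))))))

/-- The heap starts at the end of the input, which is positive as the input is not empty. The list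
is built from its last letter on, so that each new cell points to a finished tail, and the input
below remains intact. -/
theorem Steps.readList {w : List ℕ} {n : ℕ} {s : RamState} (h : ReadsAt w [] n s)
    (hw : w ≠ []) :
    Steps .readList s (w.length * 9 + 3) fun s' => 0 < s'.reg 0 ∧ s'.reg 1 = 0 ∧
      Holds s' 4 (enc w) := by
  have hpos := List.length_pos_iff.2 hw
  obtain ⟨u, hu, h3⟩ := h.split
  rw [List.append_nil] at hu
  subst hu
  let Q : ℕ → RamState → Prop := fun k s' => s'.reg 1 = 0 ∧ s'.reg 3 = k ∧ k ≤ w.length ∧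
    w.length ≤ s'.reg 0 ∧ (∀ j < w.length, s'.mem j = w.getD j 0) ∧ Holds s' 4 (enc (w.drop k))
  refine (Steps.seq (K := 1) (L := 1 + (w.length * (8 + 1) + 1)) (Q := Q 0) (.copy rfl) ?_).mono
    (by omega) ?_
  · rintro _ rfl
    refine .seq (.zero rfl) ?_
    rintro _ rfl
    refine Steps.whileLt (Inv := Q) ?_ ?_ w.length _ ?_
    · rintro k s₁ ⟨h1, h3, hk, h0, hm, hH⟩
      refine ⟨by omega, ?_⟩
      refine .seq (K := 1) (L := 7) (.pred rfl) ?_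
      rintro _ rfl
      refine .seq (K := 1) (L := 6) (.load rfl) ?_
      rintro _ rfl
      have hF : Frame 3 s₁ ((s₁.setReg 3 (s₁.reg 3 - 1)).setReg 5
          ((s₁.setReg 3 (s₁.reg 3 - 1)).mem ((s₁.setReg 3 (s₁.reg 3 - 1)).reg 3))) :=
        (Frame.setReg (m := 3) (by omega)).trans
          (Frame.setReg (m := 3) (by simp [RamState.setReg]; omega)) (k := 3)
      have h5 : Holds ((s₁.setReg 3 (s₁.reg 3 - 1)).setReg 5
          ((s₁.setReg 3 (s₁.reg 3 - 1)).mem ((s₁.setReg 3 (s₁.reg 3 - 1)).reg 3))) 5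
          (enc (w.getD k 0)) := by
        refine .setReg_self ?_
        have := hm k (by omega)
        change _ = w.getD k 0
        simpa [RamState.setReg, h3] using this
      have h4 : Holds ((s₁.setReg 3 (s₁.reg 3 - 1)).setReg 5
          ((s₁.setReg 3 (s₁.reg 3 - 1)).mem ((s₁.setReg 3 (s₁.reg 3 - 1)).reg 3))) 4
          (enc (w.drop (k + 1))) := .setReg_ne (.setReg_ne hH)
      refine .seq (L := 1) (Steps.alloc hF.pos' h5 h4) ?_
      rintro s₃ ⟨hF₃, h6⟩
      refine .copy ⟨?_, ?_, by omega, ?_, fun j hj => ?_, ?_⟩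
      · have := hF₃.reg 1 (by omega) (by omega)
        simpa [RamState.setReg, h1] using this
      · have := hF₃.reg 3 (by omega) (by omega)
        simpa [RamState.setReg, h3] using this
      · have := hF.hp.trans hF₃.hp
        simp only [RamState.setReg_reg_ne _ _ (show (0 : ℕ) ≠ 4 by omega)]
        omega
      · have h1 := hF.mem j (by omega)
        have h2 := hF₃.mem j (hj.trans_le (h0.trans hF.hp))
        exact h2.trans (h1.trans (hm j hj))
      · refine .setReg_self ?_
        have e : w.drop k = w.getD k 0 :: w.drop (k + 1) := by
          rw [List.drop_eq_getElem_cons (by omega), List.getD_eq_getElem _ _ (by omega)]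
        rw [e]
        exact h6
    · rintro s₁ ⟨h1, h3, -⟩
      omega
    · refine ⟨?_, ?_, le_rfl, ?_, ?_, ?_⟩
      · simpa [RamState.setReg] using h.reg_one
      · simpa [RamState.setReg] using h3
      · simp [RamState.setReg, h3]
      · intro j _
        exact congrFun h.mem j
      · rw [List.drop_length]
        exact .setReg_self rfl
  · rintro s' ⟨h1, -, -, h0, -, hH⟩
    exact ⟨by omega, h1, hH⟩

/-- Write the list in register `4` into the free memory. -/
def Prog.writeList : Prog :=
  .seq (.copy 2 0) (.seq (.whileLt 1 4 (.seq (.load 5 4) (.seq (.store 0 5) (.seq (.succ 0)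
    (.seq (.succ 4) (.load 4 4)))))) (.copy 0 2))

/-- The list lies below the heap pointer `H` and the output is written from `H` upwards, so the
unread part is never destroyed. Register `2` remembers `H` and returns it as the address of the
output. -/
theorem Steps.writeList {w : List ℕ} {s : RamState} (h1 : s.reg 1 = 0) (hH : Holds s 4 (enc w)) :
    Steps .writeList s (w.length * 6 + 3) fun s' => HoldsOutput s' w := by
  let H := s.reg 0
  let Q : ℕ → RamState → Prop := fun k s' => s'.reg 1 = 0 ∧ s'.reg 2 = H ∧ ∃ l₁ l₂,
    w = l₁ ++ l₂ ∧ l₂.length = k ∧ s'.reg 0 = H + l₁.length ∧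
      TreeAt s'.mem H (s'.reg 4) (enc l₂) ∧ ∀ j < l₁.length, s'.mem (H + j) = l₁.getD j 0
  refine (Steps.seq (K := 1) (L := (w.length * (5 + 1) + 1) + 1) (.copy rfl) ?_).mono (by omega)
    fun _ h => h
  rintro _ rfl
  refine .seq (R := Q 0) (Steps.whileLt (Inv := Q) ?_ ?_ w.length _ ?_) ?_
  · rintro k s₁ ⟨h1, h2, l₁, l₂, hl, hk, h0, ht, hm⟩
    obtain ⟨a, l₂, rfl⟩ := List.exists_cons_of_length_eq_add_one hk
    obtain ⟨hp, hlt, ha, ht'⟩ := ht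
    refine ⟨by omega, ?_⟩
    refine .seq (K := 1) (L := 4) (.load rfl) ?_
    rintro _ rfl
    refine .seq (K := 1) (L := 3) (.store rfl) ?_
    rintro _ rfl
    refine .seq (K := 1) (L := 2) (.succ rfl) ?_
    rintro _ rfl
    refine .seq (K := 1) (L := 1) (.succ rfl) ?_
    rintro _ rfl
    have ha' : s₁.mem (s₁.reg 4) = a := ha
    refine .load ⟨?_, ?_, l₁ ++ [a], l₂, by simp [hl], by simpa using hk, ?_, ?_, ?_⟩
    · simpa [RamState.setReg, RamState.setMem] using h1
    · simpa [RamState.setReg, RamState.setMem] using h2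
    · simp [RamState.setReg, RamState.setMem, h0]
      omega
    · have hne : s₁.reg 4 + 1 ≠ s₁.reg 0 := by omega
      have : TreeAt (Function.update s₁.mem (s₁.reg 0) a) H (s₁.mem (s₁.reg 4 + 1)) (enc l₂) :=
        TreeAt.mono le_rfl (fun b hb => Function.update_of_ne (by omega) _ _) ht'
      simpa [RamState.setReg, RamState.setMem, ha', Function.update_of_ne hne] using this
    · intro j hj
      rw [List.length_append, List.length_singleton] at hj
      simp only [RamState.setReg, RamState.setMem]
      rcases Nat.lt_succ_iff_lt_or_eq.1 hj with hj | rfl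
      · have hne : H + j ≠ s₁.reg 0 := by omega
        have := hm j hj
        rw [List.getD_append _ _ _ _ hj, ← this]
        simp [Function.update_of_ne hne]
      · simp [h0, ha']
  · rintro s₁ ⟨h1, h2, l₁, l₂, hl, hk, h0, ht, hm⟩
    rw [List.length_eq_zero_iff] at hk
    subst hk
    have : s₁.reg 4 = 0 := ht
    omega
  · refine ⟨?_, ?_, [], w, rfl, rfl, ?_, ?_, by simp⟩
    · simpa [RamState.setReg] using h1
    · simp [RamState.setReg, H]
    · simp [RamState.setReg, H]
    · exact hH
  · rintro s₁ ⟨h1, h2, l₁, l₂, hl, hk, h0, ht, hm⟩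
    rw [List.length_eq_zero_iff] at hk
    subst hk
    rw [List.append_nil] at hl
    subst hl
    refine .copy fun j => ?_
    have := hm j j.2
    rw [List.getD_eq_getElem _ _ j.2] at this
    simpa [RamState.setReg, h2] using this

theorem readsAt_start {n : ℕ} (c : InputCode n) :
    Steps (.seq (.zero 1) (.load 2 1)) (initialState c.word) 2
      fun s => ReadsAt c.word c.word n s ∧ s.reg 0 = 0 := by
  refine .seq (K := 1) (L := 1) (.zero rfl) ?_
  rintro _ rfl
  refine .load ⟨⟨?_, ?_, ?_, [], rfl, ?_⟩, ?_⟩ <;>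
    simp [RamState.setReg, initialState, InputCode.word]

/-- The length of the output. -/
theorem InputIx.length_out_le (i : InputIx) :
    i.c.out.word.length ≤ i.size + 1 + i.size * i.size * i.size := by
  rw [length_coset_word]
  have h1 := i.n_le
  have h2 : i.c.out.gens.length ≤ i.n * i.n := i.c.searchIx.length_gens_out
  have h3 := Nat.mul_le_mul (h2.trans (Nat.mul_le_mul h1 h1)) h1
  omega

theorem PB.skipCost : PB InputIx.size InputIx.skipCost := by
  have h : PB InputIx.size fun i => (i.size + 1) * (3 * i.size + 5) :=
    (PB.self.add (.const 1)).mul (((PB.const 3).mul PB.self).add (.const 5))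
  exact (PB.const 1).add (h.add ((PB.const 1).add ((PB.const 1).add
    ((PB.self.mul (h.add (.const (1 + 1)) |>.add (.const 1))).add (.const 1)))))

/-- On every input with a nonempty set of points the machine finds the output. -/
theorem exists_prog : ∃ (P : Prog) (d : ℕ), ∀ i : InputIx, ∀ s : RamState,
    ReadsAt i.c.word i.c.word i.n s →
    Steps P s (i.n.factorial * (i.n + i.c.members.length + 2) ^ d + (i.size + 2) ^ d)
      fun s' => HoldsOutput s' i.c.out.word := by
  -- The cost `c₁` is measured in the input length, and `c₂` in `n + |F|` with the factor `n!`
  -- apart. Everything else is polynomial in the input length and goes into `d`.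
  obtain ⟨c₁, hc₁, p, hp⟩ := InputIx.T_searchIx
  obtain ⟨c₂, ⟨d₂, hc₂⟩, q, hq⟩ := TF_out
  obtain ⟨d, hd⟩ : PB InputIx.size fun i => i.skipCost + (i.size * 9 + 3) + c₁ i +
      ((i.size + 1 + i.size * i.size * i.size) * 6 + 3) :=
    ((PB.skipCost.add ((PB.self.mul (.const 9)).add (.const 3))).add hc₁).add
      ((((PB.self.add (.const 1)).add ((PB.self.mul PB.self).mul PB.self)).mul (.const 6)).add
        (.const 3))
  refine ⟨.seq .skipInput (.seq .readList (.seq (p 4) (.seq (q 4) .writeList))), d + d₂,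
    fun i s hs => ?_⟩
  refine (Steps.seq (L := i.size * 9 + 3 + (c₁ i + (i.n.factorial * c₂ i.c.searchIx +
    (i.c.out.word.length * 6 + 3)))) (Steps.skipInput i hs) ?_).mono ?_ fun _ h => h
  · intro s₁ h₁
    refine .seq (Steps.readList h₁ (by simp [InputCode.word])) ?_
    rintro s₂ ⟨h0, h1, hH⟩
    refine .seq (hp i 4 s₂ (by omega) h0 hH) ?_
    rintro s₃ ⟨hf₃, h₃⟩
    refine .seq (hq i.c.searchIx 4 s₃ (by omega) hf₃.pos' h₃) ?_
    rintro s₄ ⟨hf₄, h₄⟩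
    refine Steps.writeList ?_ h₄
    -- Both programs work from register `4` on and leave the zero in register `1` in place.
    rw [hf₄.reg 1 (by omega) (by omega), hf₃.reg 1 (by omega) (by omega), h1]
  · have e : i.c.searchIx.size = i.n + i.c.members.length := by
      change i.n + i.c.memberData.length = _
      rw [InputCode.memberData, List.length_map]
    have h1 := hc₂ i.c.searchIx
    rw [e] at h1
    have h2 : (i.n + i.c.members.length + 2) ^ d₂ ≤ (i.n + i.c.members.length + 2) ^ (d + d₂) :=
      Nat.pow_le_pow_right (by omega) (by omega)
    have h3 : (i.size + 2) ^ d ≤ (i.size + 2) ^ (d + d₂) :=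
      Nat.pow_le_pow_right (by omega) (by omega)
    have h4 := Nat.mul_le_mul_left i.n.factorial (h1.trans h2)
    have h5 := hd i
    beta_reduce at h5
    have h6 := i.length_out_le
    omega

/-- On the empty set there is one labeling, and both cosets contain it. -/
theorem toCoset_eq_of_zero {V : Type u} {ν : V ≃ Fin 0} (c : CosetCode 0) (X : ColoredFamily V 0)
    (Λ : LabelingCoset V 0) : c.toCoset ν = canonicalLabeling X Λ := by
  have hV : IsEmpty V := ν.isEmpty
  ext ρ
  constructor
  · intro _
    obtain ⟨π, hπ⟩ := minimalLabelings_nonempty X Λ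
    rwa [Subsingleton.elim ρ π]
  · intro _
    exact ⟨1, one_mem _, Subsingleton.elim _ _⟩

theorem mainTheorem9 :
    ∃ CL : ∀ (V : Type u) (n : ℕ),
        ColoredFamily V n → LabelingCoset V n → LabelingCoset V n,
      IsCanonicalLabeling CL ∧
      ∃ (P : Prog) (d : ℕ),
        ∀ (V : Type u) (n : ℕ) (ν : V ≃ Fin n) (X : ColoredFamily V n) (Λ : LabelingCoset V n)
          (c : InputCode n), c.Encodes ν X Λ →
          ∃ (k : ℕ) (s : RamState) (out : CosetCode n),
            Exec P (initialState c.word) k s ∧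
            HoldsOutput s out.word ∧
            out.toCoset ν = CL V n X Λ ∧
            out.gens.length ≤ (n + 2) ^ d ∧
            k ≤ n.factorial * (n + X.card + 2) ^ d + (c.word.length + 2) ^ d := by
  refine ⟨fun _ _ X Λ => canonicalLabeling X Λ, isCanonicalLabeling, ?_⟩
  obtain ⟨P, d, hP⟩ := exists_prog
  -- The first input cell is `n`; the branch `n = 0` merely sets the output address to zero.
  refine ⟨.seq (.seq (.zero 1) (.load 2 1)) (.ifLt 1 2 P (.zero 0)), d + 2, ?_⟩
  intro V n ν X Λ c hc
  have hlen : 1 ≤ c.word.length := by simp [InputCode.word]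
  -- Raising the exponent by two pays for the at most four additional steps and also covers the `n *
  -- n` generators of the output.
  have hpow : (c.word.length + 2) ^ d + 4 ≤ (c.word.length + 2) ^ (d + 2) := by
    have h1 : 1 ≤ (c.word.length + 2) ^ d := Nat.one_le_pow _ _ (by omega)
    have h2 : 9 ≤ (c.word.length + 2) ^ 2 := (Nat.pow_le_pow_left (by omega : 3 ≤ _) 2)
    have h3 := Nat.mul_le_mul_left ((c.word.length + 2) ^ d) h2
    rw [pow_add]
    omega
  rcases Nat.eq_zero_or_pos n with rfl | hn
  · have h : Steps (.seq (.seq (.zero 1) (.load 2 1)) (.ifLt 1 2 P (.zero 0)))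
        (initialState c.word) 4 fun s => HoldsOutput s (CosetCode.mk (n := 0) 1 []).word := by
      refine .seq (K := 2) (L := 2) (readsAt_start c) ?_
      rintro s ⟨h, h0⟩
      refine .ifLt (K := 1) (fun hlt => ?_) (fun _ => .zero ?_)
      · rw [h.reg_one, h.reg_two] at hlt
        omega
      -- The output consists of an empty table and the number zero of generators. This word already
      -- stands at address `0`, since the input begins with `n = 0`.
      · have e : (CosetCode.mk (n := 0) 1 []).word = [0] := by simp [CosetCode.word, permWord]
        have hm : s.mem 0 = 0 := by simpa [InputCode.word] using congrFun h.mem 0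
        rw [e]
        intro j
        rw [Fin.fin_one_eq_zero j]
        simpa using hm
    obtain ⟨k, s, he, hk, hs⟩ := h
    exact ⟨k, s, ⟨1, []⟩, he, hs, toCoset_eq_of_zero _ _ _, by simp, by omega⟩
  · have h : Steps (.seq (.seq (.zero 1) (.load 2 1)) (.ifLt 1 2 P (.zero 0)))
        (initialState c.word) (2 + ((n.factorial * (n + c.members.length + 2) ^ d +
          (c.word.length + 2) ^ d) + 1)) fun s => HoldsOutput s c.out.word := by
      refine .seq (readsAt_start c) ?_
      rintro s ⟨h, h0⟩
      refine .ifLt (fun _ => hP ⟨n, hn, c⟩ s h) (fun hlt => ?_)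
      rw [h.reg_one, h.reg_two] at hlt
      exact absurd hn hlt
    obtain ⟨k, s, he, hk, hs⟩ := h
    refine ⟨k, s, c.out, he, hs, hc.toCoset_out, ?_, ?_⟩
    · have h1 : c.out.gens.length ≤ n * n := c.searchIx.length_gens_out
      have h2 : (n + 2) ^ 2 ≤ (n + 2) ^ (d + 2) := Nat.pow_le_pow_right (by omega) (by omega)
      have h3 : n * n ≤ (n + 2) ^ 2 := by nlinarith
      omega
    · rw [hc.card_eq]
      have h1 : (n + c.members.length + 2) ^ d ≤ (n + c.members.length + 2) ^ (d + 2) :=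
        Nat.pow_le_pow_right (by omega) (by omega)
      have h2 := Nat.mul_le_mul_left n.factorial h1
      omega
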